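/- Let $Q$ be a finite symmetric quiver with vertex set $Q_0$ and incidence matrix $(m_{ij})_{i,j\in Q_0}$ (so $m_{ij}=m_{ji}$ is the number of arrows from $i$ to $j$). Let $\mathcal{A}_Q$ be the associative unital $\mathbb{Q}$-algebra with generators $e_{i,k}$ ($i\in Q_0$, $k\ge 0$) and the following relations, where $e_i(z)=\sum_{k\ge 0}e_{i,k}z^k$: all coefficients of $$e_i(z)e_j(w)-(-1)^{m_{ii}m_{jj}}e_j(w)e_i(z)\quad (i,j\in Q_0),\qquad e_i(z)\,\frac{d^p}{dz^p}e_j(z)\quad (i,j\in Q_0,\ 0\le p<m_{ij})$$ vanish. It is graded by $\mathbb{Z}^{Q_0}\times\mathbb{Z}$ with $\deg e_{i,k}=(\alpha_i,-2k-m_{ii})$, where $(\alpha_i)$ is the standard basis of $\mathbb{Z}^{Q_0}$. Let $a\ne b$ be vertices of $Q$. Let $Q^{\mathrm{linked}}$ be the quiver with vertex set $Q_0\sqcup\{\diamond\}$ whose symmetric incidence matrix $m^{\mathrm{linked}}$ is given by $m^{\mathrm{linked}}_{ab}=m^{\mathrm{linked}}_{ba}=m_{ab}+1$, $m^{\mathrm{linked}}_{i\diamond}=m^{\mathrm{linked}}_{\diamond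 i}=m_{ia}+m_{ib}$ for all $i\in Q_0$, $m^{\mathrm{linked}}_{\diamond\diamond}=m_{aa}+m_{bb}+2m_{ab}$, and $m^{\mathrm{linked}}_{ij}=m_{ij}$ for all other $i,j\in Q_0$. In $\mathcal{A}_Q$ put $e_\diamond(z)=\sum_{k\ge0}e_{\diamond,k}z^k:=e_a(z)\,\frac{d^{m_{ab}}}{dz^{m_{ab}}}e_b(z)$. For $p\ge 0$ let $F_p\mathcal{A}_Q$ be the $\mathbb{Q}$-span of all products of at most $p$ elements (the empty product being $1$) of the set $\{e_{i,k}: i\in Q_0,\ k\ge0\}\cup\{e_{\diamond,k}: k\ge0\}$, let $F_{-1}\mathcal{A}_Q=0$, and let $\mathrm{gr}_F\mathcal{A}_Q=\bigoplus_{p\ge0}F_p\mathcal{A}_Q/F_{p-1}\mathcal{A}_Q$ be the associated graded algebra. **Theorem.** There is a unique homomorphism of unital $\mathbb{Q}$-algebras $$\pi_{\mathrm{linked}}\colon\mathcal{A}_{Q^{\mathrm{linked}}}\to\mathrm{gr}_F\mathcal{A}_Q$$ that sends each generator $e_{i,k}$ ($i\in Q_0$) and each generator $e_{\diamond,k}$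 to the class in $F_1\mathcal{A}_Q/F_0\mathcal{A}_Q$ of the element of $\mathcal{A}_Q$ of the same name, and $\pi_{\mathrm{linked}}$ is an isomorphism. It respects the gradings: for each $p$ it maps the span of the words of length $p$ in the generators onto $F_p\mathcal{A}_Q/F_{p-1}\mathcal{A}_Q$, and, for the $\mathbb{Z}^{Q_0}\times\mathbb{Z}$-grading of $\mathcal{A}_{Q^{\mathrm{linked}}}$ with $\deg e_{i,k}=(\alpha_i,-2k-m^{\mathrm{linked}}_{ii})$ for $i\in Q_0$ and $\deg e_{\diamond,k}=(\alpha_a+\alpha_b,-2k-m^{\mathrm{linked}}_{\diamond\diamond})$, it maps each homogeneous component onto the component of the same degree of $\mathrm{gr}_F\mathcal{A}_Q$, that is, onto the direct sum over $p$ of the images in $F_p\mathcal{A}_Q/F_{p-1}\mathcal{A}_Q$ of the intersections of $F_p\mathcal{A}_Q$ with the corresponding component of $\mathcal{A}_Q$. -/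

import Mathlib

noncomputable section

namespace QuiverLinking

open scoped DirectSum

universe u v w

/-! ### Associated graded algebra of a filtered algebra -/

/-- An increasing multiplicative filtration `F 0 ⊆ F 1 ⊆ …` of an algebra by submodules,
with the convention `F (-1) = 0`. -/
structure AlgFiltration (R : Type u) (A : Type v) [CommRing R] [Ring A] [Algebra R A] where
  F : ℕ → Submodule R A
  mono : Monotone F
  one_mem : (1 : A) ∈ F 0
  mul_mem : ∀ {p q : ℕ} {x y : A}, x ∈ F p → y ∈ F q → x * y ∈ F (p + q)

namespace AlgFiltration

variable {R : Type u} {A : Type v} [CommRing R] [Ring A] [Algebra R A]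

/-- The component preceding `F p`, that is `F (p - 1)`, with `F (-1) = 0`. -/
def pred (𝓕 : AlgFiltration R A) : ℕ → Submodule R A
  | 0 => ⊥
  | p + 1 => 𝓕.F p

theorem mul_mem_pred_left (𝓕 : AlgFiltration R A) {p q : ℕ} {x y : A}
    (hx : x ∈ 𝓕.pred p) (hy : y ∈ 𝓕.F q) : x * y ∈ 𝓕.pred (p + q) := by
  cases p with
  | zero =>
    have h0 : x = 0 := by simpa [pred] using hx
    simp [h0]
  | succ p =>
    have h := 𝓕.mul_mem (show x ∈ 𝓕.F p from hx) hy
    rw [Nat.succ_add]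
    exact h

theorem mul_mem_pred_right (𝓕 : AlgFiltration R A) {p q : ℕ} {x y : A}
    (hx : x ∈ 𝓕.F p) (hy : y ∈ 𝓕.pred q) : x * y ∈ 𝓕.pred (p + q) := by
  cases q with
  | zero =>
    have h0 : y = 0 := by simpa [pred] using hy
    simp [h0]
  | succ q => exact 𝓕.mul_mem hx (show y ∈ 𝓕.F q from hy)

/-- The graded piece `F p / F (p - 1)`. -/
def Piece (𝓕 : AlgFiltration R A) (p : ℕ) : Type v :=
  (𝓕.F p) ⧸ (𝓕.pred p).comap (𝓕.F p).subtype

instance instAddCommGroupPiece (𝓕 : AlgFiltration R A) (p : ℕ) : AddCommGroup (𝓕.Piece p) :=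
  inferInstanceAs (AddCommGroup ((𝓕.F p) ⧸ (𝓕.pred p).comap (𝓕.F p).subtype))

instance instModulePiece (𝓕 : AlgFiltration R A) (p : ℕ) : Module R (𝓕.Piece p) :=
  inferInstanceAs (Module R ((𝓕.F p) ⧸ (𝓕.pred p).comap (𝓕.F p).subtype))

/-- The projection `F p → F p / F (p - 1)`. -/
def toPiece (𝓕 : AlgFiltration R A) (p : ℕ) : 𝓕.F p →ₗ[R] 𝓕.Piece p :=
  ((𝓕.pred p).comap (𝓕.F p).subtype).mkQ

theorem toPiece_surjective (𝓕 : AlgFiltration R A) (p : ℕ) :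
    Function.Surjective (𝓕.toPiece p) :=
  Submodule.mkQ_surjective _

theorem toPiece_eq_zero (𝓕 : AlgFiltration R A) (p : ℕ) (x : 𝓕.F p) :
    𝓕.toPiece p x = 0 ↔ (x : A) ∈ 𝓕.pred p :=
  Submodule.Quotient.mk_eq_zero _

/-- The bilinear map `(x, y) ↦ [x * y]`. -/
def mulAux (𝓕 : AlgFiltration R A) (p q : ℕ) :
    𝓕.F p →ₗ[R] 𝓕.F q →ₗ[R] 𝓕.Piece (p + q) :=
  LinearMap.mk₂ R
    (fun x y => 𝓕.toPiece (p + q) ⟨(x : A) * (y : A), 𝓕.mul_mem x.2 y.2⟩)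
    (fun x x' y => by
      rw [← map_add]; congr 1; ext; simp [add_mul])
    (fun c x y => by
      rw [← map_smul]; congr 1; ext; simp)
    (fun x y y' => by
      rw [← map_add]; congr 1; ext; simp [mul_add])
    (fun c x y => by
      rw [← map_smul]; congr 1; ext; simp)

def mulAuxLeft (𝓕 : AlgFiltration R A) (p q : ℕ) :
    𝓕.Piece p →ₗ[R] 𝓕.F q →ₗ[R] 𝓕.Piece (p + q) :=
  Submodule.liftQ _ (𝓕.mulAux p q) (by
    intro x hx
    rw [LinearMap.mem_ker]
    ext y
    exact (𝓕.toPiece_eq_zero _ _).2 (𝓕.mul_mem_pred_left hx y.2))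

/-- The product `F p / F (p - 1) × F q / F (q - 1) → F (p + q) / F (p + q - 1)`
induced by the product of `A`. -/
def pieceMul (𝓕 : AlgFiltration R A) (p q : ℕ) :
    𝓕.Piece p →ₗ[R] 𝓕.Piece q →ₗ[R] 𝓕.Piece (p + q) :=
  (Submodule.liftQ _ (𝓕.mulAuxLeft p q).flip (by
    intro y hy
    rw [LinearMap.mem_ker]
    ext x
    obtain ⟨x, rfl⟩ := 𝓕.toPiece_surjective p x
    exact (𝓕.toPiece_eq_zero _ _).2 (𝓕.mul_mem_pred_right x.2 hy))).flip

theorem pieceMul_toPiece (𝓕 : AlgFiltration R A) (p q : ℕ) (x : 𝓕.F p) (y : 𝓕.F q) :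
    𝓕.pieceMul p q (𝓕.toPiece p x) (𝓕.toPiece q y) =
      𝓕.toPiece (p + q) ⟨(x : A) * (y : A), 𝓕.mul_mem x.2 y.2⟩ := rfl

theorem mk_toPiece_eq (𝓕 : AlgFiltration R A) {p q : ℕ} (h : p = q) (x : 𝓕.F p) (y : 𝓕.F q)
    (hxy : (x : A) = (y : A)) :
    (GradedMonoid.mk p (𝓕.toPiece p x) : GradedMonoid 𝓕.Piece) =
      GradedMonoid.mk q (𝓕.toPiece q y) := by
  subst h
  rw [Subtype.ext hxy]

instance instGMul (𝓕 : AlgFiltration R A) : GradedMonoid.GMul 𝓕.Piece where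
  mul := fun {p q} x y => 𝓕.pieceMul p q x y

instance instGOne (𝓕 : AlgFiltration R A) : GradedMonoid.GOne 𝓕.Piece where
  one := 𝓕.toPiece 0 ⟨1, 𝓕.one_mem⟩

theorem mk_mul_mk (𝓕 : AlgFiltration R A) (p q : ℕ) (x : 𝓕.F p) (y : 𝓕.F q) :
    (GradedMonoid.mk p (𝓕.toPiece p x) * GradedMonoid.mk q (𝓕.toPiece q y) :
      GradedMonoid 𝓕.Piece) =
      GradedMonoid.mk (p + q)
        (𝓕.toPiece (p + q) ⟨(x : A) * (y : A), 𝓕.mul_mem x.2 y.2⟩) := rfl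

theorem one_eq_mk (𝓕 : AlgFiltration R A) :
    (1 : GradedMonoid 𝓕.Piece) = GradedMonoid.mk 0 (𝓕.toPiece 0 ⟨1, 𝓕.one_mem⟩) := rfl

instance instGMonoid (𝓕 : AlgFiltration R A) : GradedMonoid.GMonoid 𝓕.Piece where
  one_mul := by
    rintro ⟨p, x⟩
    obtain ⟨x, rfl⟩ := 𝓕.toPiece_surjective p x
    exact 𝓕.mk_toPiece_eq (by simp) _ _ (by simp)
  mul_one := by
    rintro ⟨p, x⟩
    obtain ⟨x, rfl⟩ := 𝓕.toPiece_surjective p x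
    exact 𝓕.mk_toPiece_eq (by simp) _ _ (by simp)
  mul_assoc := by
    rintro ⟨p, x⟩ ⟨q, y⟩ ⟨r, z⟩
    obtain ⟨x, rfl⟩ := 𝓕.toPiece_surjective p x
    obtain ⟨y, rfl⟩ := 𝓕.toPiece_surjective q y
    obtain ⟨z, rfl⟩ := 𝓕.toPiece_surjective r z
    exact 𝓕.mk_toPiece_eq (add_assoc p q r) _ _ (mul_assoc (x : A) y z)

instance instGRing (𝓕 : AlgFiltration R A) : DirectSum.GRing 𝓕.Piece where
  __ := instGMonoid 𝓕
  mul_zero := fun {p q} x => (𝓕.pieceMul p q x).map_zero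
  zero_mul := fun {p q} y => by
    change 𝓕.pieceMul p q 0 y = 0
    simp
  mul_add := fun {p q} x y z => (𝓕.pieceMul p q x).map_add y z
  add_mul := fun {p q} x y z => by
    change 𝓕.pieceMul p q (x + y) z = 𝓕.pieceMul p q x z + 𝓕.pieceMul p q y z
    simp
  natCast := fun n => n • 𝓕.toPiece 0 ⟨1, 𝓕.one_mem⟩
  natCast_zero := zero_smul _ _
  natCast_succ := fun n => succ_nsmul _ n
  intCast := fun n => n • 𝓕.toPiece 0 ⟨1, 𝓕.one_mem⟩
  intCast_ofNat := fun n => natCast_zsmul _ n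
  intCast_negSucc_ofNat := fun n => negSucc_zsmul _ n

instance instGAlgebra (𝓕 : AlgFiltration R A) : DirectSum.GAlgebra R 𝓕.Piece where
  toFun := (LinearMap.toSpanSingleton R _ (𝓕.toPiece 0 ⟨1, 𝓕.one_mem⟩)).toAddMonoidHom
  map_one := by
    change (1 : R) • 𝓕.toPiece 0 ⟨1, 𝓕.one_mem⟩ = 𝓕.toPiece 0 ⟨1, 𝓕.one_mem⟩
    exact one_smul R _
  map_mul := fun r s =>
    𝓕.mk_toPiece_eq (by simp) ((r * s) • ⟨1, 𝓕.one_mem⟩)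
      ⟨(((r • ⟨1, 𝓕.one_mem⟩ : 𝓕.F 0) : A)) * ((s • ⟨1, 𝓕.one_mem⟩ : 𝓕.F 0) : A),
        𝓕.mul_mem (Subtype.mem _) (Subtype.mem _)⟩ (by simp [mul_smul, smul_comm r s])
  commutes := by
    rintro r ⟨p, x⟩
    obtain ⟨x, rfl⟩ := 𝓕.toPiece_surjective p x
    exact 𝓕.mk_toPiece_eq (by simp)
      ⟨(((r • ⟨1, 𝓕.one_mem⟩ : 𝓕.F 0) : A)) * (x : A), 𝓕.mul_mem (Subtype.mem _) x.2⟩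
      ⟨(x : A) * ((r • ⟨1, 𝓕.one_mem⟩ : 𝓕.F 0) : A), 𝓕.mul_mem x.2 (Subtype.mem _)⟩ (by simp)
  smul_def := by
    rintro r ⟨p, x⟩
    obtain ⟨x, rfl⟩ := 𝓕.toPiece_surjective p x
    exact 𝓕.mk_toPiece_eq (by simp) (r • x)
      ⟨(((r • ⟨1, 𝓕.one_mem⟩ : 𝓕.F 0) : A)) * (x : A), 𝓕.mul_mem (Subtype.mem _) x.2⟩ (by simp)

/-- The associated graded algebra `⨁ p, F p / F (p - 1)`. -/
abbrev Gr (𝓕 : AlgFiltration R A) : Type v := ⨁ p, 𝓕.Piece p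

/-- The inclusion of the graded piece of weight `p` composed with the projection:
`F p → F p / F (p - 1) → Gr`. -/
def cls (𝓕 : AlgFiltration R A) (p : ℕ) : 𝓕.F p →ₗ[R] 𝓕.Gr :=
  (DirectSum.lof R ℕ 𝓕.Piece p).comp (𝓕.toPiece p)

theorem cls_mul_cls (𝓕 : AlgFiltration R A) (p q : ℕ) (x : 𝓕.F p) (y : 𝓕.F q) :
    𝓕.cls p x * 𝓕.cls q y =
      𝓕.cls (p + q) ⟨(x : A) * (y : A), 𝓕.mul_mem x.2 y.2⟩ :=
  DirectSum.of_mul_of _ _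

/-- The filtration in which the elements of `S` are put in degree one: `F p` is spanned by the
products of at most `p` elements of `S`. -/
def generatedBy (R : Type u) {A : Type v} [CommRing R] [Ring A] [Algebra R A] (S : Set A) :
    AlgFiltration R A where
  F p := Submodule.span R {x | ∃ l : List A, l.length ≤ p ∧ (∀ y ∈ l, y ∈ S) ∧ l.prod = x}
  mono := fun p q h => Submodule.span_mono (by
    rintro x ⟨l, hl, hS, rfl⟩
    exact ⟨l, hl.trans h, hS, rfl⟩)
  one_mem := Submodule.subset_span ⟨[], by simp, by simp, by simp⟩
  mul_mem := fun {p q x y} hx hy => by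
    have h := Submodule.mul_mem_mul hx hy
    rw [Submodule.span_mul_span] at h
    refine Submodule.span_mono ?_ h
    rintro _ ⟨_, ⟨l, hl, hS, rfl⟩, _, ⟨l', hl', hS', rfl⟩, rfl⟩
    refine ⟨l ++ l', by simp; omega, ?_, by simp⟩
    intro y hy
    rcases List.mem_append.1 hy with h | h
    · exact hS y h
    · exact hS' y h

theorem mem_generatedBy_one (R : Type u) {A : Type v} [CommRing R] [Ring A] [Algebra R A]
    {S : Set A} {x : A} (hx : x ∈ S) : x ∈ (generatedBy R S).F 1 :=
  Submodule.subset_span ⟨[x], by simp, by simpa using hx, by simp⟩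

end AlgFiltration

/-! ### Formal power series with noncommuting coefficients -/

/-- The formal derivative `d/dz` of a power series over a possibly noncommutative ring. -/
def formalDeriv {A : Type v} [Semiring A] (f : PowerSeries A) : PowerSeries A :=
  PowerSeries.mk fun n => (n + 1) • PowerSeries.coeff (n + 1) f

/-! ### The quadratic algebra of a symmetric quiver -/

/-- The incidence matrix of a quiver: `m i j` is the number of arrows from `i` to `j`. -/
def incidence (V : Type u) [Quiver.{v} V] : Matrix V V ℕ :=
  fun i j => Nat.card (i ⟶ j)

/-- The defining relations between the generators `e i k` (`i : V`, `k : ℕ`): supercommutativity,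
`e i` having the parity of `m i i`, and the vanishing of all coefficients of
`e_i(z) (d/dz)^p e_j(z)` for `0 ≤ p < m i j`, where `e_i(z) = ∑ k, e i k z ^ k`. -/
inductive Rel {V : Type u} (m : Matrix V V ℕ) :
    FreeAlgebra ℚ (V × ℕ) → FreeAlgebra ℚ (V × ℕ) → Prop
  | supercomm (i j : V) (k l : ℕ) :
      Rel m (FreeAlgebra.ι ℚ (i, k) * FreeAlgebra.ι ℚ (j, l))
        ((-1) ^ (m i i * m j j) * (FreeAlgebra.ι ℚ (j, l) * FreeAlgebra.ι ℚ (i, k)))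
  | diag (i j : V) (p n : ℕ) (hp : p < m i j) :
      Rel m
        (PowerSeries.coeff n
          (PowerSeries.mk (fun k => FreeAlgebra.ι ℚ (i, k)) *
            formalDeriv^[p] (PowerSeries.mk (fun k => FreeAlgebra.ι ℚ (j, k)))))
        0

/-- The algebra with generators `e i k` and relations `Rel m`. -/
abbrev MatrixAlg {V : Type u} (m : Matrix V V ℕ) : Type u := RingQuot (Rel m)

/-- The algebra `𝒜_Q` of a (finite symmetric) quiver `Q`. -/
abbrev QuadAlg (V : Type u) [Quiver.{v} V] : Type u := MatrixAlg (incidence V)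

/-- The generator `e i k`. -/
def gen {V : Type u} (m : Matrix V V ℕ) (x : V × ℕ) : MatrixAlg m :=
  RingQuot.mkAlgHom ℚ (Rel m) (FreeAlgebra.ι ℚ x)

/-- The generating series `e_i(z)`. -/
def genSeries {V : Type u} (m : Matrix V V ℕ) (i : V) : PowerSeries (MatrixAlg m) :=
  PowerSeries.mk fun k => gen m (i, k)

/-- Given degrees `deg x` of the generators, the span of all words in the generators
of total degree `g`. -/
def homogeneousPart {V : Type u} (m : Matrix V V ℕ) {G : Type w} [AddCommMonoid G]
    (deg : V × ℕ → G) (g : G) : Submodule ℚ (MatrixAlg m) :=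
  Submodule.span ℚ {x | ∃ l : List (V × ℕ), (l.map deg).sum = g ∧ (l.map (gen m)).prod = x}

/-- The degree `(α_i, - 2 k - m i i)` of `e i k`, in `ℤ ^ V × ℤ`. -/
def genDegree {V : Type u} [DecidableEq V] (m : Matrix V V ℕ) (x : V × ℕ) : (V → ℤ) × ℤ :=
  (Pi.single x.1 1, - 2 * (x.2 : ℤ) - (m x.1 x.1 : ℤ))

/-! ### Linking -/

/-- The vertices of the quiver obtained from a quiver by linking its vertices `a` and `b`:
the old vertices and one new vertex. -/
inductive Linked {V : Type u} (a b : V) : Type u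
  | old (i : V) : Linked a b
  | diamond : Linked a b

/-- The incidence matrix of the linked quiver. -/
def linkedMatrix {V : Type u} [DecidableEq V] (m : Matrix V V ℕ) (a b : V) :
    Matrix (Linked a b) (Linked a b) ℕ
  | .old i, .old j => if (i = a ∧ j = b) ∨ (i = b ∧ j = a) then m i j + 1 else m i j
  | .old i, .diamond => m i a + m i b
  | .diamond, .old j => m j a + m j b
  | .diamond, .diamond => m a a + m b b + 2 * m a b

/-- The linked quiver: the quiver with incidence matrix `linkedMatrix`. -/
instance instQuiverLinked {V : Type u} [DecidableEq V] [Quiver.{v} V] (a b : V) :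
    Quiver.{0} (Linked a b) where
  Hom x y := Fin (linkedMatrix (incidence V) a b x y)

theorem incidence_linked {V : Type u} [DecidableEq V] [Quiver.{v} V] (a b : V) :
    incidence (Linked a b) = linkedMatrix (incidence V) a b := by
  ext x y
  exact Nat.card_fin _

theorem linkedMatrix_isSymm {V : Type u} [DecidableEq V] {m : Matrix V V ℕ} (hm : m.IsSymm)
    (a b : V) : (linkedMatrix m a b).IsSymm := by
  ext x y
  have h := fun i j => hm.apply i j
  cases x <;> cases y <;> simp only [Matrix.transpose_apply, linkedMatrix]
  rename_i i j
  rw [h i j]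
  congr 1
  simp only [eq_iff_iff]
  tauto

/-- The series `e_⋄(z) = e_a(z) (d/dz)^{m a b} e_b(z)` over `𝒜_Q`. -/
def diamondSeries {V : Type u} [Quiver.{v} V] (a b : V) : PowerSeries (QuadAlg V) :=
  genSeries (incidence V) a * formalDeriv^[incidence V a b] (genSeries (incidence V) b)

/-- The generators of `𝒜_Q` together with the coefficients of `e_⋄(z)`. -/
def linkingSet {V : Type u} [Quiver.{v} V] (a b : V) : Set (QuadAlg V) :=
  Set.range (gen (incidence V)) ∪ Set.range fun k => PowerSeries.coeff k (diamondSeries a b)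

/-- The filtration of `𝒜_Q` in which the elements of `linkingSet a b` are put in degree one. -/
def linkingFiltration {V : Type u} [Quiver.{v} V] (a b : V) : AlgFiltration ℚ (QuadAlg V) :=
  AlgFiltration.generatedBy ℚ (linkingSet a b)

/-- The class of the generator `e i k` in `F 1 / F 0`. -/
def grGen {V : Type u} [Quiver.{v} V] (a b : V) (x : V × ℕ) : (linkingFiltration a b).Gr :=
  (linkingFiltration a b).cls 1
    ⟨gen (incidence V) x, AlgFiltration.mem_generatedBy_one ℚ (Or.inl ⟨x, rfl⟩)⟩

/-- The class of the coefficient of `z ^ k` in `e_⋄(z)` in `F 1 / F 0`. -/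
def grDiamond {V : Type u} [Quiver.{v} V] (a b : V) (k : ℕ) : (linkingFiltration a b).Gr :=
  (linkingFiltration a b).cls 1
    ⟨PowerSeries.coeff k (diamondSeries a b),
      AlgFiltration.mem_generatedBy_one ℚ (Or.inr ⟨k, rfl⟩)⟩

/-- `π` sends each generator of the algebra of the linked quiver to the class of the element of
the same name. -/
def IsLinkingMap {V : Type u} [DecidableEq V] [Quiver.{v} V] (a b : V)
    (π : QuadAlg (Linked a b) →ₐ[ℚ] (linkingFiltration a b).Gr) : Prop :=
  (∀ (i : V) (k : ℕ), π (gen (incidence (Linked a b)) (.old i, k)) = grGen a b (i, k)) ∧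
    ∀ k : ℕ, π (gen (incidence (Linked a b)) (.diamond, k)) = grDiamond a b k

/-- The degree in `ℤ ^ V × ℤ` of the generators of the algebra of the linked quiver: the new
vertex is given the lattice degree `α_a + α_b`. -/
def reducedDegree {V : Type u} [DecidableEq V] [Quiver.{v} V] (a b : V) :
    Linked a b × ℕ → (V → ℤ) × ℤ
  | (.old i, k) => (Pi.single i 1,
      - 2 * (k : ℤ) - (incidence (Linked a b) (.old i) (.old i) : ℤ))
  | (.diamond, k) => (Pi.single a 1 + Pi.single b 1,
      - 2 * (k : ℤ) - (incidence (Linked a b) .diamond .diamond : ℤ))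

/-- The component of degree `g` of the associated graded algebra: the sum over `p` of the images
of the intersections of `F p` with the component of degree `g` of `𝒜_Q`. -/
def grDegreePart {V : Type u} [DecidableEq V] [Quiver.{v} V] (a b : V) (g : (V → ℤ) × ℤ) :
    Submodule ℚ (linkingFiltration a b).Gr :=
  ⨆ p : ℕ, (((homogeneousPart (incidence V) (genDegree (incidence V)) g).comap
    ((linkingFiltration a b).F p).subtype).map ((linkingFiltration a b).cls p))

end QuiverLinking

end

/-!
The algebra of a symmetric quiver is studied through its dual, in the spirit of shuffle algebras.
Label a finite set `T` of variables by vertices. A functional on the words whose letters have the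
vertices of the labels is the same as a polynomial in the variables `X t`; the relations
`e_i(z) (d/dz)^p e_j(z) = 0` for `p < m i j` say that this polynomial is divisible by
`(X s - X t) ^ m i j` for labels `s`, `t` of colours `i`, `j`, and supercommutativity says that the
quotient is symmetric in the variables of each colour (`exists_symmetric_quotient`). Conversely, the
algebra acts on families of polynomials indexed by sets of labels by removing labels one at a time
(`labelAction`), and symmetric polynomials give back the functionals as matrix coefficients of this
action (`exists_constantCoeff_opWord_eq`). Hence the actions are jointly faithful
(`eq_zero_of_labelAction`).

Under the action, the coefficients of `e_⋄(z)` remove a pair of labels of colours `a` and `b` after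
their variables are identified, up to a nonzero scalar. This gives the relations of the linked
quiver between the `e_{i,k}` and the `e_{⋄,k}`, except that `e_a(z) (d/dz)^{m a b} e_b(z)` is not
zero but `e_⋄(z)`, which has lower weight than a product of two generators (`hatGen_supercomm`,
`hatGen_diag`, `exists_hatGen_b_a`). So the homomorphism to the associated graded algebra exists
(`linkingMap`). It is unique and surjective because words in the generators span, and its images of
the homogeneous components are read off from words.

For the injectivity, let `φ` be a functional not vanishing on a given element of the algebra of the
linked quiver, supported on the words with the vertices of a set `T` of labels; it corresponds to a
symmetric polynomial `g`. Double the labels of the new vertex, colouring the two copies by `a` and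
`b`. The key point is `exists_lift`: up to a nonzero scalar, `g ∏ (X s - X t)`, with the product
over the labels `s` of the vertex `a` and `t` of the vertex `b`, is obtained by identifying the two
copies of each label from a symmetric polynomial `f` in the doubled labels which vanishes whenever
more pairs of labels of colours `a` and `b` are identified than there are labels of the new vertex.
Such an `f` is the symmetrization of an explicit rational function. The matrix coefficient given by
`f` is then a functional on the original algebra which vanishes on all products of fewer than `|T|`
elements `e_{i,k}`, `e_{⋄,k}`: with the correct total degree such a product has more factors
`e_{⋄,k}` than there are labels of the new vertex, and each of them identifies a pair of variables
of `f`. On the products of `|T|` factors it induces a nonzero multiple of `φ`, since the additional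
differences of variables are those by which the exchange factors of the linked quiver, with its
additional arrow between `a` and `b`, differ from those of the merged vertices
(`listFactor_linkedSystem`). Therefore the given element is not in the kernel.
-/

noncomputable section

namespace QuiverLinking

open MvPolynomial
open Finset.HasAntidiagonal (antidiagonal)

/-! ### Coefficients and identification of variables -/

section Polynomials

variable {T : Type*} [DecidableEq T]

/-- A polynomial in the variables `X s`, regarded as a polynomial in `X t` whose coefficients are
polynomials in the other variables. -/
def takeVar (t : T) : MvPolynomial T ℚ →ₐ[ℚ] Polynomial (MvPolynomial T ℚ) :=
  aeval fun s => if s = t then Polynomial.X else Polynomial.C (X s)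

/-- The coefficient of `X t ^ k`, a polynomial in the other variables. -/
def coeffAt (t : T) (k : ℕ) : MvPolynomial T ℚ →ₗ[ℚ] MvPolynomial T ℚ where
  toFun F := (takeVar t F).coeff k
  map_add' F F' := by simp
  map_smul' c F := by simp

/-- The substitution `X u ↦ X t`. -/
def identify (t u : T) : MvPolynomial T ℚ →ₐ[ℚ] MvPolynomial T ℚ :=
  rename fun z => if z = u then t else z

theorem coeffAt_apply (t : T) (k : ℕ) (F : MvPolynomial T ℚ) :
    coeffAt t k F = (takeVar t F).coeff k := rfl

@[simp] theorem takeVar_X_self (t : T) : takeVar t (X t) = Polynomial.X := by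
  simp [takeVar]

theorem takeVar_X_of_ne {s t : T} (h : s ≠ t) : takeVar t (X s) = Polynomial.C (X s) := by
  simp [takeVar, h]

@[simp] theorem identify_X (t u s : T) :
    identify t u (X s) = X (if s = u then t else s) := by
  simp [identify]

@[simp] theorem identify_self (t : T) : identify t t = AlgHom.id ℚ (MvPolynomial T ℚ) := by
  ext s : 1
  by_cases h : s = t <;> simp [h]

/-- Polynomials not involving `X t` are constants for `takeVar t`. -/
theorem takeVar_of_mem {t : T} {p : MvPolynomial T ℚ} (hp : p ∈ supported ℚ ({t}ᶜ : Set T)) :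
    takeVar t p = Polynomial.C p := by
  have key : supported ℚ ({t}ᶜ : Set T) ≤
      AlgHom.equalizer (takeVar t) (Polynomial.CAlgHom) := by
    rw [supported_eq_adjoin_X, Algebra.adjoin_le_iff]
    rintro _ ⟨s, hs, rfl⟩
    exact takeVar_X_of_ne hs
  exact key hp

theorem coeffAt_mul_of_mem {t : T} {p : MvPolynomial T ℚ} (hp : p ∈ supported ℚ ({t}ᶜ : Set T))
    (k : ℕ) (F : MvPolynomial T ℚ) : coeffAt t k (p * F) = p * coeffAt t k F := by
  simp [coeffAt_apply, takeVar_of_mem hp]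

theorem coeffAt_mul_X_pow {t : T} {p : MvPolynomial T ℚ} (hp : p ∈ supported ℚ ({t}ᶜ : Set T))
    (k i : ℕ) : coeffAt t k (p * X t ^ i) = if k = i then p else 0 := by
  rw [coeffAt_mul_of_mem hp, coeffAt_apply, map_pow, takeVar_X_self, Polynomial.coeff_X_pow]
  split_ifs <;> simp

/-- Two linear maps agree if they agree on the products of a power of `X t` with a polynomial
not involving `X t`. -/
theorem linearMap_ext_var {M : Type*} [AddCommGroup M] [Module ℚ M] (t : T)
    {f g : MvPolynomial T ℚ →ₗ[ℚ] M}
    (h : ∀ (p : MvPolynomial T ℚ) (i : ℕ), p ∈ supported ℚ ({t}ᶜ : Set T) →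
      f (p * X t ^ i) = g (p * X t ^ i)) : f = g := by
  ext μ : 2
  have h1 : (monomial μ (1 : ℚ)) = monomial (μ.erase t) 1 * X t ^ μ t := by
    rw [X_pow_eq_monomial, monomial_mul, one_mul, Finsupp.erase_add_single]
  change f (monomial μ 1) = g (monomial μ 1)
  rw [h1]
  refine h _ _ ?_
  rw [mem_supported, vars_monomial one_ne_zero]
  intro s hs
  rw [Finset.mem_coe, Finsupp.support_erase] at hs
  simpa using Finset.ne_of_mem_erase hs

theorem coeffAt_mem_supported {t : T} {S : Set T} (k : ℕ) {F : MvPolynomial T ℚ}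
    (hF : F ∈ supported ℚ S) : coeffAt t k F ∈ supported ℚ (S \ {t}) := by
  revert k
  rw [supported_eq_adjoin_X] at hF
  induction hF using Algebra.adjoin_induction with
  | mem x hx =>
    obtain ⟨s, hs, rfl⟩ := hx
    intro k
    by_cases h : s = t
    · subst h
      rw [coeffAt_apply, takeVar_X_self, Polynomial.coeff_X]
      split_ifs
      exacts [one_mem _, zero_mem _]
    · rw [coeffAt_apply, takeVar_X_of_ne h, Polynomial.coeff_C]
      split_ifs
      exacts [X_mem_supported.2 ⟨hs, h⟩, zero_mem _]
  | algebraMap r =>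
    intro k
    rw [coeffAt_apply, AlgHom.commutes, Polynomial.algebraMap_apply, Polynomial.coeff_C]
    split_ifs
    exacts [Subalgebra.algebraMap_mem _ _, zero_mem _]
  | add x y _ _ hx hy =>
    intro k
    rw [map_add]
    exact add_mem (hx k) (hy k)
  | mul x y _ _ hx hy =>
    intro k
    rw [coeffAt_apply, map_mul, Polynomial.coeff_mul]
    exact sum_mem fun i _ => mul_mem (hx i.1) (hy i.2)

theorem rename_mem_supported {σ τ : Type*} (f : σ → τ) {S : Set σ} {F : MvPolynomial σ ℚ}
    (hF : F ∈ supported ℚ S) : rename f F ∈ supported ℚ (f '' S) := by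
  have key : supported ℚ S ≤ (supported ℚ (f '' S)).comap (rename f) := by
    rw [supported_eq_adjoin_X (s := S), Algebra.adjoin_le_iff]
    rintro _ ⟨s, hs, rfl⟩
    simpa using Set.mem_image_of_mem f hs
  exact key hF

/-- Substitutions agreeing on the variables involved agree. -/
theorem algHom_eq_of_mem {T : Type*} {B : Type*} [CommRing B] [Algebra ℚ B] {S : Set T}
    {f g : MvPolynomial T ℚ →ₐ[ℚ] B} (h : ∀ s ∈ S, f (X s) = g (X s)) {p : MvPolynomial T ℚ}
    (hp : p ∈ supported ℚ S) : f p = g p := by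
  have key : supported ℚ S ≤ AlgHom.equalizer f g := by
    rw [supported_eq_adjoin_X, Algebra.adjoin_le_iff]
    rintro _ ⟨s, hs, rfl⟩
    exact h s hs
  exact key hp

theorem identify_of_mem {t u : T} {p : MvPolynomial T ℚ} (hp : p ∈ supported ℚ ({u}ᶜ : Set T)) :
    identify t u p = p := by
  refine algHom_eq_of_mem (g := AlgHom.id ℚ _) ?_ hp
  intro s hs
  rw [identify_X, if_neg (by simpa using hs)]; rfl

theorem coeffAt_comm {t u : T} (h : t ≠ u) (k l : ℕ) (F : MvPolynomial T ℚ) :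
    coeffAt t k (coeffAt u l F) = coeffAt u l (coeffAt t k F) := by
  have key : coeffAt t k ∘ₗ coeffAt u l = coeffAt u l ∘ₗ coeffAt t k := by
    refine linearMap_ext_var t fun p i hp => ?_
    have hX : (X t ^ i : MvPolynomial T ℚ) ∈ supported ℚ ({u}ᶜ : Set T) :=
      pow_mem (X_mem_supported.2 h) i
    have hp' : coeffAt u l p ∈ supported ℚ ({t}ᶜ : Set T) :=
      supported_mono Set.sdiff_subset (coeffAt_mem_supported l hp)
    rw [LinearMap.comp_apply, LinearMap.comp_apply, coeffAt_mul_X_pow hp, mul_comm p,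
      coeffAt_mul_of_mem hX, mul_comm, coeffAt_mul_X_pow hp']
    split_ifs <;> simp
  exact LinearMap.congr_fun key F

/-- Coefficient extraction commutes with substitutions under which `X t` goes to `X t'` and the
other variables to polynomials without `X t'`. -/
theorem rename_coeffAt {σ : Type*} [DecidableEq σ] (f : T → σ) {t : T} {t' : σ} (ht : f t = t')
    {S : Set T} (hf : ∀ s ∈ S, s ≠ t → f s ≠ t') (k : ℕ) {F : MvPolynomial T ℚ}
    (hF : F ∈ supported ℚ S) :
    rename f (coeffAt t k F) = coeffAt t' k (rename f F) := by
  have key : (Polynomial.mapAlgHom (rename f)).comp (takeVar t) F =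
      (takeVar t').comp (rename f) F := by
    refine algHom_eq_of_mem (S := S) ?_ hF
    intro s hs
    simp only [AlgHom.comp_apply, rename_X]
    by_cases h : s = t
    · subst h ht
      simp
    · rw [takeVar_X_of_ne h, takeVar_X_of_ne (hf s hs h)]
      simp
  have := congrArg (fun q => Polynomial.coeff q k) key
  simpa [coeffAt_apply] using this

theorem identify_coeffAt {t u s : T} (h1 : t ≠ s) (h2 : u ≠ s) (k : ℕ) (F : MvPolynomial T ℚ) :
    identify t u (coeffAt s k F) = coeffAt s k (identify t u F) := by
  refine rename_coeffAt _ (by simp [h2.symm]) (S := Set.univ) ?_ k (by simp)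
  intro z _ hz
  by_cases hzu : z = u <;> simp [hzu, h1, hz]

theorem coeffAt_pderiv_iterate (t : T) (l p : ℕ) (F : MvPolynomial T ℚ) :
    coeffAt t l ((pderiv t)^[p] F) = (l + p).descFactorial p • coeffAt t (l + p) F := by
  have h1 : ∀ F, takeVar t (pderiv t F) = Polynomial.derivative (takeVar t F) := by
    intro F
    induction F using MvPolynomial.induction_on with
    | C a =>
      have : takeVar t (C a) = Polynomial.C (C a) := by
        rw [← algebraMap_eq, AlgHom.commutes]; rfl
      simp [this]
    | add p q hp hq => simp [hp, hq]
    | mul_X p s hp =>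
      by_cases h : s = t
      · subst h
        simp [hp]
        ring
      · simp [hp, pderiv_X_of_ne h, takeVar_X_of_ne h]
        ring
  have h2 : takeVar t ((pderiv t)^[p] F) = Polynomial.derivative^[p] (takeVar t F) := by
    induction p with
    | zero => rfl
    | succ p ih => rw [Function.iterate_succ_apply', h1, ih, Function.iterate_succ_apply']
  rw [coeffAt_apply, h2, Polynomial.coeff_iterate_derivative, coeffAt_apply]

/-- The coefficient of `z ^ n` after the substitution `X t = X u = z`. -/
theorem coeffAt_identify (t u : T) (n : ℕ) (F : MvPolynomial T ℚ) :
    coeffAt t n (identify t u F) =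
      ∑ x ∈ antidiagonal n, coeffAt t x.1 (coeffAt u x.2 F) := by
  have key : coeffAt t n ∘ₗ (identify t u).toLinearMap =
      ∑ x ∈ antidiagonal n, coeffAt t x.1 ∘ₗ coeffAt u x.2 := by
    refine linearMap_ext_var u fun p j hp => ?_
    simp only [LinearMap.comp_apply, AlgHom.toLinearMap_apply, LinearMap.sum_apply, map_mul,
      map_pow, identify_X, if_true, identify_of_mem hp, coeffAt_mul_X_pow hp]
    have key2 : coeffAt t n ∘ₗ LinearMap.mulRight ℚ (X t ^ j) =
        ∑ x ∈ antidiagonal n, if x.2 = j then coeffAt t x.1 else 0 := by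
      refine linearMap_ext_var t fun q i hq => ?_
      simp only [LinearMap.comp_apply, LinearMap.mulRight_apply, LinearMap.sum_apply, mul_assoc,
        ← pow_add, coeffAt_mul_X_pow hq]
      have : ∀ x ∈ antidiagonal n,
          (if x.2 = j then coeffAt t x.1 else 0) (q * X t ^ i) =
            if x = (i, j) then q else 0 := by
        intro x _
        by_cases h2 : x.2 = j
        · rw [if_pos h2, coeffAt_mul_X_pow hq]
          simp [Prod.ext_iff, h2]
        · simp [Prod.ext_iff, h2]
      rw [Finset.sum_congr rfl this, Finset.sum_ite_eq']
      simp [eq_comm]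
    have := LinearMap.congr_fun key2 p
    simp only [LinearMap.comp_apply, LinearMap.mulRight_apply, LinearMap.sum_apply] at this
    rw [this]
    refine Finset.sum_congr rfl fun x _ => ?_
    split_ifs <;> simp
  simpa using LinearMap.congr_fun key F

theorem coeffAt_identify_comm {t u : T} (h : t ≠ u) (n : ℕ) (F : MvPolynomial T ℚ) :
    coeffAt t n (identify t u F) = coeffAt u n (identify u t F) := by
  rw [coeffAt_identify, coeffAt_identify, ← Finset.Nat.sum_antidiagonal_swap]
  refine Finset.sum_congr rfl fun x _ => ?_
  exact (coeffAt_comm h _ _ F)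

theorem eq_zero_of_coeffAt (t : T) {F : MvPolynomial T ℚ} (h : ∀ n, coeffAt t n F = 0) :
    F = 0 := by
  have h1 : takeVar t F = 0 := Polynomial.ext fun n => h n
  have h2 : ((Polynomial.aeval (X t : MvPolynomial T ℚ)).restrictScalars ℚ).comp (takeVar t) =
      AlgHom.id ℚ (MvPolynomial T ℚ) := by
    ext s : 1
    by_cases hs : s = t
    · subst hs; simp
    · simp [takeVar_X_of_ne hs]
  have := AlgHom.congr_fun h2 F
  simpa [h1] using this.symm

/-! ### Divisibility by differences of variables -/

/-- This makes `X t - X u` prime, and turns vanishing under identification into divisibility. -/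
theorem identify_eq_zero_iff (t u : T) (F : MvPolynomial T ℚ) :
    identify t u F = 0 ↔ (X t - X u) ∣ F := by
  constructor
  · intro h
    have key : (Ideal.Quotient.mkₐ ℚ (Ideal.span {(X t - X u : MvPolynomial T ℚ)})).comp
        (identify t u) = Ideal.Quotient.mkₐ ℚ _ := by
      ext s : 1
      by_cases hs : s = u
      · subst hs
        simp only [AlgHom.comp_apply, identify_X, if_true, Ideal.Quotient.mkₐ_eq_mk]
        exact Ideal.Quotient.eq.2 (Ideal.mem_span_singleton_self _)
      · simp [hs]
    have h1 := AlgHom.congr_fun key F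
    rw [AlgHom.comp_apply, h, map_zero, Ideal.Quotient.mkₐ_eq_mk, eq_comm,
      Ideal.Quotient.eq_zero_iff_mem, Ideal.mem_span_singleton] at h1
    exact h1
  · rintro ⟨G, rfl⟩
    by_cases h : t = u <;> simp [h]

theorem prime_X_sub_X {t u : T} (h : t ≠ u) : Prime (X t - X u : MvPolynomial T ℚ) := by
  refine ⟨sub_ne_zero.2 fun h' => h (X_injective h'), ?_, ?_⟩
  · intro hu
    have := hu.map (identify t u)
    simp at this
  · intro p q hpq
    rw [← identify_eq_zero_iff, map_mul] at hpq
    rw [← identify_eq_zero_iff, ← identify_eq_zero_iff]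
    exact mul_eq_zero.1 hpq

theorem identify_X_sub_X_ne_zero {t u s r : T} (hsr : s ≠ r) (h1 : ¬ (s = t ∧ r = u))
    (h2 : ¬ (s = u ∧ r = t)) :
    identify t u (X s - X r) ≠ 0 := by
  rw [map_sub, identify_X, identify_X, sub_ne_zero]
  intro h
  have := X_injective h
  by_cases hs : s = u <;> by_cases hr : r = u <;> simp [hs, hr] at this <;> subst_vars <;> tauto

theorem isRelPrime_X_sub_X {t u s r : T} (htu : t ≠ u) (hsr : s ≠ r) (h1 : ¬ (s = t ∧ r = u))
    (h2 : ¬ (s = u ∧ r = t)) :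
    IsRelPrime (X t - X u : MvPolynomial T ℚ) (X s - X r) := by
  rw [(prime_X_sub_X htu).irreducible.isRelPrime_iff_not_dvd, ← identify_eq_zero_iff]
  exact identify_X_sub_X_ne_zero hsr h1 h2

theorem pderiv_X_sub_X_pow_mul {T : Type*} {t u : T} (h : t ≠ u) (m : ℕ) (F : MvPolynomial T ℚ) :
    pderiv u ((X t - X u) ^ (m + 1) * F) =
      (X t - X u) ^ m * (-(m + 1 : ℚ) • F + (X t - X u) * pderiv u F) := by
  rw [pderiv_mul, pderiv_pow, map_sub, pderiv_X_of_ne h, pderiv_X_self, Algebra.smul_def]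
  simp only [map_neg, map_add, map_natCast, map_one]
  push_cast
  ring

theorem identify_pderiv_iterate_of_lt {t u : T} (h : t ≠ u) {m p : ℕ} (hp : p < m)
    (F : MvPolynomial T ℚ) :
    identify t u ((pderiv u)^[p] ((X t - X u) ^ m * F)) = 0 := by
  induction p generalizing m F with
  | zero =>
    obtain ⟨m, rfl⟩ := Nat.exists_eq_add_of_lt hp
    simp [pow_succ]
  | succ p ih =>
    obtain ⟨m, rfl⟩ : ∃ m', m = m' + 1 := ⟨m - 1, by omega⟩
    rw [Function.iterate_succ_apply, pderiv_X_sub_X_pow_mul h]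
    exact ih (by omega) _

theorem identify_pderiv_iterate_self {t u : T} (h : t ≠ u) (m : ℕ) (F : MvPolynomial T ℚ) :
    identify t u ((pderiv u)^[m] ((X t - X u) ^ m * F)) =
      ((-1) ^ m * m.factorial : ℚ) • identify t u F := by
  induction m generalizing F with
  | zero => simp
  | succ m ih =>
    rw [Function.iterate_succ_apply, pderiv_X_sub_X_pow_mul h, ih, map_add, map_mul]
    simp only [map_smul, map_sub, identify_X, if_true, if_neg h, sub_self, zero_mul, add_zero,
      smul_smul]
    congr 1
    rw [Nat.factorial_succ]
    push_cast
    ring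

/-- A polynomial all of whose derivatives of order less than `m` in the direction of `X u` vanish
along `X t = X u` is divisible by `(X t - X u) ^ m`. -/
theorem X_sub_X_pow_dvd {t u : T} (h : t ≠ u) (m : ℕ) {F : MvPolynomial T ℚ}
    (hF : ∀ p < m, identify t u ((pderiv u)^[p] F) = 0) : (X t - X u) ^ m ∣ F := by
  induction m with
  | zero => simp
  | succ m ih =>
    obtain ⟨G, rfl⟩ := ih fun p hp => hF p (by omega)
    have := hF m (by omega)
    rw [identify_pderiv_iterate_self h, smul_eq_zero, identify_eq_zero_iff] at this
    rcases this with h0 | h0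
    · exact absurd h0 (by positivity)
    · rw [pow_succ]
      exact mul_dvd_mul_left _ h0

end Polynomials

/-! ### Coefficients of the defining relations -/

theorem coeff_formalDeriv_iterate {A : Type*} [Semiring A] (p n : ℕ) (f : PowerSeries A) :
    PowerSeries.coeff n (formalDeriv^[p] f) =
      (n + p).descFactorial p • PowerSeries.coeff (n + p) f := by
  induction p generalizing n with
  | zero => simp
  | succ p ih =>
    rw [Function.iterate_succ_apply', formalDeriv, PowerSeries.coeff_mk, ih, smul_smul]
    have h : n + 1 + p = n + (p + 1) := by ring
    rw [h, Nat.descFactorial_succ, show n + (p + 1) - p = n + 1 by omega]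

theorem coeff_mk_mul_formalDeriv {A : Type*} [Semiring A] (p n : ℕ) (f g : ℕ → A) :
    PowerSeries.coeff n (PowerSeries.mk f * formalDeriv^[p] (PowerSeries.mk g)) =
      ∑ x ∈ antidiagonal n, (x.2 + p).descFactorial p • (f x.1 * g (x.2 + p)) := by
  rw [PowerSeries.coeff_mul]
  refine Finset.sum_congr rfl fun x _ => ?_
  rw [coeff_formalDeriv_iterate, PowerSeries.coeff_mk, PowerSeries.coeff_mk, mul_smul_comm]

/-- The homomorphism out of the quadratic algebra of a matrix with given values on the generators,
the relations being stated coefficientwise. -/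
def matrixLift {V : Type*} {m : Matrix V V ℕ} {A : Type*} [Ring A] [Algebra ℚ A] (e : V × ℕ → A)
    (h1 : ∀ i j k l, e (i, k) * e (j, l) = (-1) ^ (m i i * m j j) * (e (j, l) * e (i, k)))
    (h2 : ∀ i j p n, p < m i j →
      ∑ x ∈ antidiagonal n, (x.2 + p).descFactorial p • (e (i, x.1) * e (j, x.2 + p)) = 0) :
    MatrixAlg m →ₐ[ℚ] A :=
  RingQuot.liftAlgHom ℚ ⟨FreeAlgebra.lift ℚ e, by
    intro x y hxy
    cases hxy with
    | supercomm i j k l => simpa using h1 i j k l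
    | diag i j p n hp =>
      rw [coeff_mk_mul_formalDeriv]
      simpa using h2 i j p n hp⟩

@[simp] theorem matrixLift_gen {V : Type*} {m : Matrix V V ℕ} {A : Type*} [Ring A] [Algebra ℚ A]
    (e : V × ℕ → A) (h1 h2) (x : V × ℕ) : matrixLift (m := m) e h1 h2 (gen m x) = e x := by
  simp [matrixLift, gen]

theorem gen_supercomm {V : Type*} (m : Matrix V V ℕ) (i j : V) (k l : ℕ) :
    gen m (i, k) * gen m (j, l) = (-1) ^ (m i i * m j j) * (gen m (j, l) * gen m (i, k)) := by
  have := RingQuot.mkAlgHom_rel ℚ (Rel.supercomm (m := m) i j k l)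
  simpa [gen] using this

theorem gen_diag {V : Type*} (m : Matrix V V ℕ) {i j : V} {p : ℕ} (n : ℕ) (hp : p < m i j) :
    ∑ x ∈ antidiagonal n,
      (x.2 + p).descFactorial p • (gen m (i, x.1) * gen m (j, x.2 + p)) = 0 := by
  have := RingQuot.mkAlgHom_rel ℚ (Rel.diag (m := m) i j p n hp)
  rw [coeff_mk_mul_formalDeriv] at this
  simpa [gen] using this

/-! ### Exchange factors -/

/-- Nonzero scalars correcting the sign with which `(x - y) ^ m i j` changes under the exchange of
`x` and `y` to the sign in the supercommutation rule. -/
structure SignSystem {V : Type*} (m : Matrix V V ℕ) where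
  val : V → V → ℚ
  ne_zero : ∀ i j, val i j ≠ 0
  swap : ∀ i j, val i j = (-1) ^ (m i j + m i i * m j j) * val j i

theorem even_mul_self_add (n : ℕ) : Even (n + n * n) := by
  rw [show n + n * n = n * (n + 1) by ring]
  exact Nat.even_mul_succ_self n

theorem exists_signSystem {V : Type*} {m : Matrix V V ℕ} (hm : m.IsSymm) :
    Nonempty (SignSystem m) := by
  classical
  -- put the sign on the pairs in decreasing order for some total order of the vertices
  obtain ⟨r, hr⟩ := exists_wellFoundedLT V
  refine ⟨⟨fun i j => if i ≤ j then 1 else (-1) ^ (m i j + m i i * m j j), ?_, ?_⟩⟩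
  · intro i j
    split_ifs
    · exact one_ne_zero
    · positivity
  · intro i j
    rcases lt_trichotomy i j with h | rfl | h
    · simp [h.le, h.not_ge, hm.apply i j, mul_comm (m i i), ← mul_pow]
    · simp [(even_mul_self_add (m i i)).neg_one_pow]
    · simp [h.le, h.not_ge]

section Factor

variable {V : Type*} {m : Matrix V V ℕ} (ε : SignSystem m) {T : Type*} (τ : T → V)

/-- The exchange factor of the variables with labels `s` and `t`. The sign system is needed for
`factor_swap`: exchanging the labels has to produce the sign of the supercommutation rule. -/
def factor (s t : T) : MvPolynomial T ℚ :=
  C (ε.val (τ s) (τ t)) * (X s - X t) ^ m (τ s) (τ t)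

theorem factor_swap (hm : m.IsSymm) (s t : T) :
    factor ε τ s t = (-1) ^ (m (τ s) (τ s) * m (τ t) (τ t)) * factor ε τ t s := by
  rw [factor, factor, ε.swap, hm.apply (τ t) (τ s), ← neg_sub (X t) (X s : MvPolynomial T ℚ),
    neg_pow (X t - X s)]
  simp only [map_mul, map_pow, map_neg, map_one, pow_add]
  have h : ((-1 : MvPolynomial T ℚ) ^ m (τ t) (τ s)) * (-1) ^ m (τ t) (τ s) = 1 := by
    rw [← mul_pow]; simp
  linear_combination ((-1) ^ (m (τ s) (τ s) * m (τ t) (τ t)) * C (ε.val (τ t) (τ s)) *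
    (X t - X s) ^ m (τ t) (τ s)) * h

theorem factor_ne_zero {s t : T} (h : s ≠ t) : factor ε τ s t ≠ 0 :=
  mul_ne_zero ((map_ne_zero_iff C (C_injective _ _)).2 (ε.ne_zero _ _))
    (pow_ne_zero _ (sub_ne_zero.2 fun h' => h (X_injective h')))

theorem rename_factor {T' : Type*} (τ' : T' → V) (f : T → T') (hf : ∀ t, τ' (f t) = τ t)
    (s t : T) : rename f (factor ε τ s t) = factor ε τ' (f s) (f t) := by
  simp [factor, hf]

theorem factor_mem_supported {S : Set T} {s t : T} (hs : s ∈ S) (ht : t ∈ S) :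
    factor ε τ s t ∈ supported ℚ S := by
  refine mul_mem (Subalgebra.algebraMap_mem _ _) (pow_mem (sub_mem ?_ ?_) _)
  · exact X_mem_supported.2 hs
  · exact X_mem_supported.2 ht

/-- The product of the exchange factors of the labels in `S` with those in `S'`. -/
def cross (S S' : Finset T) : MvPolynomial T ℚ :=
  ∏ s ∈ S, ∏ t ∈ S', factor ε τ s t

theorem cross_union_left [DecidableEq T] {S₁ S₂ : Finset T} (h : Disjoint S₁ S₂) (S : Finset T) :
    cross ε τ (S₁ ∪ S₂) S = cross ε τ S₁ S * cross ε τ S₂ S :=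
  Finset.prod_union h

theorem cross_union_right [DecidableEq T] {S₁ S₂ : Finset T} (h : Disjoint S₁ S₂)
    (S : Finset T) :
    cross ε τ S (S₁ ∪ S₂) = cross ε τ S S₁ * cross ε τ S S₂ := by
  rw [cross, cross, cross, ← Finset.prod_mul_distrib]
  exact Finset.prod_congr rfl fun s _ => Finset.prod_union h

theorem cross_swap (hm : m.IsSymm) (S S' : Finset T) :
    cross ε τ S S' = (-1) ^ ((∑ s ∈ S, m (τ s) (τ s)) * ∑ t ∈ S', m (τ t) (τ t)) *
      cross ε τ S' S := by
  rw [cross, cross, Finset.prod_comm (s := S'), Finset.sum_mul_sum, ← Finset.prod_pow_eq_pow_sum,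
    ← Finset.prod_mul_distrib]
  refine Finset.prod_congr rfl fun s _ => ?_
  rw [← Finset.prod_pow_eq_pow_sum, ← Finset.prod_mul_distrib]
  exact Finset.prod_congr rfl fun t _ => factor_swap ε τ hm s t

theorem cross_mem_supported {S S' : Finset T} {U : Set T} (h : ∀ s ∈ S, s ∈ U)
    (h' : ∀ s ∈ S', s ∈ U) : cross ε τ S S' ∈ supported ℚ U :=
  prod_mem fun s hs => prod_mem fun t ht => factor_mem_supported ε τ (h s hs) (h' t ht)

end Factor

/-! ### Blocks of labels -/

section Blocks

variable {V : Type*} [DecidableEq V] {m : Matrix V V ℕ} (ε : SignSystem m) {a b : V}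
  {T : Type*} [DecidableEq T] (τ : T → V)

/-- The vertices of the original quiver merged in a vertex of the linked quiver. -/
def letters : Linked a b → Finset V
  | .old i => {i}
  | .diamond => {a, b}

/-- The labels in a block: a single label is encoded as a pair `(t, t)`. -/
abbrev blockSupp (β : T × T) : Finset T := {β.1, β.2}

/-- The blocks belonging to a vertex of the linked quiver: the single labels of colour `i` for an
old vertex `i`, and the pairs of labels of colours `a` and `b` for the new vertex. -/
def IsBlock : Linked a b → T × T → Prop
  | .old i, β => β.1 = β.2 ∧ τ β.1 = i
  | .diamond, β => τ β.1 = a ∧ τ β.2 = b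

theorem prod_block {M : Type*} [CommMonoid M] (hab : a ≠ b) {x : Linked a b} {β : T × T}
    (h : IsBlock τ x β) (f : V → M) : ∏ z ∈ blockSupp β, f (τ z) = ∏ i ∈ letters x, f i := by
  obtain ⟨t, u⟩ := β
  cases x with
  | old i =>
    obtain ⟨h1, h2⟩ := h
    dsimp only at h1 h2
    subst h1 h2
    simp [letters, blockSupp]
  | diamond =>
    obtain ⟨h1, h2⟩ := h
    dsimp only at h1 h2
    have htu : t ≠ u := by rintro rfl; exact hab (h1.symm.trans h2)
    rw [letters, blockSupp, Finset.prod_pair htu, Finset.prod_pair hab, h1, h2]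

theorem sum_block {M : Type*} [AddCommMonoid M] (hab : a ≠ b) {x : Linked a b} {β : T × T}
    (h : IsBlock τ x β) (f : V → M) : ∑ z ∈ blockSupp β, f (τ z) = ∑ i ∈ letters x, f i :=
  prod_block (M := Multiplicative M) τ hab h f

variable (m) in
/-- The total number of arrows between the vertices merged in two vertices of the linked quiver. -/
def mergedMatrix : Matrix (Linked a b) (Linked a b) ℕ :=
  fun x y => ∑ i ∈ letters x, ∑ j ∈ letters y, m i j

/-- The scalar in the exchange factors of two merged vertices. -/
def mergedSign (x y : Linked a b) : ℚ := ∏ i ∈ letters x, ∏ j ∈ letters y, ε.val i j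

/-- Extraction of the coefficient of `z ^ k` after all variables of a block are set to `z`. -/
def blockCoeff (β : T × T) (k : ℕ) : MvPolynomial T ℚ →ₗ[ℚ] MvPolynomial T ℚ :=
  coeffAt β.1 k ∘ₗ (identify β.1 β.2).toLinearMap

theorem blockCoeff_apply (β : T × T) (k : ℕ) (F : MvPolynomial T ℚ) :
    blockCoeff β k F = coeffAt β.1 k (identify β.1 β.2 F) := rfl

theorem blockCoeff_mul_of_mem {β : T × T} {p : MvPolynomial T ℚ}
    (hp : p ∈ supported ℚ ((blockSupp β : Set T)ᶜ)) (k : ℕ) (F : MvPolynomial T ℚ) :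
    blockCoeff β k (p * F) = p * blockCoeff β k F := by
  have h1 : p ∈ supported ℚ ({β.1}ᶜ : Set T) := supported_mono (by simp) hp
  have h2 : p ∈ supported ℚ ({β.2}ᶜ : Set T) := supported_mono (by simp) hp
  rw [blockCoeff_apply, map_mul, identify_of_mem h2, coeffAt_mul_of_mem h1, blockCoeff_apply]

theorem identify_identify {t u s r : T} (h2 : t ≠ r) (h3 : u ≠ s) (h4 : u ≠ r)
    (F : MvPolynomial T ℚ) :
    identify t u (identify s r F) = identify s r (identify t u F) := by
  rw [identify, identify, rename_rename, rename_rename]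
  congr 2
  ext z
  simp only [Function.comp_apply]
  by_cases hz : z = r
  · subst hz
    simp [h4.symm, h3.symm]
  · by_cases hz' : z = u
    · subst hz'
      simp [h2, hz]
    · simp [hz, hz']

theorem blockCoeff_blockCoeff {β γ : T × T} (h : Disjoint (blockSupp β) (blockSupp γ)) (k l : ℕ)
    (F : MvPolynomial T ℚ) :
    blockCoeff β k (blockCoeff γ l F) =
      coeffAt β.1 k (coeffAt γ.1 l (identify β.1 β.2 (identify γ.1 γ.2 F))) := by
  rw [blockCoeff_apply, blockCoeff_apply, identify_coeffAt]
  · rintro h'; simp [h'] at h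
  · rintro h'; simp [h'] at h

theorem blockCoeff_comm {β γ : T × T} (h : Disjoint (blockSupp β) (blockSupp γ)) (k l : ℕ)
    (F : MvPolynomial T ℚ) :
    blockCoeff β k (blockCoeff γ l F) = blockCoeff γ l (blockCoeff β k F) := by
  have h' := h
  simp only [Finset.disjoint_insert_left, Finset.mem_insert, Finset.mem_singleton, not_or,
    Finset.disjoint_singleton_left] at h'
  obtain ⟨⟨h1, h2⟩, h3, h4⟩ := h'
  rw [blockCoeff_blockCoeff h, blockCoeff_blockCoeff h.symm, coeffAt_comm h1,
    identify_identify h2 h3 h4]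

/-- The product of the exchange factors of two blocks after all variables of each block are set
equal. -/
theorem map_cross_block {B : Type*} [CommRing B] [Algebra ℚ B] (hab : a ≠ b) {x y : Linked a b}
    {β γ : T × T} (hβ : IsBlock τ x β) (hγ : IsBlock τ y γ) (f : MvPolynomial T ℚ →ₐ[ℚ] B)
    {p q : B} (hp : ∀ z ∈ blockSupp β, f (X z) = p) (hq : ∀ z ∈ blockSupp γ, f (X z) = q) :
    f (cross ε τ (blockSupp β) (blockSupp γ)) =
      algebraMap ℚ B (mergedSign ε x y) * (p - q) ^ mergedMatrix m x y := by
  have key : ∀ z ∈ blockSupp β, ∀ w ∈ blockSupp γ, f (factor ε τ z w) =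
      algebraMap ℚ B (ε.val (τ z) (τ w)) * (p - q) ^ m (τ z) (τ w) := by
    intro z hz w hw
    rw [factor, map_mul, map_pow, map_sub, hp z hz, hq w hw, ← algebraMap_eq, AlgHom.commutes]
  simp only [cross, map_prod]
  rw [Finset.prod_congr rfl fun z hz => Finset.prod_congr rfl fun w hw => key z hz w hw]
  simp only [Finset.prod_mul_distrib, Finset.prod_pow_eq_pow_sum, ← map_prod]
  rw [mergedSign, mergedMatrix, ← prod_block τ hab hβ, ← sum_block τ hab hβ]
  congr 2
  · congr 1
    funext z
    exact prod_block τ hab hγ _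
  · exact Finset.sum_congr rfl fun z _ => sum_block τ hab hγ _

theorem identify_cross_block (hab : a ≠ b) {x y : Linked a b} {β γ : T × T}
    (hβ : IsBlock τ x β) (hγ : IsBlock τ y γ) (h : Disjoint (blockSupp β) (blockSupp γ)) :
    identify β.1 β.2 (identify γ.1 γ.2 (cross ε τ (blockSupp β) (blockSupp γ))) =
      C (mergedSign ε x y) * (X β.1 - X γ.1) ^ mergedMatrix m x y := by
  simp only [Finset.disjoint_insert_left, Finset.mem_insert, Finset.mem_singleton, not_or,
    Finset.disjoint_singleton_left] at h
  obtain ⟨⟨h1, h2⟩, h3, h4⟩ := h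
  refine map_cross_block ε τ hab hβ hγ ((identify β.1 β.2).comp (identify γ.1 γ.2)) ?_ ?_
  · intro z hz
    rcases Finset.mem_insert.1 hz with rfl | hz
    · simp [h2]
    · rw [Finset.mem_singleton.1 hz]
      simp [h4]
  · intro w hw
    rcases Finset.mem_insert.1 hw with rfl | hw
    · simp [Ne.symm h3]
    · rw [Finset.mem_singleton.1 hw]
      simp [Ne.symm h3]

end Blocks

/-- Signs in an algebra act as scalars, so they pass through linear maps. -/
theorem neg_one_pow_mul_eq_smul {A : Type*} [Ring A] [Algebra ℚ A] (n : ℕ) (x : A) :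
    (-1) ^ n * x = (-1 : ℚ) ^ n • x := by
  rcases Nat.even_or_odd n with h | h <;> simp [h.neg_one_pow]

/-! ### Block operators -/

section Operators

variable {V : Type*} {m : Matrix V V ℕ} (ε : SignSystem m) {a b : V}
  {T : Type*} [Fintype T] [DecidableEq T] (τ : T → V)

open scoped Classical in
/-- The blocks belonging to `x` and disjoint from `S`. -/
def freeBlocks (x : Linked a b) (S : Finset T) : Finset (T × T) :=
  Finset.univ.filter fun β => IsBlock τ x β ∧ Disjoint (blockSupp β) S

theorem mem_freeBlocks {x : Linked a b} {S : Finset T} {β : T × T} :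
    β ∈ freeBlocks τ x S ↔ IsBlock τ x β ∧ Disjoint (blockSupp β) S := by
  simp [freeBlocks]

/-- The operator on families `G` of polynomials indexed by sets of labels that removes a block
belonging to `x`: the value at `S` is the sum over the blocks `β` disjoint from `S` of the
coefficients of `z ^ k` in `G (S ∪ β)`, multiplied by the exchange factors of `S` with `β`, after
all variables of `β` are set to `z`. -/
def blockOp (x : Linked a b) (k : ℕ) :
    Module.End ℚ (Finset T → MvPolynomial T ℚ) where
  toFun G S := ∑ β ∈ freeBlocks τ x S,
    blockCoeff β k (cross ε τ S (blockSupp β) * G (S ∪ blockSupp β))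
  map_add' G G' := by
    funext S
    simp [mul_add, Finset.sum_add_distrib]
  map_smul' c G := by
    funext S
    simp [Finset.smul_sum]

theorem blockOp_apply (x : Linked a b) (k : ℕ) (G : Finset T → MvPolynomial T ℚ)
    (S : Finset T) :
    blockOp ε τ x k G S = ∑ β ∈ freeBlocks τ x S,
      blockCoeff β k (cross ε τ S (blockSupp β) * G (S ∪ blockSupp β)) := rfl

open scoped Classical in
/-- The pairs of disjoint blocks disjoint from `S` belonging to `x` and `y`. -/
def freePairs (x y : Linked a b) (S : Finset T) : Finset ((T × T) × (T × T)) :=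
  Finset.univ.filter fun q => IsBlock τ x q.1 ∧ IsBlock τ y q.2 ∧
    Disjoint (blockSupp q.1) S ∧ Disjoint (blockSupp q.2) S ∧
    Disjoint (blockSupp q.1) (blockSupp q.2)

theorem mem_freePairs {x y : Linked a b} {S : Finset T} {q : (T × T) × (T × T)} :
    q ∈ freePairs τ x y S ↔ IsBlock τ x q.1 ∧ IsBlock τ y q.2 ∧
    Disjoint (blockSupp q.1) S ∧ Disjoint (blockSupp q.2) S ∧
    Disjoint (blockSupp q.1) (blockSupp q.2) := by
  simp [freePairs]

/-- The exchange factors of the two blocks with each other come from the labels that remain when the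
second block is removed. -/
theorem blockOp_blockOp (x y : Linked a b) (k l : ℕ) (G : Finset T → MvPolynomial T ℚ)
    (S : Finset T) :
    blockOp ε τ x k (blockOp ε τ y l G) S = ∑ q ∈ freePairs τ x y S,
      blockCoeff q.1 k (blockCoeff q.2 l (cross ε τ (blockSupp q.1) (blockSupp q.2) *
        (cross ε τ S (blockSupp q.1) * cross ε τ S (blockSupp q.2) *
          G (S ∪ (blockSupp q.1 ∪ blockSupp q.2))))) := by
  rw [Finset.sum_finset_product' (f := fun β γ => blockCoeff β k (blockCoeff γ l
      (cross ε τ (blockSupp β) (blockSupp γ) * (cross ε τ S (blockSupp β) *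
        cross ε τ S (blockSupp γ) * G (S ∪ (blockSupp β ∪ blockSupp γ))))))
      (r := freePairs τ x y S) (s := freeBlocks τ x S)
      (t := fun β => freeBlocks τ y (S ∪ blockSupp β))]
  · rw [blockOp_apply]
    refine Finset.sum_congr rfl fun β hβ => ?_
    rw [blockOp_apply, Finset.mul_sum, map_sum]
    refine Finset.sum_congr rfl fun γ hγ => ?_
    rw [mem_freeBlocks] at hβ hγ
    have h1 := Finset.disjoint_union_right.1 hγ.2
    rw [← blockCoeff_mul_of_mem, cross_union_left ε τ hβ.2.symm, Finset.union_assoc]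
    · exact congrArg (fun F => blockCoeff β k (blockCoeff γ l F)) (by ring)
    · refine cross_mem_supported ε τ ?_ ?_
      · intro s hs hs'
        exact Finset.disjoint_left.1 h1.1 hs' hs
      · intro s hs hs'
        exact Finset.disjoint_left.1 h1.2 hs' hs
  · rintro ⟨β, γ⟩
    simp only [mem_freePairs, mem_freeBlocks, Finset.disjoint_union_right]
    rw [disjoint_comm (a := blockSupp γ) (b := blockSupp β)]
    tauto

variable [DecidableEq V]

/-- The exchange of two block operators. -/
theorem blockOp_comm (hm : m.IsSymm) (hab : a ≠ b) (x y : Linked a b) (k l : ℕ)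
    (G : Finset T → MvPolynomial T ℚ) :
    blockOp ε τ x k (blockOp ε τ y l G) =
      (-1 : ℚ) ^ ((∑ i ∈ letters x, m i i) * ∑ i ∈ letters y, m i i) •
        blockOp ε τ y l (blockOp ε τ x k G) := by
  funext S
  rw [Pi.smul_apply, blockOp_blockOp, blockOp_blockOp, Finset.smul_sum]
  refine Finset.sum_bij' (fun q _ => q.swap) (fun q _ => q.swap) ?_ ?_ (fun _ _ => rfl)
    (fun _ _ => rfl) ?_
  · rintro ⟨β, γ⟩ h
    simp only [mem_freePairs, Prod.swap] at h ⊢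
    exact ⟨h.2.1, h.1, h.2.2.2.1, h.2.2.1, h.2.2.2.2.symm⟩
  · rintro ⟨β, γ⟩ h
    simp only [mem_freePairs, Prod.swap] at h ⊢
    exact ⟨h.2.1, h.1, h.2.2.2.1, h.2.2.1, h.2.2.2.2.symm⟩
  · rintro ⟨β, γ⟩ h
    simp only [mem_freePairs] at h
    obtain ⟨h1, h2, -, -, h5⟩ := h
    simp only [Prod.swap]
    rw [blockCoeff_comm h5, cross_swap ε τ hm, sum_block τ hab h1 (fun i => m i i),
      sum_block τ hab h2 (fun i => m i i), ← map_smul, ← map_smul, Finset.union_comm (blockSupp β)]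
    refine congrArg (fun F => blockCoeff γ l (blockCoeff β k F)) ?_
    rw [Algebra.smul_def]
    simp only [map_pow, map_neg, map_one]
    ring

/-- The coefficients of the products of one generating series of block operators with the
derivatives of another one. -/
theorem sum_blockOp_blockOp (hab : a ≠ b) (x y : Linked a b) (p n : ℕ)
    (G : Finset T → MvPolynomial T ℚ) (S : Finset T) :
    ∑ z ∈ antidiagonal n, (z.2 + p).descFactorial p •
        blockOp ε τ x z.1 (blockOp ε τ y (z.2 + p) G) S =
      ∑ q ∈ freePairs τ x y S, coeffAt q.1.1 n (identify q.1.1 q.2.1 ((pderiv q.2.1)^[p]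
        ((X q.1.1 - X q.2.1) ^ mergedMatrix m x y * (C (mergedSign ε x y) *
          identify q.1.1 q.1.2 (identify q.2.1 q.2.2
            (cross ε τ S (blockSupp q.1) * cross ε τ S (blockSupp q.2) *
          G (S ∪ (blockSupp q.1 ∪ blockSupp q.2)))))))) := by
  simp only [blockOp_blockOp, Finset.smul_sum]
  rw [Finset.sum_comm]
  refine Finset.sum_congr rfl fun q hq => ?_
  rw [mem_freePairs] at hq
  obtain ⟨h1, h2, -, -, h5⟩ := hq
  rw [coeffAt_identify]
  refine Finset.sum_congr rfl fun z _ => ?_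
  rw [blockCoeff_blockCoeff h5, map_mul, map_mul, identify_cross_block ε τ hab h1 h2 h5,
    coeffAt_pderiv_iterate, map_nsmul]
  refine congrArg (fun F => (z.2 + p).descFactorial p •
    coeffAt q.1.1 z.1 (coeffAt q.2.1 (z.2 + p) F)) ?_
  ring

/-- The factor `(X s - X t) ^ mergedMatrix m x y` kills all derivatives of smaller order along
`X s = X t`. -/
theorem sum_blockOp_blockOp_eq_zero (hab : a ≠ b) {x y : Linked a b} {p : ℕ}
    (hp : p < mergedMatrix m x y) (n : ℕ) (G : Finset T → MvPolynomial T ℚ) :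
    ∑ z ∈ antidiagonal n, (z.2 + p).descFactorial p •
        blockOp ε τ x z.1 (blockOp ε τ y (z.2 + p) G) = 0 := by
  funext S
  simp only [Finset.sum_apply, Pi.smul_apply, Pi.zero_apply]
  rw [sum_blockOp_blockOp ε τ hab]
  refine Finset.sum_eq_zero fun q hq => ?_
  rw [mem_freePairs] at hq
  have : q.1.1 ≠ q.2.1 := by
    intro h
    have := hq.2.2.2.2
    simp [h] at this
  rw [identify_pderiv_iterate_of_lt this hp, map_zero]

theorem mergedMatrix_old (i j : V) :
    mergedMatrix m (.old i : Linked a b) (.old j) = m i j := by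
  simp [mergedMatrix, letters]

theorem mergedSign_old (i j : V) :
    mergedSign ε (.old i : Linked a b) (.old j) = ε.val i j := by
  simp [mergedSign, letters]

/-- The coefficients of the product of the series for `a` with the derivative of order `m a b` of
the series for `b` are multiples of the operators removing blocks of the new vertex. -/
theorem sum_blockOp_a_b (hab : a ≠ b) (n : ℕ) (G : Finset T → MvPolynomial T ℚ) :
    ∑ z ∈ antidiagonal n, (z.2 + m a b).descFactorial (m a b) •
        blockOp ε τ (.old a : Linked a b) z.1 (blockOp ε τ (.old b : Linked a b) (z.2 + m a b) G) =
      (ε.val a b * ((-1) ^ m a b * (m a b).factorial)) •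
        blockOp ε τ (.diamond : Linked a b) n G := by
  funext S
  simp only [Finset.sum_apply, Pi.smul_apply]
  rw [sum_blockOp_blockOp ε τ hab, blockOp_apply, Finset.smul_sum]
  refine Finset.sum_bij' (fun q _ => (q.1.1, q.2.1)) (fun β _ => ((β.1, β.1), (β.2, β.2)))
    ?_ ?_ ?_ ?_ ?_
  · rintro ⟨⟨t, t'⟩, ⟨u, u'⟩⟩ h
    simp only [mem_freePairs, mem_freeBlocks, IsBlock] at h ⊢
    obtain ⟨⟨rfl, h1⟩, ⟨rfl, h2⟩, h3, h4, h5⟩ := h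
    refine ⟨⟨h1, h2⟩, ?_⟩
    simp_all [blockSupp]
  · rintro ⟨t, u⟩ h
    simp only [mem_freePairs, mem_freeBlocks, IsBlock] at h ⊢
    obtain ⟨⟨h1, h2⟩, h3⟩ := h
    have htu : t ≠ u := by rintro rfl; exact hab (h1.symm.trans h2)
    simp_all [blockSupp]
  · rintro ⟨⟨t, t'⟩, ⟨u, u'⟩⟩ h
    simp only [mem_freePairs, IsBlock] at h
    obtain ⟨⟨rfl, h1⟩, ⟨rfl, h2⟩, -⟩ := h
    rfl
  · rintro ⟨t, u⟩ h
    rfl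
  · rintro ⟨⟨t, t'⟩, ⟨u, u'⟩⟩ h
    simp only [mem_freePairs, IsBlock] at h
    obtain ⟨⟨rfl, h1⟩, ⟨rfl, h2⟩, -, -, h5⟩ := h
    have htu : t ≠ u := by rintro rfl; exact hab (h1.symm.trans h2)
    have e1 : blockSupp (t, t) ∪ blockSupp (u, u) = blockSupp (t, u) := by
      ext; simp [blockSupp]
    have e2 : cross ε τ S (blockSupp (t, t)) * cross ε τ S (blockSupp (u, u)) =
        cross ε τ S (blockSupp (t, u)) := by
      rw [← cross_union_right ε τ h5, e1]
    simp only [e1, e2, identify_self, AlgHom.id_apply, mergedMatrix_old, mergedSign_old]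
    rw [identify_pderiv_iterate_self htu, ← smul_eq_C_mul, map_smul, map_smul, map_smul, smul_smul,
      blockCoeff_apply, mul_comm (ε.val a b)]

/-- Up to a sign, the product of the series for `b` with the derivative of order `m a b` of the
series for `a` is the same. -/
theorem sum_blockOp_b_a (hm : m.IsSymm) (hab : a ≠ b) (n : ℕ)
    (G : Finset T → MvPolynomial T ℚ) :
    ∑ z ∈ antidiagonal n, (z.2 + m a b).descFactorial (m a b) •
        blockOp ε τ (.old b : Linked a b) z.1 (blockOp ε τ (.old a : Linked a b) (z.2 + m a b) G) =
      (ε.val b a * ((-1) ^ m a b * (m a b).factorial)) •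
        blockOp ε τ (.diamond : Linked a b) n G := by
  funext S
  simp only [Finset.sum_apply, Pi.smul_apply]
  rw [sum_blockOp_blockOp ε τ hab, blockOp_apply, Finset.smul_sum]
  refine Finset.sum_bij' (fun q _ => (q.2.1, q.1.1)) (fun β _ => ((β.2, β.2), (β.1, β.1)))
    ?_ ?_ ?_ ?_ ?_
  · rintro ⟨⟨t, t'⟩, ⟨u, u'⟩⟩ h
    simp only [mem_freePairs, mem_freeBlocks, IsBlock] at h ⊢
    obtain ⟨⟨rfl, h1⟩, ⟨rfl, h2⟩, h3, h4, h5⟩ := h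
    refine ⟨⟨h2, h1⟩, ?_⟩
    simp_all [blockSupp]
  · rintro ⟨t, u⟩ h
    simp only [mem_freePairs, mem_freeBlocks, IsBlock] at h ⊢
    obtain ⟨⟨h1, h2⟩, h3⟩ := h
    have htu : u ≠ t := by rintro rfl; exact hab (h1.symm.trans h2)
    simp_all [blockSupp]
  · rintro ⟨⟨t, t'⟩, ⟨u, u'⟩⟩ h
    simp only [mem_freePairs, IsBlock] at h
    obtain ⟨⟨rfl, h1⟩, ⟨rfl, h2⟩, -⟩ := h
    rfl
  · rintro ⟨t, u⟩ h
    rfl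
  · rintro ⟨⟨u, u'⟩, ⟨t, t'⟩⟩ h
    simp only [mem_freePairs, IsBlock] at h
    obtain ⟨⟨rfl, h1⟩, ⟨rfl, h2⟩, -, -, h5⟩ := h
    have htu : u ≠ t := by rintro rfl; exact hab (h2.symm.trans h1)
    have e1 : blockSupp (u, u) ∪ blockSupp (t, t) = blockSupp (t, u) := by
      ext; simp [blockSupp, or_comm]
    have e2 : cross ε τ S (blockSupp (u, u)) * cross ε τ S (blockSupp (t, t)) =
        cross ε τ S (blockSupp (t, u)) := by
      rw [← cross_union_right ε τ h5, e1]
    simp only [e1, e2, identify_self, AlgHom.id_apply, mergedMatrix_old, mergedSign_old]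
    rw [hm.apply a b, identify_pderiv_iterate_self htu, ← smul_eq_C_mul, map_smul, map_smul,
      map_smul, smul_smul, coeffAt_identify_comm htu, blockCoeff_apply, mul_comm (ε.val b a)]

variable (a b) in
/-- The action of the quadratic algebra by removal of labels. -/
def labelAction (hm : m.IsSymm) (hab : a ≠ b) :
    MatrixAlg m →ₐ[ℚ] Module.End ℚ (Finset T → MvPolynomial T ℚ) :=
  matrixLift (m := m) (fun x => blockOp ε τ (.old x.1 : Linked a b) x.2)
    (by
      intro i j k l
      refine LinearMap.ext fun G => ?_
      have := blockOp_comm ε τ hm hab (.old i : Linked a b) (.old j) k l G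
      simp only [letters, Finset.sum_singleton] at this
      exact this.trans (LinearMap.congr_fun (neg_one_pow_mul_eq_smul (m i i * m j j)
        (blockOp ε τ (.old j : Linked a b) l * blockOp ε τ (.old i : Linked a b) k)) G).symm)
    (by
      intro i j p n hp
      refine LinearMap.ext fun G => ?_
      have := sum_blockOp_blockOp_eq_zero ε τ hab (x := (.old i : Linked a b)) (y := .old j)
        (p := p) (by rwa [mergedMatrix_old]) n G
      simpa [LinearMap.sum_apply] using this)

@[simp] theorem labelAction_gen (hm : m.IsSymm) (hab : a ≠ b) (i : V) (k : ℕ) :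
    labelAction ε a b τ hm hab (gen m (i, k)) = blockOp ε τ (.old i : Linked a b) k :=
  matrixLift_gen _ _ _ _

end Operators

/-! ### Words in the generators and gradings -/

section Words

variable {V : Type*} (m : Matrix V V ℕ)

theorem span_words_eq_top :
    Submodule.span ℚ (Set.range fun l : List (V × ℕ) => (l.map (gen m)).prod) = ⊤ := by
  rw [eq_top_iff]
  rintro x -
  obtain ⟨x, rfl⟩ := RingQuot.mkAlgHom_surjective ℚ (Rel m) x
  induction x using FreeAlgebra.induction with
  | grade0 r =>
    rw [AlgHom.commutes, Algebra.algebraMap_eq_smul_one]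
    exact Submodule.smul_mem _ _ (Submodule.subset_span ⟨[], by simp⟩)
  | grade1 x => exact Submodule.subset_span ⟨[x], by simp [gen]⟩
  | mul x y hx hy =>
    rw [map_mul]
    have h := Submodule.mul_mem_mul hx hy
    rw [Submodule.span_mul_span] at h
    refine Submodule.span_mono ?_ h
    rintro _ ⟨_, ⟨l, rfl⟩, _, ⟨l', rfl⟩, rfl⟩
    exact ⟨l ++ l', by simp⟩
  | add x y hx hy =>
    rw [map_add]
    exact add_mem hx hy

theorem linearMap_ext_words {M : Type*} [AddCommGroup M] [Module ℚ M]
    {f g : MatrixAlg m →ₗ[ℚ] M}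
    (h : ∀ l : List (V × ℕ), f (l.map (gen m)).prod = g (l.map (gen m)).prod) : f = g := by
  refine LinearMap.ext_on_range (span_words_eq_top m) h

variable {G : Type*} [AddCommMonoid G] (α : V → G) (β : G)

/-- The coaction defining the grading of the quadratic algebra for which the degree of `e i k` is
`α i + k • β`. -/
def gradingCoaction : MatrixAlg m →ₐ[ℚ] AddMonoidAlgebra (MatrixAlg m) G :=
  matrixLift (m := m) (fun x => AddMonoidAlgebra.single (α x.1 + x.2 • β) (gen m x))
    (by
      intro i j k l
      refine Eq.trans ?_ (neg_one_pow_mul_eq_smul (m i i * m j j) _).symm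
      rw [AddMonoidAlgebra.single_mul_single, AddMonoidAlgebra.single_mul_single,
        AddMonoidAlgebra.smul_single, ← neg_one_pow_mul_eq_smul, gen_supercomm, add_comm])
    (by
      intro i j p n hp
      have h : ∀ x ∈ antidiagonal n, (x.2 + p).descFactorial p •
          (AddMonoidAlgebra.single (α i + x.1 • β) (gen m (i, x.1)) *
            AddMonoidAlgebra.single (α j + (x.2 + p) • β) (gen m (j, x.2 + p))) =
          AddMonoidAlgebra.single (α i + α j + (n + p) • β)
            ((x.2 + p).descFactorial p • (gen m (i, x.1) * gen m (j, x.2 + p))) := by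
        intro x hx
        rw [AddMonoidAlgebra.single_mul_single, AddMonoidAlgebra.smul_single,
          ← Finset.HasAntidiagonal.mem_antidiagonal.1 hx]
        congr 1
        simp only [add_smul]
        abel
      refine (Finset.sum_congr rfl h).trans ?_
      have h2 := map_sum (AddMonoidAlgebra.singleAddHom (R := MatrixAlg m)
        (α i + α j + (n + p) • β)) (fun x : ℕ × ℕ => (x.2 + p).descFactorial p •
          (gen m (i, x.1) * gen m (j, x.2 + p))) (antidiagonal n)
      rw [gen_diag m n hp, map_zero] at h2
      exact h2.symm)

theorem gradingCoaction_word (l : List (V × ℕ)) :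
    gradingCoaction m α β (l.map (gen m)).prod =
      AddMonoidAlgebra.single (l.map fun x => α x.1 + x.2 • β).sum (l.map (gen m)).prod := by
  induction l with
  | nil => simp [AddMonoidAlgebra.one_def]
  | cons x l ih =>
    rw [List.map_cons, List.prod_cons, map_mul, ih, gradingCoaction, matrixLift_gen,
      AddMonoidAlgebra.single_mul_single]
    simp

/-- The projection to the component of degree `g` in this grading. -/
def gradingProj (g : G) : MatrixAlg m →ₗ[ℚ] MatrixAlg m where
  toFun y := (gradingCoaction m α β y).coeff g
  map_add' x y := by simp
  map_smul' c x := by simp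

theorem gradingProj_word [DecidableEq G] (g : G) (l : List (V × ℕ)) :
    gradingProj m α β g (l.map (gen m)).prod =
      if (l.map fun x => α x.1 + x.2 • β).sum = g then (l.map (gen m)).prod else 0 := by
  change (gradingCoaction m α β (l.map (gen m)).prod).coeff g = _
  rw [gradingCoaction_word, AddMonoidAlgebra.coeff_single, Finsupp.single_apply]

/-- An element is the sum of its components. -/
theorem exists_gradingProj_ne_zero {y : MatrixAlg m} (hy : y ≠ 0) :
    ∃ g, gradingProj m α β g y ≠ 0 := by
  by_contra! h
  have h0 : gradingCoaction m α β y = 0 := by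
    refine AddMonoidAlgebra.coeff_injective (Finsupp.ext fun g => ?_)
    exact h g
  let s : AddMonoidAlgebra (MatrixAlg m) G →ₗ[ℚ] MatrixAlg m :=
    { toFun := fun z => z.coeff.sum fun _ c => c
      map_add' := fun x y => by
        rw [AddMonoidAlgebra.coeff_add, Finsupp.sum_add_index' (by simp) (by simp)]
      map_smul' := fun c x => by
        rw [AddMonoidAlgebra.coeff_smul, Finsupp.sum_smul_index' (by simp), Finsupp.smul_sum]
        rfl }
  have h1 : s ∘ₗ (gradingCoaction m α β).toLinearMap = LinearMap.id := by
    refine linearMap_ext_words m fun l => ?_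
    rw [LinearMap.comp_apply, AlgHom.toLinearMap_apply, gradingCoaction_word]
    change (AddMonoidAlgebra.coeff _).sum (fun _ c => c) = _
    rw [AddMonoidAlgebra.coeff_single, Finsupp.sum_single_index rfl]
    rfl
  have h2 := LinearMap.congr_fun h1 y
  rw [LinearMap.comp_apply, AlgHom.toLinearMap_apply, h0, map_zero] at h2
  exact hy h2.symm

/-- The degree recording the vertices of a word and the sum of the indices of its letters. -/
def wordClass (l : List (V × ℕ)) : Multiset V × ℕ :=
  (l.map fun x => (({x.1}, 0) : Multiset V × ℕ) + x.2 • ((0, 1) : Multiset V × ℕ)).sum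

theorem wordClass_eq (l : List (V × ℕ)) :
    wordClass l = (((l.map Prod.fst : List V) : Multiset V), (l.map Prod.snd).sum) := by
  induction l with
  | nil => rfl
  | cons x l ih =>
    have : wordClass (x :: l) = (({x.1}, 0) + x.2 • (0, 1)) + wordClass l := by
      simp [wordClass]
    rw [this, ih]
    ext1 <;> simp

/-- Functionals supported on the words with given vertices and given sum of indices separate the
elements of the algebra. -/
theorem exists_homogeneous_dual {y : MatrixAlg m} (hy : y ≠ 0) :
    ∃ (φ : MatrixAlg m →ₗ[ℚ] ℚ) (μ : Multiset V) (D : ℕ), φ y ≠ 0 ∧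
      ∀ l : List (V × ℕ), wordClass l ≠ (μ, D) → φ (l.map (gen m)).prod = 0 := by
  classical
  obtain ⟨g, h⟩ := exists_gradingProj_ne_zero m
    (fun i => (({i}, 0) : Multiset V × ℕ)) ((0, 1) : Multiset V × ℕ) hy
  obtain ⟨φ, hφ⟩ : ∃ φ : MatrixAlg m →ₗ[ℚ] ℚ, φ (gradingProj m _ _ g y) ≠ 0 := by
    by_contra! h'
    exact h ((Module.forall_dual_apply_eq_zero_iff ℚ _).1 h')
  refine ⟨φ ∘ₗ gradingProj m _ _ g, g.1, g.2, hφ, fun l hl => ?_⟩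
  rw [LinearMap.comp_apply, gradingProj_word, if_neg, map_zero]
  exact hl

end Words

/-! ### Words of labels -/

section LabelWords

variable {V : Type*} {m : Matrix V V ℕ} (ε : SignSystem m) {T : Type*} (τ : T → V)

variable (m) in
/-- The word with the vertices of a list of labels and given indices. -/
def labelWord (κ : T →₀ ℕ) (L : List T) : MatrixAlg m :=
  (L.map fun t => gen m (τ t, κ t)).prod

@[simp] theorem labelWord_cons (κ : T →₀ ℕ) (t : T) (L : List T) :
    labelWord m τ κ (t :: L) = gen m (τ t, κ t) * labelWord m τ κ L := by
  simp [labelWord]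

variable [DecidableEq T]

/-- The product of the exchange factors of the labels in `S` with those in `L`, and of those in
`L` among each other. -/
def listFactor : Finset T → List T → MvPolynomial T ℚ
  | _, [] => 1
  | S, t :: L => cross ε τ S {t} * listFactor (insert t S) L

theorem listFactor_cons (S : Finset T) (t : T) (L : List T) :
    listFactor ε τ S (t :: L) = cross ε τ S {t} * listFactor ε τ (insert t S) L := rfl

/-- Words of labels and products of exchange factors change by the same scalar under a permutation
of the labels. -/
theorem listFactor_perm (hm : m.IsSymm) {L L' : List T} (h : L.Perm L') (hL : L.Nodup) :
    ∃ c : ℚ, c ≠ 0 ∧ (∀ κ, labelWord m τ κ L' = c • labelWord m τ κ L) ∧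
      ∀ S, (∀ t ∈ L, t ∉ S) → listFactor ε τ S L' = c • listFactor ε τ S L := by
  induction h with
  | nil => exact ⟨1, one_ne_zero, by simp, by simp⟩
  | cons t _ ih =>
    obtain ⟨c, hc, h1, h2⟩ := ih (List.nodup_cons.1 hL).2
    refine ⟨c, hc, fun κ => by simp [h1], fun S hS => ?_⟩
    rw [listFactor, listFactor, h2, mul_smul_comm]
    intro u hu hu'
    rcases Finset.mem_insert.1 hu' with rfl | h
    · exact (List.nodup_cons.1 hL).1 hu
    · exact hS u (List.mem_cons_of_mem _ hu) h
  | swap t u L =>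
    have htu : u ≠ t := by
      rintro rfl
      simp at hL
    refine ⟨(-1) ^ (m (τ t) (τ t) * m (τ u) (τ u)), by positivity, fun κ => ?_, fun S hS => ?_⟩
    · simp only [labelWord_cons]
      rw [← mul_assoc, gen_supercomm, neg_one_pow_mul_eq_smul, smul_mul_assoc, mul_assoc]
    · have ht : t ∉ S := hS t (by simp)
      have hu : u ∉ S := hS u (by simp)
      simp only [listFactor, cross, Finset.prod_singleton, Finset.prod_insert ht,
        Finset.prod_insert hu]
      rw [factor_swap ε τ hm t u, neg_one_pow_mul_eq_smul, Finset.insert_comm]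
      simp only [smul_mul_assoc, mul_smul_comm]
      congr 1
      ring
  | trans h h' ih ih' =>
    obtain ⟨c, hc, h1, h2⟩ := ih hL
    obtain ⟨c', hc', h1', h2'⟩ := ih' (h.nodup_iff.1 hL)
    refine ⟨c' * c, mul_ne_zero hc' hc, fun κ => by rw [h1', h1, smul_smul], fun S hS => ?_⟩
    rw [h2' S fun t ht => hS t (h.mem_iff.2 ht), h2 S hS, smul_smul]

theorem listFactor_ne_zero {S : Finset T} {L : List T} (hL : L.Nodup) (hS : ∀ t ∈ L, t ∉ S) :
    listFactor ε τ S L ≠ 0 := by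
  induction L generalizing S with
  | nil => exact one_ne_zero
  | cons t L ih =>
    refine mul_ne_zero ?_ (ih (List.nodup_cons.1 hL).2 ?_)
    · refine Finset.prod_ne_zero_iff.2 fun s hs => ?_
      rw [Finset.prod_singleton]
      refine factor_ne_zero ε τ ?_
      rintro rfl
      exact hS s (by simp) hs
    · intro u hu hu'
      rcases Finset.mem_insert.1 hu' with rfl | h
      · exact (List.nodup_cons.1 hL).1 hu
      · exact hS u (List.mem_cons_of_mem _ hu) h

theorem rename_listFactor (σ : Equiv.Perm T) (hσ : ∀ t, τ (σ t) = τ t) (S : Finset T)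
    (L : List T) :
    rename σ (listFactor ε τ S L) = listFactor ε τ (S.map σ.toEmbedding) (L.map σ) := by
  induction L generalizing S with
  | nil => simp [listFactor]
  | cons t L ih =>
    rw [List.map_cons, listFactor, listFactor, map_mul, ih, Finset.map_insert]
    congr 1
    simp [cross, rename_factor ε τ τ σ hσ]

theorem isRelPrime_factor {t u s r : T} (htu : t ≠ u) (hsr : s ≠ r) (h1 : ¬ (s = t ∧ r = u))
    (h2 : ¬ (s = u ∧ r = t)) :
    IsRelPrime (factor ε τ t u) (factor ε τ s r) := by
  have hu : ∀ i j, IsUnit (C (ε.val i j) : MvPolynomial T ℚ) := fun i j =>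
    (isUnit_iff_ne_zero.2 (ε.ne_zero i j)).map C
  rw [factor, factor, isRelPrime_mul_unit_left_left (hu _ _),
    isRelPrime_mul_unit_left_right (hu _ _)]
  exact (isRelPrime_X_sub_X htu hsr h1 h2).pow

theorem isRelPrime_listFactor {s t : T} (hst : s ≠ t) {S : Finset T} {L : List T}
    (hs : s ∉ L) (ht : t ∉ L) (hL : L.Nodup) (hS : ∀ t ∈ L, t ∉ S) :
    IsRelPrime (factor ε τ s t) (listFactor ε τ S L) := by
  induction L generalizing S with
  | nil => exact isRelPrime_one_right
  | cons u L ih =>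
    rw [List.mem_cons, not_or] at hs ht
    refine IsRelPrime.mul_right ?_ (ih hs.2 ht.2 (List.nodup_cons.1 hL).2 ?_)
    · refine IsRelPrime.prod_right fun r hr => ?_
      rw [Finset.prod_singleton]
      refine isRelPrime_factor ε τ hst ?_ ?_ ?_
      · rintro rfl
        exact hS r (by simp) hr
      · rintro ⟨-, h⟩
        exact ht.1 h.symm
      · rintro ⟨-, h⟩
        exact hs.1 h.symm
    · intro r hr hr'
      rcases Finset.mem_insert.1 hr' with rfl | h
      · exact (List.nodup_cons.1 hL).1 hr
      · exact hS r (List.mem_cons_of_mem _ hr) h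

theorem listFactor_dvd {F : MvPolynomial T ℚ} (hF : ∀ s t, s ≠ t → factor ε τ s t ∣ F)
    {S : Finset T} {L : List T} (hL : L.Nodup) (hS : ∀ t ∈ L, t ∉ S) :
    listFactor ε τ S L ∣ F := by
  induction L generalizing S with
  | nil => exact one_dvd _
  | cons t L ih =>
    have htL := (List.nodup_cons.1 hL).1
    have hL' := (List.nodup_cons.1 hL).2
    have htS : t ∉ S := hS t (by simp)
    have hS' : ∀ r ∈ L, r ∉ insert t S := by
      intro r hr hr'
      rcases Finset.mem_insert.1 hr' with rfl | h
      · exact htL hr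
      · exact hS r (List.mem_cons_of_mem _ hr) h
    refine IsRelPrime.mul_dvd ?_ ?_ (ih hL' hS')
    · refine IsRelPrime.prod_left fun s hs => ?_
      rw [Finset.prod_singleton]
      refine isRelPrime_listFactor ε τ ?_ ?_ htL hL' hS'
      · rintro rfl
        exact htS hs
      · intro h
        exact hS s (List.mem_cons_of_mem _ h) hs
    · refine Finset.prod_dvd_of_isRelPrime ?_ ?_
      · intro s hs r hr hsr
        simp only [Function.onFun, Finset.prod_singleton]
        refine isRelPrime_factor ε τ ?_ ?_ ?_ ?_
        · rintro rfl; exact htS hs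
        · rintro rfl; exact htS hr
        · rintro ⟨rfl, -⟩; exact hsr rfl
        · rintro ⟨rfl, -⟩; exact htS hr
      · intro s hs
        rw [Finset.prod_singleton]
        exact hF s t (by rintro rfl; exact htS hs)

end LabelWords

/-! ### Functionals and polynomials -/

section Functionals

variable {V : Type*} {m : Matrix V V ℕ} (ε : SignSystem m) {T : Type*} [DecidableEq T]
  (τ : T → V)

theorem coeff_coeffAt (t : T) (k : ℕ) (F : MvPolynomial T ℚ) (μ : T →₀ ℕ) :
    coeff μ (coeffAt t k F) = if μ t = 0 then coeff (μ + Finsupp.single t k) F else 0 := by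
  have h1 : ∀ ν : T →₀ ℕ, coeffAt t k (monomial ν (1 : ℚ)) =
      if k = ν t then monomial (ν.erase t) 1 else 0 := by
    intro ν
    rw [← coeffAt_mul_X_pow (p := monomial (ν.erase t) (1 : ℚ)) (t := t)]
    · rw [X_pow_eq_monomial, monomial_mul, one_mul, Finsupp.erase_add_single]
    · rw [mem_supported, vars_monomial one_ne_zero]
      intro s hs
      rw [Finset.mem_coe, Finsupp.support_erase] at hs
      simpa using Finset.ne_of_mem_erase hs
  induction F using MvPolynomial.induction_on' with
  | monomial ν c =>
    rw [← mul_one c, ← smul_eq_mul, ← smul_monomial, map_smul, coeff_smul, coeff_smul, h1]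
    by_cases hμ : μ t = 0
    · rw [if_pos hμ, coeff_monomial]
      by_cases hν : ν = μ + Finsupp.single t k
      · subst hν
        have : (μ + Finsupp.single t k).erase t = μ := by
          ext s
          by_cases hs : s = t
          · subst hs; simp [hμ]
          · simp [Finsupp.erase_ne hs]
        simp [hμ, this]
      · rw [if_neg hν]
        split_ifs with h
        · rw [coeff_monomial, if_neg]
          rintro rfl
          rw [h, Finsupp.erase_add_single] at hν
          exact hν rfl
        · simp
    · rw [if_neg hμ]
      split_ifs with h
      · rw [coeff_monomial, if_neg]
        · simp
        · rintro rfl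
          simp at hμ
      · simp
  | add p q hp hq =>
    rw [map_add, coeff_add, hp, hq, coeff_add]
    split_ifs <;> simp

variable [Fintype T]

/-- The generating polynomial of the values of a functional on the words with the vertices of a
list of labels and sum of indices `D`. -/
def wordPoly (φ : MatrixAlg m →ₗ[ℚ] ℚ) (D : ℕ) (L : List T) : MvPolynomial T ℚ :=
  ∑ κ ∈ Finset.univ.finsuppAntidiag D, monomial κ (φ (labelWord m τ κ L))

theorem coeff_wordPoly {φ : MatrixAlg m →ₗ[ℚ] ℚ} {D : ℕ} {L : List T}
    (hφ : ∀ κ : T →₀ ℕ, ∑ t, κ t ≠ D → φ (labelWord m τ κ L) = 0) (κ : T →₀ ℕ) :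
    coeff κ (wordPoly τ φ D L) = φ (labelWord m τ κ L) := by
  rw [wordPoly, coeff_sum]
  simp only [coeff_monomial]
  rw [Finset.sum_ite_eq']
  split_ifs with h
  · rfl
  · rw [hφ]
    intro h'
    exact h (by simp [h'])

/-- The relations `e_i(z) (d/dz)^r e_j(z) = 0` between the first two letters of a word. -/
theorem X_sub_X_pow_dvd_wordPoly {φ : MatrixAlg m →ₗ[ℚ] ℚ} {D : ℕ} {p q : T} (hpq : p ≠ q)
    {L : List T} (hp : p ∉ L) (hq : q ∉ L)
    (hφ : ∀ κ : T →₀ ℕ, ∑ t, κ t ≠ D → φ (labelWord m τ κ (p :: q :: L)) = 0) :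
    (X p - X q) ^ m (τ p) (τ q) ∣ wordPoly τ φ D (p :: q :: L) := by
  refine X_sub_X_pow_dvd hpq _ fun r hr => eq_zero_of_coeffAt p fun n => ?_
  rw [coeffAt_identify]
  ext μ
  simp only [coeffAt_pderiv_iterate, map_nsmul, coeff_sum, coeff_smul, coeff_zero, coeff_coeffAt]
  by_cases h1 : μ p = 0
  · by_cases h2 : μ q = 0
    · have key : ∀ x : ℕ × ℕ,
          φ (labelWord m τ (μ + Finsupp.single p x.1 + Finsupp.single q (x.2 + r))
            (p :: q :: L)) =
          φ (gen m (τ p, x.1) * gen m (τ q, x.2 + r) * labelWord m τ μ L) := by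
        intro x
        rw [labelWord_cons, labelWord_cons, mul_assoc]
        congr 2
        · simp [h1, hpq.symm]
        · congr 1
          · simp [h2, hpq]
          · rw [labelWord, labelWord]
            congr 1
            refine List.map_congr_left fun t ht => ?_
            have e1 : p ≠ t := by rintro rfl; exact hp ht
            have e2 : q ≠ t := by rintro rfl; exact hq ht
            simp [e1, e2]
      have h3 : ∀ x : ℕ × ℕ, (μ + Finsupp.single p x.1) q = 0 := by
        intro x; simp [h2, hpq]
      simp only [h1, h3, if_true, coeff_wordPoly τ hφ, key]
      have := gen_diag m n hr
      have h4 := congrArg (fun y => φ (y * labelWord m τ μ L)) this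
      simp only [Finset.sum_mul, smul_mul_assoc, map_sum, map_nsmul, zero_mul, map_zero] at h4
      exact h4
    · refine Finset.sum_eq_zero fun x _ => ?_
      have : (μ + Finsupp.single p x.1) q ≠ 0 := by simp [h2]
      rw [if_neg this, ite_self, smul_zero]
  · simp [h1]

variable {τ}

/-- A functional on the words with the vertices of a list `L` of all labels corresponds to a
polynomial which is divisible by all exchange factors; the quotient is symmetric. -/
theorem exists_symmetric_quotient (hm : m.IsSymm) {φ : MatrixAlg m →ₗ[ℚ] ℚ} {D : ℕ} {L : List T}
    (hL : L.Nodup) (hL' : ∀ t, t ∈ L)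
    (hφ : ∀ κ : T →₀ ℕ, ∑ t, κ t ≠ D → φ (labelWord m τ κ L) = 0) :
    ∃ g : MvPolynomial T ℚ,
      (∀ σ : Equiv.Perm T, (∀ t, τ (σ t) = τ t) → rename σ g = g) ∧
      ∀ κ, coeff κ (listFactor ε τ ∅ L * g) = φ (labelWord m τ κ L) := by
  have hdvd : listFactor ε τ ∅ L ∣ wordPoly τ φ D L := by
    refine listFactor_dvd ε τ ?_ hL (by simp)
    intro p q hpq
    have h1 : L.Perm (p :: q :: (L.erase p).erase q) :=
      (List.perm_cons_erase (hL' p)).trans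
        ((List.perm_cons_erase ((List.mem_erase_of_ne hpq.symm).2 (hL' q))).cons p)
    obtain ⟨c, hc, hw, -⟩ := listFactor_perm ε τ hm h1 hL
    have hφ' : ∀ κ : T →₀ ℕ, ∑ t, κ t ≠ D →
        φ (labelWord m τ κ (p :: q :: (L.erase p).erase q)) = 0 := by
      intro κ hκ
      rw [hw, map_smul, hφ κ hκ, smul_zero]
    have h2 : wordPoly τ φ D L = c⁻¹ • wordPoly τ φ D (p :: q :: (L.erase p).erase q) := by
      ext κ
      rw [coeff_smul, coeff_wordPoly τ hφ, coeff_wordPoly τ hφ', hw, map_smul, smul_smul,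
        inv_mul_cancel₀ hc, one_smul]
    have hu : IsUnit (C (ε.val (τ p) (τ q)) : MvPolynomial T ℚ) :=
      (isUnit_iff_ne_zero.2 (ε.ne_zero _ _)).map C
    rw [factor, hu.mul_left_dvd, h2, smul_eq_C_mul]
    refine Dvd.dvd.mul_left (X_sub_X_pow_dvd_wordPoly τ hpq ?_ ?_ hφ') _
    · intro h
      exact (hL.not_mem_erase (List.mem_of_mem_erase h))
    · exact (hL.erase p).not_mem_erase
  obtain ⟨g, hg⟩ := hdvd
  refine ⟨g, fun σ hσ => ?_, fun κ => by rw [← hg, coeff_wordPoly τ hφ]⟩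
  have hperm : L.Perm (L.map σ) := by
    rw [List.perm_ext_iff_of_nodup hL (hL.map σ.injective)]
    intro t
    simp only [hL', true_iff, List.mem_map]
    exact ⟨σ.symm t, trivial, by simp⟩
  obtain ⟨c, hc, hw, hf⟩ := listFactor_perm ε τ hm hperm hL
  have h1 : rename σ (wordPoly τ φ D L) = c • wordPoly τ φ D L := by
    ext κ
    have hκ : κ = (κ.mapDomain σ.symm).mapDomain σ := by
      rw [← Finsupp.mapDomain_comp]; simp [Finsupp.mapDomain_id]
    conv_lhs => rw [hκ]
    rw [coeff_rename_mapDomain _ σ.injective, coeff_smul, coeff_wordPoly τ hφ,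
      coeff_wordPoly τ hφ, ← map_smul, ← hw, labelWord, labelWord, List.map_map]
    congr 2
    refine List.map_congr_left fun t _ => ?_
    simp [Finsupp.mapDomain_equiv_apply, hσ]
  rw [hg, map_mul, rename_listFactor ε τ σ hσ, Finset.map_empty, hf ∅ (by simp), smul_mul_assoc,
    ← mul_smul_comm, ← mul_smul_comm] at h1
  have h2 := mul_left_cancel₀ (listFactor_ne_zero ε τ hL (by simp)) h1
  exact smul_right_injective _ hc h2

end Functionals

/-! ### Equivariant families of polynomials -/

section Equivariant

variable {V : Type*} {m : Matrix V V ℕ} (ε : SignSystem m) {a b : V}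
  {T : Type*} (τ : T → V)

/-- Families of polynomials indexed by sets of labels, equivariant under the permutations of the
labels that preserve colours, the member with index `S` involving only the variables from `S`. -/
structure IsEquivariant (G : Finset T → MvPolynomial T ℚ) : Prop where
  rename_eq : ∀ σ : Equiv.Perm T, (∀ t, τ (σ t) = τ t) → ∀ S : Finset T,
    rename σ (G S) = G (S.map σ.toEmbedding)
  mem_supported : ∀ S : Finset T, G S ∈ supported ℚ (S : Set T)

theorem rename_cross (σ : Equiv.Perm T) (hσ : ∀ t, τ (σ t) = τ t) (S S' : Finset T) :
    rename σ (cross ε τ S S') = cross ε τ (S.map σ.toEmbedding) (S'.map σ.toEmbedding) := by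
  simp [cross, rename_factor ε τ τ σ hσ]

theorem isBlock_perm {σ : Equiv.Perm T} (hσ : ∀ t, τ (σ t) = τ t) {x : Linked a b} {β : T × T}
    (h : IsBlock τ x β) : IsBlock τ x (σ β.1, σ β.2) := by
  cases x with
  | old i => exact ⟨congrArg σ h.1, (hσ _).trans h.2⟩
  | diamond => exact ⟨(hσ _).trans h.1, (hσ _).trans h.2⟩

variable [DecidableEq T]

theorem rename_blockCoeff (σ : Equiv.Perm T) (β : T × T) (k : ℕ) (F : MvPolynomial T ℚ) :
    rename σ (blockCoeff β k F) = blockCoeff (σ β.1, σ β.2) k (rename σ F) := by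
  rw [blockCoeff_apply, blockCoeff_apply, rename_coeffAt σ rfl (S := Set.univ)
    (fun s _ hs h => hs (σ.injective h)) k (by simp), identify, identify, rename_rename,
    rename_rename]
  congr 3
  ext z
  simp only [Function.comp_apply, EmbeddingLike.apply_eq_iff_eq]
  split_ifs <;> rfl

theorem map_blockSupp (σ : Equiv.Perm T) (β : T × T) :
    (blockSupp β).map σ.toEmbedding = blockSupp (σ β.1, σ β.2) := by
  simp [blockSupp, Finset.map_insert]

variable [Fintype T]

theorem mem_freeBlocks_perm {σ : Equiv.Perm T} (hσ : ∀ t, τ (σ t) = τ t) {x : Linked a b}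
    {S : Finset T} {β : T × T} (h : β ∈ freeBlocks τ x S) :
    (σ β.1, σ β.2) ∈ freeBlocks τ x (S.map σ.toEmbedding) := by
  rw [mem_freeBlocks] at h ⊢
  refine ⟨isBlock_perm τ hσ h.1, ?_⟩
  rw [← map_blockSupp, Finset.disjoint_map]
  exact h.2

variable {τ}

omit [Fintype T] in
theorem blockCoeff_mem_supported {G : Finset T → MvPolynomial T ℚ} (hG : IsEquivariant τ G)
    (β : T × T) (k : ℕ) (S : Finset T) :
    blockCoeff β k (cross ε τ S (blockSupp β) * G (S ∪ blockSupp β)) ∈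
      supported ℚ (S : Set T) := by
  have h1 : cross ε τ S (blockSupp β) * G (S ∪ blockSupp β) ∈
      supported ℚ ((S ∪ blockSupp β : Finset T) : Set T) := by
    refine mul_mem (cross_mem_supported ε τ ?_ ?_) (hG.mem_supported _)
    · intro s hs
      simp [hs]
    · intro s hs
      rw [Finset.mem_coe]
      exact Finset.mem_union_right _ hs
  have h2 := coeffAt_mem_supported (t := β.1) k (rename_mem_supported (fun z =>
    if z = β.2 then β.1 else z) h1)
  refine supported_mono ?_ h2
  rintro _ ⟨⟨z, hz, rfl⟩, h⟩
  by_cases hz2 : z = β.2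
  · simp [hz2] at h
  · simp only [if_neg hz2, Set.mem_singleton_iff] at h ⊢
    simpa [h, hz2] using hz

theorem IsEquivariant.blockOp {G : Finset T → MvPolynomial T ℚ} (hG : IsEquivariant τ G)
    (x : Linked a b) (k : ℕ) : IsEquivariant τ (blockOp ε τ x k G) where
  rename_eq σ hσ S := by
    rw [blockOp_apply, blockOp_apply, map_sum]
    have hσ' : ∀ t, τ (σ.symm t) = τ t := fun t => by rw [← hσ (σ.symm t), σ.apply_symm_apply]
    refine Finset.sum_bij' (fun β _ => (σ β.1, σ β.2)) (fun β _ => (σ.symm β.1, σ.symm β.2))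
      ?_ ?_ ?_ ?_ ?_
    · intro β hβ
      exact mem_freeBlocks_perm τ hσ hβ
    · intro β hβ
      have h := mem_freeBlocks_perm τ hσ' hβ
      rw [Finset.map_map] at h
      convert h
      ext; simp
    · intro β _; simp
    · intro β _; simp
    · intro β _
      rw [rename_blockCoeff, map_mul, rename_cross ε τ σ hσ, hG.rename_eq σ hσ,
        Finset.map_union, map_blockSupp]
  mem_supported S := sum_mem fun β _ => blockCoeff_mem_supported ε hG β k S

/-- The permutations preserving colours and fixing a set of labels act transitively on the blocks
disjoint from that set. -/
theorem exists_perm_freeBlocks (hab : a ≠ b) {x : Linked a b} {S : Finset T} {β β' : T × T}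
    (h : β ∈ freeBlocks τ x S) (h' : β' ∈ freeBlocks τ x S) :
    ∃ σ : Equiv.Perm T, (∀ t, τ (σ t) = τ t) ∧ (∀ s ∈ S, σ s = s) ∧ (σ β.1, σ β.2) = β' := by
  have hswap : ∀ t t' : T, τ t = τ t' → ∀ z, τ (Equiv.swap t t' z) = τ z := by
    intro t t' htt z
    rcases eq_or_ne z t with rfl | h1
    · simp [htt]
    · rcases eq_or_ne z t' with rfl | h2
      · simp [htt]
      · rw [Equiv.swap_apply_of_ne_of_ne h1 h2]
  obtain ⟨t, u⟩ := β
  obtain ⟨t', u'⟩ := β'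
  rw [mem_freeBlocks] at h h'
  simp only [Finset.disjoint_insert_left, Finset.disjoint_singleton_left] at h h'
  obtain ⟨h, h1, h2⟩ := h
  obtain ⟨h', h1', h2'⟩ := h'
  cases x with
  | old i =>
    obtain ⟨h0, h3⟩ := h
    obtain ⟨h0', h3'⟩ := h'
    dsimp only at *
    subst h0 h0'
    refine ⟨Equiv.swap t t', hswap _ _ (h3.trans h3'.symm), ?_, by simp⟩
    intro s hs
    refine Equiv.swap_apply_of_ne_of_ne ?_ ?_ <;> rintro rfl <;> contradiction
  | diamond =>
    obtain ⟨h3, h4⟩ := h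
    obtain ⟨h3', h4'⟩ := h'
    dsimp only at *
    refine ⟨Equiv.swap t t' * Equiv.swap u u', ?_, ?_, ?_⟩
    · intro z
      rw [Equiv.Perm.mul_apply, hswap _ _ (h3.trans h3'.symm), hswap _ _ (h4.trans h4'.symm)]
    · intro s hs
      rw [Equiv.Perm.mul_apply, Equiv.swap_apply_of_ne_of_ne (a := u),
        Equiv.swap_apply_of_ne_of_ne] <;> rintro rfl <;> contradiction
    · have e1 : t ≠ u := by rintro rfl; exact hab (h3.symm.trans h4)
      have e2 : t ≠ u' := by rintro rfl; exact hab (h3.symm.trans h4')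
      have e3 : u' ≠ t' := by rintro rfl; exact hab (h3'.symm.trans h4')
      rw [Equiv.Perm.mul_apply, Equiv.swap_apply_of_ne_of_ne e1 e2, Equiv.swap_apply_left,
        Equiv.Perm.mul_apply, Equiv.swap_apply_left, Equiv.swap_apply_of_ne_of_ne e2.symm e3]

/-- On equivariant families, all blocks contribute equally to a block operator. -/
theorem IsEquivariant.blockOp_apply (hab : a ≠ b) {G : Finset T → MvPolynomial T ℚ}
    (hG : IsEquivariant τ G) {x : Linked a b} (k : ℕ) {S : Finset T} {β : T × T}
    (hβ : β ∈ freeBlocks τ x S) :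
    QuiverLinking.blockOp ε τ x k G S = ((freeBlocks τ x S).card : ℚ) •
      blockCoeff β k (cross ε τ S (blockSupp β) * G (S ∪ blockSupp β)) := by
  rw [QuiverLinking.blockOp_apply, Nat.cast_smul_eq_nsmul, ← Finset.sum_const]
  refine Finset.sum_congr rfl fun β' hβ' => ?_
  obtain ⟨σ, hσ, hS, rfl⟩ := exists_perm_freeBlocks hab hβ hβ'
  have hS' : S.map σ.toEmbedding = S := by
    rw [Finset.map_eq_image]
    conv_rhs => rw [← Finset.image_id (s := S)]
    exact Finset.image_congr fun s hs => hS s hs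
  have h1 : rename σ (blockCoeff β k (cross ε τ S (blockSupp β) * G (S ∪ blockSupp β))) =
      blockCoeff (σ β.1, σ β.2) k (cross ε τ S (blockSupp (σ β.1, σ β.2)) *
        G (S ∪ blockSupp (σ β.1, σ β.2))) := by
    rw [rename_blockCoeff, map_mul, rename_cross ε τ σ hσ, hG.rename_eq σ hσ,
      Finset.map_union, map_blockSupp, hS']
  rw [← h1]
  refine algHom_eq_of_mem (g := AlgHom.id ℚ _) (fun s hs => ?_)
    (blockCoeff_mem_supported ε hG β k S)
  simp [hS s hs]

end Equivariant

/-! ### Arranging labels -/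

theorem exists_perm_map_eq {S T : Type*} {f : S → T} {l : List S} {l' : List T}
    (h : (l.map f).Perm l') : ∃ l₀ : List S, l.Perm l₀ ∧ l₀.map f = l' := by
  have h1 : List.Forall₂ (fun t s => t = f s) (l.map f) l := by
    rw [List.forall₂_map_left_iff]
    exact List.forall₂_same.2 fun s _ => rfl
  obtain ⟨l₀, h2, h3⟩ := List.perm_comp_forall₂ h.symm h1
  refine ⟨l₀, h3.symm, ?_⟩
  clear h h1 h3
  induction h2 with
  | nil => rfl
  | cons h _ ih => rw [List.map_cons, ih, h]

/-- A word whose vertices are the colours of the labels in some order arises from an arrangement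
of the labels. -/
theorem exists_labelling {X T : Type*} [Fintype T] [DecidableEq T] {τ : T → X}
    {W : List (X × ℕ)}
    (h : ((W.map Prod.fst : List X) : Multiset X) = Finset.univ.val.map τ) :
    ∃ (L : List T) (κ : T →₀ ℕ), L.Nodup ∧ (∀ t, t ∈ L) ∧ W = L.map fun t => (τ t, κ t) := by
  have h1 : ((Finset.univ : Finset T).toList.map τ).Perm (W.map Prod.fst) := by
    rw [← Multiset.coe_eq_coe, h, ← Multiset.map_coe, Finset.coe_toList]
  obtain ⟨L, hL, hW⟩ := exists_perm_map_eq h1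
  have hnd : L.Nodup := hL.nodup_iff.1 (Finset.nodup_toList _)
  have hlen : L.length = W.length := by simpa using congrArg List.length hW
  refine ⟨L, Finsupp.equivFunOnFinite.symm fun t => ((W.map Prod.snd).getD (L.idxOf t) 0), hnd,
    fun t => hL.mem_iff.1 (by simp), ?_⟩
  refine List.ext_getElem (by simp [hlen]) fun i h1 h2 => ?_
  have h3 : i < L.length := by omega
  have h4 : W[i].1 = τ L[i] := by
    have : (W.map Prod.fst)[i]? = (L.map τ)[i]? := by rw [hW]
    simpa [h1, h3] using this
  ext1
  · simpa using h4
  · simp [hnd.idxOf_getElem, h1]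

/-- A functional supported on the words with the vertices of a family of labels is determined by its
values for one arrangement of the labels. -/
theorem functional_ext_of_labelWord {X T : Type*} [Fintype T] [DecidableEq T] {m : Matrix X X ℕ}
    (hm : m.IsSymm) {τ : T → X} {φ ψ : MatrixAlg m →ₗ[ℚ] ℚ} {L : List T} (hL : L.Nodup)
    (hL' : ∀ t, t ∈ L) (h : ∀ κ, φ (labelWord m τ κ L) = ψ (labelWord m τ κ L))
    (hφ : ∀ W : List (X × ℕ), ((W.map Prod.fst : List X) : Multiset X) ≠ Finset.univ.val.map τ →
      φ (W.map (gen m)).prod = 0)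
    (hψ : ∀ W : List (X × ℕ), ((W.map Prod.fst : List X) : Multiset X) ≠ Finset.univ.val.map τ →
      ψ (W.map (gen m)).prod = 0) : φ = ψ := by
  obtain ⟨ε⟩ := exists_signSystem hm
  refine linearMap_ext_words m fun W => ?_
  by_cases hW : ((W.map Prod.fst : List X) : Multiset X) = Finset.univ.val.map τ
  · obtain ⟨L', κ, hnd, hmem, rfl⟩ := exists_labelling hW
    have hperm : L.Perm L' := (List.perm_ext_iff_of_nodup hL hnd).2 fun t => by simp [hL', hmem]
    obtain ⟨c, -, hc, -⟩ := listFactor_perm ε τ hm hperm hL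
    have : ((L'.map fun t => (τ t, κ t)).map (gen m)).prod = labelWord m τ κ L' := by
      rw [labelWord, List.map_map]; rfl
    rw [this, hc, map_smul, map_smul, h]
  · rw [hφ W hW, hψ W hW]

/-! ### Merging the labels of a block -/

section Merge

variable {V : Type*} [DecidableEq V] {m : Matrix V V ℕ} (ε : SignSystem m) {a b : V}

/-- Decidable equality, needed for exchange factors and words of the linked quiver. It is classical
since only propositions depend on it. -/
instance instDecidableEqLinked : DecidableEq (Linked a b) := Classical.decEq _

/-- The merged vertex has the parity of the product of its letters. -/
theorem mergedMatrix_self (hm : m.IsSymm) (hab : a ≠ b) (x : Linked a b) :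
    (-1 : ℚ) ^ mergedMatrix m x x = (-1) ^ ∑ i ∈ letters x, m i i := by
  cases x with
  | old i => simp [mergedMatrix, letters]
  | diamond =>
    simp only [mergedMatrix, letters, Finset.sum_pair hab]
    rw [hm.apply a b, show m a a + m a b + (m a b + m b b) = m a a + m b b + 2 * m a b by ring,
      pow_add, pow_mul]
    simp

variable (a b) in
/-- The sign system of the merged matrix. -/
def mergedSystem (hm : m.IsSymm) (hab : a ≠ b) :
    SignSystem (mergedMatrix m (a := a) (b := b)) where
  val := mergedSign ε
  ne_zero x y := Finset.prod_ne_zero_iff.2 fun i _ => Finset.prod_ne_zero_iff.2 fun j _ =>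
    ε.ne_zero i j
  swap x y := by
    have h1 : (-1 : ℚ) ^ (mergedMatrix m x x * mergedMatrix m y y) =
        (-1) ^ ((∑ i ∈ letters x, m i i) * ∑ i ∈ letters y, m i i) := by
      rw [pow_mul, mergedMatrix_self hm hab, ← pow_mul, mul_comm, pow_mul,
        mergedMatrix_self hm hab, ← pow_mul, mul_comm]
    rw [pow_add, h1, mergedSign, mergedSign, Finset.prod_comm (s := letters y), mergedMatrix,
      Finset.sum_mul_sum, ← Finset.prod_pow_eq_pow_sum, ← Finset.prod_pow_eq_pow_sum,
      ← Finset.prod_mul_distrib, ← Finset.prod_mul_distrib]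
    refine Finset.prod_congr rfl fun i _ => ?_
    rw [← Finset.prod_pow_eq_pow_sum, ← Finset.prod_pow_eq_pow_sum, ← Finset.prod_mul_distrib,
      ← Finset.prod_mul_distrib]
    refine Finset.prod_congr rfl fun j _ => ?_
    rw [ε.swap i j, pow_add]

variable {T : Type*} [Fintype T] [DecidableEq T] (τ : T → Linked a b)

/-- The labels of the original quiver: those of the linked quiver, and a second copy of those of
the new vertex. -/
abbrev Doubled : Type _ := T ⊕ {x : T // τ x = .diamond}

/-- The vertex `i` for an old vertex `i`, and `a` for the new vertex. -/
def baseLetter : Linked a b → V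
  | .old i => i
  | .diamond => a

/-- The colours of the doubled labels: the first copies of the labels of the new vertex have colour
`a`, the second copies have colour `b`. -/
def doubledColour : Doubled τ → V := Sum.elim (fun x => baseLetter (τ x)) fun _ => b

/-- The projection identifying the two copies of a label. -/
def fold : Doubled τ → T := Sum.elim id Subtype.val

/-- The block formed by the copies of a label. -/
def blockOf (x : T) : Doubled τ × Doubled τ :=
  (.inl x, if h : τ x = .diamond then .inr ⟨x, h⟩ else .inl x)

/-- The set of all copies of the labels in a set. -/
def unfold (S : Finset T) : Finset (Doubled τ) := Finset.univ.filter fun z => fold τ z ∈ S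

omit [DecidableEq V] in
theorem mem_unfold {S : Finset T} {z : Doubled τ} : z ∈ unfold τ S ↔ fold τ z ∈ S := by
  simp [unfold]

omit [DecidableEq V] [Fintype T] [DecidableEq T] in
theorem isBlock_blockOf (x : T) : IsBlock (doubledColour τ) (τ x) (blockOf τ x) := by
  cases h : τ x with
  | old i =>
    simp [IsBlock, blockOf, h, doubledColour, baseLetter]
  | diamond =>
    simp [IsBlock, blockOf, h, doubledColour, baseLetter]

omit [DecidableEq V] [Fintype T] in
theorem mem_blockSupp_blockOf {x : T} {z : Doubled τ} :
    z ∈ blockSupp (blockOf τ x) ↔ fold τ z = x := by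
  by_cases h : τ x = .diamond
  · rcases z with z | ⟨z, hz⟩
    · simp [blockOf, h, fold]
    · simp [blockOf, h, fold]
  · rcases z with z | ⟨z, hz⟩
    · simp [blockOf, h, fold]
    · simp only [blockOf, h, fold, blockSupp]
      simp
      rintro rfl
      exact h hz

omit [DecidableEq V] in
theorem unfold_insert (x : T) (S : Finset T) :
    unfold τ (insert x S) = unfold τ S ∪ blockSupp (blockOf τ x) := by
  ext z
  rw [Finset.mem_union, mem_blockSupp_blockOf, mem_unfold, mem_unfold, Finset.mem_insert, or_comm]

omit [DecidableEq V] in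
theorem disjoint_blockOf {x : T} {S : Finset T} (hx : x ∉ S) :
    Disjoint (blockSupp (blockOf τ x)) (unfold τ S) := by
  rw [Finset.disjoint_left]
  intro z hz hz'
  rw [mem_blockSupp_blockOf] at hz
  rw [mem_unfold, hz] at hz'
  exact hx hz'

omit [DecidableEq V] [Fintype T] in
theorem rename_fold_blockCoeff (x : T) (k : ℕ) (F : MvPolynomial (Doubled τ) ℚ) :
    rename (fold τ) (blockCoeff (blockOf τ x) k F) = coeffAt x k (rename (fold τ) F) := by
  have h1 : rename (fold τ) (identify (blockOf τ x).1 (blockOf τ x).2 F) =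
      rename (fold τ) F := by
    rw [identify, rename_rename]
    congr 2
    ext z
    simp only [Function.comp_apply]
    split_ifs with h
    · rw [h, (mem_blockSupp_blockOf τ).1 (Finset.mem_insert_self _ _)]
      exact ((mem_blockSupp_blockOf τ).1 (by simp [blockSupp])).symm
    · rfl
  rw [blockCoeff_apply, ← h1]
  refine rename_coeffAt (fold τ) rfl (S := (fun z => if z = (blockOf τ x).2 then (blockOf τ x).1
    else z) '' Set.univ) ?_ k (rename_mem_supported _ (by simp))
  rintro _ ⟨z, -, rfl⟩ hz hz'
  dsimp only at hz hz'
  split_ifs at hz hz' with h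
  · exact hz rfl
  · have := (mem_blockSupp_blockOf τ).2 hz'
    rw [Finset.mem_insert, Finset.mem_singleton] at this
    exact this.elim hz h

theorem rename_fold_cross (hm : m.IsSymm) (hab : a ≠ b) (x : T) (S : Finset T) :
    rename (fold τ) (cross ε (doubledColour τ) (unfold τ S) (blockSupp (blockOf τ x))) =
      cross (mergedSystem ε a b hm hab) τ S {x} := by
  induction S using Finset.induction_on with
  | empty => simp [unfold, cross]
  | insert s S hs ih =>
    rw [unfold_insert, cross_union_left _ _ (disjoint_blockOf τ hs).symm, map_mul, ih,
      map_cross_block ε _ hab (isBlock_blockOf τ s) (isBlock_blockOf τ x) (rename (fold τ))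
        (p := X s) (q := X x)]
    · simp only [cross, Finset.prod_singleton, Finset.prod_insert hs]
      rw [mul_comm]
      rfl
    · intro z hz
      rw [rename_X, (mem_blockSupp_blockOf τ).1 hz]
    · intro z hz
      rw [rename_X, (mem_blockSupp_blockOf τ).1 hz]

end Merge

/-! ### Evaluation of words of block operators -/

section ListCoeff

variable {T : Type*} [DecidableEq T] (κ : T →₀ ℕ)

/-- Extraction of the coefficient with given exponents of the variables in a list. -/
def listCoeff : List T → MvPolynomial T ℚ →ₗ[ℚ] MvPolynomial T ℚ
  | [] => LinearMap.id
  | x :: L => coeffAt x (κ x) ∘ₗ listCoeff L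

theorem listCoeff_mul_of_mem {L : List T} {p : MvPolynomial T ℚ}
    (hp : p ∈ supported ℚ {x | x ∉ L}) (F : MvPolynomial T ℚ) :
    listCoeff κ L (p * F) = p * listCoeff κ L F := by
  induction L with
  | nil => rfl
  | cons x L ih =>
    rw [listCoeff, LinearMap.comp_apply, LinearMap.comp_apply, ih, coeffAt_mul_of_mem]
    · exact supported_mono (by intro y; simp +contextual) hp
    · exact supported_mono (by intro y; simp +contextual) hp

theorem coeff_listCoeff {L : List T} (hL : L.Nodup) (μ : T →₀ ℕ) (hμ : ∀ x ∈ L, μ x = 0)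
    (F : MvPolynomial T ℚ) :
    coeff μ (listCoeff κ L F) = coeff (μ + (L.map fun x => Finsupp.single x (κ x)).sum) F := by
  induction L generalizing μ with
  | nil => simp [listCoeff]
  | cons x L ih =>
    rw [listCoeff, LinearMap.comp_apply, coeff_coeffAt, if_pos (hμ x (by simp)),
      ih (List.nodup_cons.1 hL).2]
    · simp [add_assoc]
    · intro y hy
      have : x ≠ y := by rintro rfl; exact (List.nodup_cons.1 hL).1 hy
      simp [hμ y (List.mem_cons_of_mem _ hy), this]

theorem constantCoeff_listCoeff {L : List T} (hL : L.Nodup) (hL' : ∀ x, x ∈ L)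
    (F : MvPolynomial T ℚ) : constantCoeff (listCoeff κ L F) = coeff κ F := by
  rw [constantCoeff_eq, coeff_listCoeff κ hL 0 (by simp), zero_add]
  congr 1
  ext y
  have : ∀ L : List T, L.Nodup → ((L.map fun x => Finsupp.single x (κ x)).sum) y =
      if y ∈ L then κ y else 0 := by
    intro L hL
    induction L with
    | nil => simp
    | cons x L ih =>
      rw [List.nodup_cons] at hL
      rw [List.map_cons, List.sum_cons, Finsupp.add_apply, ih hL.2]
      by_cases h : x = y
      · subst h; simp [hL.1]
      · simp [Ne.symm h]
  rw [this L hL, if_pos (hL' y)]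

end ListCoeff

section Evaluation

variable {V : Type*} [DecidableEq V] {m : Matrix V V ℕ} (ε : SignSystem m) {a b : V}

omit [DecidableEq V] in
theorem IsEquivariant.single {T : Type*} [Fintype T] [DecidableEq T] {τ : T → V}
    {f : MvPolynomial T ℚ}
    (hf : ∀ σ : Equiv.Perm T, (∀ t, τ (σ t) = τ t) → rename σ f = f) :
    IsEquivariant τ (Pi.single Finset.univ f) where
  rename_eq σ hσ S := by
    by_cases h : S = Finset.univ
    · subst h
      rw [Finset.map_univ_equiv, Pi.single_eq_same, hf σ hσ]
    · rw [Pi.single_eq_of_ne h, Pi.single_eq_of_ne, map_zero]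
      intro h'
      exact h (Finset.map_injective σ.toEmbedding (h'.trans (Finset.map_univ_equiv σ).symm))
  mem_supported S := by
    by_cases h : S = Finset.univ
    · subst h
      simp
    · rw [Pi.single_eq_of_ne h]
      exact zero_mem _

/-- The product of the block operators belonging to the letters of a word. -/
def opWord {T : Type*} [Fintype T] [DecidableEq T] (τ : T → V) (W : List (Linked a b × ℕ)) :
    Module.End ℚ (Finset T → MvPolynomial T ℚ) :=
  (W.map fun x => blockOp ε τ x.1 x.2).prod

omit [DecidableEq V] in
theorem opWord_cons {T : Type*} [Fintype T] [DecidableEq T] (τ : T → V) (x : Linked a b × ℕ)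
    (W : List (Linked a b × ℕ)) (G : Finset T → MvPolynomial T ℚ) :
    opWord ε τ (x :: W) G = blockOp ε τ x.1 x.2 (opWord ε τ W G) := by
  simp [opWord]

omit [DecidableEq V] in
theorem IsEquivariant.opWord {T : Type*} [Fintype T] [DecidableEq T] {τ : T → V}
    {G : Finset T → MvPolynomial T ℚ} (hG : IsEquivariant τ G) (W : List (Linked a b × ℕ)) :
    IsEquivariant τ (opWord ε τ W G) := by
  induction W with
  | nil => exact hG
  | cons x W ih =>
    rw [opWord_cons]
    exact ih.blockOp ε _ _

variable {T : Type*} [Fintype T] [DecidableEq T] {τ : T → Linked a b}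

/-- The form of `exists_constantCoeff_opWord_eq` in which the labels in `S` remain. The scalar is
the product of the numbers of blocks that can be removed at each step, which are equivalent by
symmetry. -/
theorem exists_opWord_eq (hm : m.IsSymm) (hab : a ≠ b) {f : MvPolynomial (Doubled τ) ℚ}
    (hf : ∀ σ : Equiv.Perm (Doubled τ), (∀ t, doubledColour τ (σ t) = doubledColour τ t) →
      rename σ f = f) {L : List T} (hL : L.Nodup) {S : Finset T} (hS : ∀ x, x ∈ S ↔ x ∉ L) :
    ∃ N : ℚ, N ≠ 0 ∧ ∀ κ : T →₀ ℕ, rename (fold τ) (opWord ε (doubledColour τ)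
        (L.map fun x => (τ x, κ x)) (Pi.single Finset.univ f) (unfold τ S)) =
      N • listCoeff κ L (listFactor (mergedSystem ε a b hm hab) τ S L * rename (fold τ) f) := by
  induction L generalizing S with
  | nil =>
    refine ⟨1, one_ne_zero, fun κ => ?_⟩
    have : unfold τ S = Finset.univ := by
      ext z
      simp [mem_unfold, hS]
    simp [opWord, this, listCoeff, listFactor]
  | cons x L ih =>
    rw [List.nodup_cons] at hL
    have hxS : x ∉ S := by simp [hS]
    obtain ⟨N, hN, ih⟩ := ih hL.2 (S := insert x S) (by
      intro y
      rw [Finset.mem_insert, hS, List.mem_cons]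
      by_cases h : y = x
      · subst h; simp [hL.1]
      · simp [h])
    have hβ : blockOf τ x ∈ freeBlocks (doubledColour τ) (τ x) (unfold τ S) :=
      (mem_freeBlocks _).2 ⟨isBlock_blockOf τ x, disjoint_blockOf τ hxS⟩
    refine ⟨(freeBlocks (doubledColour τ) (τ x) (unfold τ S)).card * N, mul_ne_zero ?_ hN,
      fun κ => ?_⟩
    · rw [Nat.cast_ne_zero]
      exact Finset.card_ne_zero_of_mem hβ
    · have hmem : cross (mergedSystem ε a b hm hab) τ S {x} ∈ supported ℚ {y | y ∉ L} := by
        refine cross_mem_supported _ _ ?_ ?_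
        · intro s hs h
          exact (hS s).1 hs (List.mem_cons_of_mem _ h)
        · intro s hs
          rw [Finset.mem_singleton.1 hs]
          exact hL.1
      rw [List.map_cons, opWord_cons,
        ((IsEquivariant.single hf).opWord ε _).blockOp_apply ε hab _ hβ,
        map_smul, rename_fold_blockCoeff, map_mul, rename_fold_cross ε τ hm hab, ← unfold_insert,
        ih, listFactor_cons, listCoeff, LinearMap.comp_apply, mul_assoc,
        listCoeff_mul_of_mem κ hmem, mul_smul_comm, map_smul, smul_smul]

/-- Up to a nonzero factor, words of block operators removing all labels extract the coefficients
of one polynomial. -/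
theorem exists_constantCoeff_opWord_eq (hm : m.IsSymm) (hab : a ≠ b)
    {f : MvPolynomial (Doubled τ) ℚ}
    (hf : ∀ σ : Equiv.Perm (Doubled τ), (∀ t, doubledColour τ (σ t) = doubledColour τ t) →
      rename σ f = f) {L : List T} (hL : L.Nodup) (hL' : ∀ x, x ∈ L) :
    ∃ N : ℚ, N ≠ 0 ∧ ∀ κ : T →₀ ℕ, constantCoeff (opWord ε (doubledColour τ)
        (L.map fun x => (τ x, κ x)) (Pi.single Finset.univ f) ∅) =
      N * coeff κ (listFactor (mergedSystem ε a b hm hab) τ ∅ L * rename (fold τ) f) := by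
  obtain ⟨N, hN, h⟩ := exists_opWord_eq ε hm hab hf hL (S := ∅) (by simp [hL'])
  refine ⟨N, hN, fun κ => ?_⟩
  have h1 := congrArg constantCoeff (h κ)
  have h2 : unfold τ ∅ = ∅ := by simp [unfold]
  rw [constantCoeff_rename, h2, constantCoeff_smul, constantCoeff_listCoeff κ hL hL',
    smul_eq_mul] at h1
  exact h1

/-- The multiset of the vertices merged in a vertex of the linked quiver. -/
def content (x : Linked a b) : Multiset V := ∑ i ∈ letters x, {i}

/-- A word of block operators removes labels of the colours given by its letters. -/
theorem opWord_single_eq_zero {T : Type*} [Fintype T] [DecidableEq T] (τ : T → V) (hab : a ≠ b)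
    (f : MvPolynomial T ℚ) (W : List (Linked a b × ℕ)) (S : Finset T)
    (h : ∑ z ∈ S, ({τ z} : Multiset V) + (W.map fun x => content x.1).sum ≠
      ∑ z, ({τ z} : Multiset V)) :
    opWord ε τ W (Pi.single Finset.univ f) S = 0 := by
  induction W generalizing S with
  | nil =>
    have : S ≠ Finset.univ := by
      rintro rfl
      simp at h
    simp [opWord, Pi.single_eq_of_ne this]
  | cons x W ih =>
    rw [opWord_cons, blockOp_apply]
    refine Finset.sum_eq_zero fun β hβ => ?_
    rw [mem_freeBlocks] at hβ
    rw [ih, mul_zero, map_zero]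
    rw [Finset.sum_union hβ.2.symm, sum_block τ hab hβ.1 fun i => ({i} : Multiset V)]
    rw [List.map_cons, List.sum_cons, ← add_assoc] at h
    exact h

end Evaluation

/-! ### Faithfulness of the actions on labels -/

section Faithful

variable {V : Type*} [DecidableEq V] {m : Matrix V V ℕ} (ε : SignSystem m) {a b : V}

/-- The matrix coefficient of the action on labels determined by a polynomial `f`: the constant term
of what remains of `f` when all labels have been removed. -/
def evalFunctional {T : Type*} [Fintype T] [DecidableEq T] (τ : T → V) (hm : m.IsSymm)
    (hab : a ≠ b) (f : MvPolynomial T ℚ) : MatrixAlg m →ₗ[ℚ] ℚ where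
  toFun y := constantCoeff (labelAction ε a b τ hm hab y (Pi.single Finset.univ f) ∅)
  map_add' x y := by simp
  map_smul' c x := by simp [constantCoeff_smul]

theorem evalFunctional_apply {T : Type*} [Fintype T] [DecidableEq T] (τ : T → V) (hm : m.IsSymm)
    (hab : a ≠ b) (f : MvPolynomial T ℚ) (y : MatrixAlg m) :
    evalFunctional ε τ hm hab f y =
      constantCoeff (labelAction ε a b τ hm hab y (Pi.single Finset.univ f) ∅) := rfl

theorem labelAction_word {T : Type*} [Fintype T] [DecidableEq T] (τ : T → V) (hm : m.IsSymm)
    (hab : a ≠ b) (W : List (V × ℕ)) :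
    labelAction ε a b τ hm hab (W.map (gen m)).prod =
      opWord ε τ (W.map fun x => ((.old x.1 : Linked a b), x.2)) := by
  induction W with
  | nil => simp [opWord]
  | cons x W ih =>
    rw [List.map_cons, List.prod_cons, map_mul, ih, labelAction_gen]
    simp [opWord]

theorem sum_singleton_eq_map {X T : Type*} [Fintype T] (τ : T → X) :
    ∑ t, ({τ t} : Multiset X) = Finset.univ.val.map τ := by
  rw [Finset.sum, ← Multiset.sum_map_singleton (Finset.univ.val.map τ), Multiset.map_map]
  rfl

theorem sum_map_of_nodup {T : Type*} [Fintype T] {L : List T} (hL : L.Nodup)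
    (hL' : ∀ t, t ∈ L) (κ : T → ℕ) : (L.map κ).sum = ∑ t, κ t := by
  classical
  rw [← List.sum_toFinset _ hL]
  congr 1
  ext t
  simp [hL']

theorem labelWord_eq_prod {V : Type*} {m : Matrix V V ℕ} {T : Type*} (τ : T → V)
    (κ : T →₀ ℕ) (L : List T) :
    labelWord m τ κ L = ((L.map fun t => (τ t, κ t)).map (gen m)).prod := by
  rw [labelWord, List.map_map]; rfl

theorem listFactor_old (hm : m.IsSymm) (hab : a ≠ b) {T : Type*} [DecidableEq T] (τ : T → V)
    (S : Finset T) (L : List T) :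
    listFactor (mergedSystem ε a b hm hab) (fun t => .old (τ t)) S L = listFactor ε τ S L := by
  induction L generalizing S with
  | nil => rfl
  | cons t L ih =>
    rw [listFactor_cons, listFactor_cons, ih]
    congr 1
    simp [cross, factor, mergedSystem, mergedMatrix_old, mergedSign_old]

theorem sum_content_old (W : List (V × ℕ)) :
    (W.map fun x => content (.old x.1 : Linked a b)).sum = ((W.map Prod.fst : List V) :
      Multiset V) := by
  induction W with
  | nil => rfl
  | cons x W ih =>
    rw [List.map_cons, List.sum_cons, ih]
    simp [content, letters]

/-- Every nonzero element is detected by a functional on the words with the vertices of a family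
of labels, and this functional is given by a symmetric polynomial in these labels. -/
theorem exists_symmetric_dual {X : Type*} {m : Matrix X X ℕ} (ε : SignSystem m) (hm : m.IsSymm)
    {y : MatrixAlg m} (hy : y ≠ 0) :
    ∃ (n : ℕ) (τ : Fin n → X) (φ : MatrixAlg m →ₗ[ℚ] ℚ) (g : MvPolynomial (Fin n) ℚ), φ y ≠ 0 ∧
      (∀ W : List (X × ℕ), ((W.map Prod.fst : List X) : Multiset X) ≠ Finset.univ.val.map τ →
        φ (W.map (gen m)).prod = 0) ∧
      (∀ σ : Equiv.Perm (Fin n), (∀ t, τ (σ t) = τ t) → rename σ g = g) ∧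
      ∀ κ, coeff κ (listFactor ε τ ∅ (List.finRange n) * g) =
        φ (labelWord m τ κ (List.finRange n)) := by
  obtain ⟨φ, μ, D, hφy, hφ⟩ := exists_homogeneous_dual m hy
  have hμ : Finset.univ.val.map μ.toList.get = μ := by
    rw [Fin.univ_val_map, List.ofFn_get, Multiset.coe_toList]
  have hL := List.nodup_finRange μ.toList.length
  have hL' : ∀ t, t ∈ List.finRange μ.toList.length := List.mem_finRange
  obtain ⟨g, hg, hgφ⟩ := exists_symmetric_quotient ε (τ := μ.toList.get) (φ := φ) (D := D) hm hL
    hL' (by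
      intro κ hκ
      rw [labelWord_eq_prod]
      refine hφ _ fun h => hκ ?_
      rw [wordClass_eq] at h
      have h2 := congrArg Prod.snd h
      dsimp only at h2
      rw [List.map_map] at h2
      rw [← h2, ← sum_map_of_nodup hL hL']
      rfl)
  refine ⟨_, μ.toList.get, φ, g, hφy, fun W hW => hφ W ?_, hg, hgφ⟩
  rw [wordClass_eq]
  intro h
  rw [Prod.ext_iff] at h
  exact hW (h.1.trans hμ.symm)

/-- The actions on all finite sets of labels are jointly faithful. -/
theorem eq_zero_of_labelAction (hm : m.IsSymm) (hab : a ≠ b) {y : MatrixAlg m}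
    (hy : ∀ (T : Type) [Fintype T] [DecidableEq T] (τ : T → V),
      labelAction ε a b τ hm hab y = 0) : y = 0 := by
  by_contra hy0
  obtain ⟨n, τ, φ, g, hφy, hφ, hg, hgφ⟩ := exists_symmetric_dual ε hm hy0
  have hL := List.nodup_finRange n
  have hL' : ∀ t, t ∈ List.finRange n := List.mem_finRange
  set τ' : Fin n → Linked a b := fun t => .old (τ t)
  have : IsEmpty {x // τ' x = .diamond} := ⟨fun x => by simpa [τ'] using x.2⟩
  let e : Doubled τ' ≃ Fin n := Equiv.sumEmpty _ _
  have he : ∀ z, fold τ' z = e z := by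
    rintro (z | z)
    · rfl
    · exact isEmptyElim z
  have hcol : ∀ z, doubledColour τ' z = τ (e z) := by
    rintro (z | z)
    · rfl
    · exact isEmptyElim z
  obtain ⟨N, hN, hNκ⟩ := exists_constantCoeff_opWord_eq ε hm hab (f := rename e.symm g) (by
    intro σ hσ
    rw [rename_rename]
    have h1 := hg ((e.symm.trans σ).trans e) (by
      intro t
      have := hσ (e.symm t)
      rw [hcol, hcol, e.apply_symm_apply] at this
      exact this)
    conv_rhs => rw [← h1, rename_rename]
    congr 2
    ext t
    simp) hL hL'
  have hfold : rename (fold τ') (rename e.symm g) = g := by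
    rw [rename_rename]
    have : fold τ' ∘ e.symm = id := by
      funext t
      simp [he]
    rw [this, rename_id, AlgHom.id_apply]
  have key : evalFunctional ε (doubledColour τ') hm hab (rename e.symm g) = N • φ := by
    refine functional_ext_of_labelWord hm (τ := τ) hL hL' ?_ ?_ ?_
    · intro κ
      rw [labelWord_eq_prod, evalFunctional_apply, labelAction_word, List.map_map,
        LinearMap.smul_apply, ← labelWord_eq_prod, ← hgφ, smul_eq_mul,
        ← listFactor_old ε hm hab τ, ← congrArg (listFactor _ _ _ _ * ·) hfold]
      exact hNκ κ
    · intro W hW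
      rw [evalFunctional_apply, labelAction_word, opWord_single_eq_zero ε _ hab, map_zero]
      rw [sum_singleton_eq_map, Finset.sum_empty, zero_add]
      intro h
      refine hW ?_
      rw [List.map_map] at h
      have h1 : (Finset.univ.val.map (doubledColour τ')) = Finset.univ.val.map τ := by
        rw [← sum_singleton_eq_map, ← sum_singleton_eq_map]
        exact Fintype.sum_equiv e _ _ fun z => by rw [hcol]
      rw [← h1, ← h, ← sum_content_old (a := a) (b := b)]
      rfl
    · intro W hW
      rw [LinearMap.smul_apply, hφ W hW, smul_zero]
  have h1 := LinearMap.congr_fun key y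
  rw [evalFunctional_apply, hy] at h1
  simp only [LinearMap.zero_apply, Pi.zero_apply, map_zero, LinearMap.smul_apply] at h1
  exact (smul_ne_zero hN hφy) h1.symm

end Faithful

/-! ### Relations satisfied by the new generators -/

section Hat

variable {V : Type*} [DecidableEq V] {m : Matrix V V ℕ} (ε : SignSystem m) {a b : V}

variable (m a b) in
/-- The elements of the original algebra that correspond to the generators of the linked one. -/
def hatGen : Linked a b × ℕ → MatrixAlg m
  | (.old i, k) => gen m (i, k)
  | (.diamond, k) => PowerSeries.coeff k (genSeries m a * formalDeriv^[m a b] (genSeries m b))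

omit [DecidableEq V] in
theorem hatGen_diamond (n : ℕ) : hatGen m a b (.diamond, n) =
    ∑ x ∈ antidiagonal n, (x.2 + m a b).descFactorial (m a b) •
      (gen m (a, x.1) * gen m (b, x.2 + m a b)) := by
  rw [hatGen, genSeries, genSeries, coeff_mk_mul_formalDeriv]

/-- The factor by which the action of the new generators differs from the block operators. -/
def hatScalar : Linked a b → ℚ
  | .old _ => 1
  | .diamond => ε.val a b * ((-1) ^ m a b * (m a b).factorial)

omit [DecidableEq V] in
theorem hatScalar_ne_zero (x : Linked a b) : hatScalar ε x ≠ 0 := by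
  cases x with
  | old i => exact one_ne_zero
  | diamond => exact mul_ne_zero (ε.ne_zero _ _) (by positivity)

variable {T : Type*} [Fintype T] [DecidableEq T] (τ : T → V)

theorem labelAction_hatGen (hm : m.IsSymm) (hab : a ≠ b) (x : Linked a b) (k : ℕ) :
    labelAction ε a b τ hm hab (hatGen m a b (x, k)) = hatScalar ε x • blockOp ε τ x k := by
  cases x with
  | old i => rw [hatGen, labelAction_gen, hatScalar, one_smul]
  | diamond =>
    refine LinearMap.ext fun G => ?_
    rw [LinearMap.smul_apply, hatScalar, ← sum_blockOp_a_b ε τ hab, hatGen_diamond, map_sum,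
      LinearMap.sum_apply]
    refine Finset.sum_congr rfl fun x _ => ?_
    rw [map_nsmul, map_mul, labelAction_gen, labelAction_gen]
    rfl

theorem labelAction_hatWord (hm : m.IsSymm) (hab : a ≠ b) (W : List (Linked a b × ℕ)) :
    labelAction ε a b τ hm hab (W.map (hatGen m a b)).prod =
      (W.map fun x => hatScalar ε x.1).prod • opWord ε τ W := by
  induction W with
  | nil => simp [opWord]
  | cons x W ih =>
    obtain ⟨x, k⟩ := x
    rw [List.map_cons, List.prod_cons, map_mul, ih, labelAction_hatGen]
    simp [opWord, smul_smul, mul_comm]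

theorem neg_one_pow_linkedMatrix (hab : a ≠ b) (x y : Linked a b) :
    (-1 : ℚ) ^ (linkedMatrix m a b x x * linkedMatrix m a b y y) =
      (-1) ^ ((∑ i ∈ letters x, m i i) * ∑ i ∈ letters y, m i i) := by
  have h : ∀ x : Linked a b, (-1 : ℚ) ^ linkedMatrix m a b x x = (-1) ^ ∑ i ∈ letters x, m i i := by
    intro x
    cases x with
    | old i =>
      rw [linkedMatrix, if_neg, letters, Finset.sum_singleton]
      rintro (⟨rfl, h⟩ | ⟨rfl, h⟩)
      exacts [hab h, hab h.symm]
    | diamond => simp [linkedMatrix, letters, Finset.sum_pair hab, pow_add, pow_mul]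
  rw [pow_mul, h, ← pow_mul, mul_comm, pow_mul, h, ← pow_mul, mul_comm]

theorem hatGen_supercomm (hm : m.IsSymm) (hab : a ≠ b) (x y : Linked a b) (k l : ℕ) :
    hatGen m a b (x, k) * hatGen m a b (y, l) =
      (-1) ^ (linkedMatrix m a b x x * linkedMatrix m a b y y) *
        (hatGen m a b (y, l) * hatGen m a b (x, k)) := by
  obtain ⟨ε⟩ := exists_signSystem hm
  rw [neg_one_pow_mul_eq_smul, ← sub_eq_zero]
  refine eq_zero_of_labelAction ε hm hab fun T _ _ τ => ?_
  rw [map_sub, map_smul, map_mul, map_mul, labelAction_hatGen, labelAction_hatGen, sub_eq_zero]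
  refine LinearMap.ext fun G => ?_
  simp only [Module.End.mul_apply, LinearMap.smul_apply, map_smul]
  rw [blockOp_comm ε τ hm hab x y, neg_one_pow_linkedMatrix hab]
  simp only [smul_smul]
  congr 1
  ring

/-- The relations between the generators of the linked quiver, except for the highest one for the
vertices `a` and `b`, hold in the original algebra without passing to the associated graded
algebra. -/
theorem hatGen_diag (hm : m.IsSymm) (hab : a ≠ b) {x y : Linked a b} {p : ℕ}
    (hp : p < mergedMatrix m x y) (n : ℕ) :
    ∑ z ∈ antidiagonal n, (z.2 + p).descFactorial p •
      (hatGen m a b (x, z.1) * hatGen m a b (y, z.2 + p)) = 0 := by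
  obtain ⟨ε⟩ := exists_signSystem hm
  refine eq_zero_of_labelAction ε hm hab fun T _ _ τ => ?_
  refine LinearMap.ext fun G => ?_
  have h := sum_blockOp_blockOp_eq_zero ε τ hab hp n G
  have h2 := congrArg (fun F => (hatScalar ε x * hatScalar ε y) • F) h
  simp only [smul_zero, Finset.smul_sum] at h2
  rw [map_sum, LinearMap.sum_apply, LinearMap.zero_apply, ← h2]
  refine Finset.sum_congr rfl fun z _ => ?_
  rw [map_nsmul, map_mul, labelAction_hatGen, labelAction_hatGen, LinearMap.smul_apply,
    Module.End.mul_apply, LinearMap.smul_apply, LinearMap.smul_apply, map_smul, smul_smul,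
    smul_comm]

/-- The product of the series of `b` with the derivative of order `m a b` of the series of `a` is a
multiple of the series of the new vertex. -/
theorem exists_hatGen_b_a (hm : m.IsSymm) (hab : a ≠ b) (n : ℕ) :
    ∃ c : ℚ, ∑ z ∈ antidiagonal n, (z.2 + m a b).descFactorial (m a b) •
      (gen m (b, z.1) * gen m (a, z.2 + m a b)) = c • hatGen m a b (.diamond, n) := by
  obtain ⟨ε⟩ := exists_signSystem hm
  refine ⟨ε.val b a * (ε.val a b)⁻¹, ?_⟩
  rw [← sub_eq_zero]
  refine eq_zero_of_labelAction ε hm hab fun T _ _ τ => ?_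
  rw [map_sub, map_smul, sub_eq_zero, labelAction_hatGen]
  refine LinearMap.ext fun G => ?_
  have h := sum_blockOp_b_a ε τ hm hab n G
  rw [map_sum, LinearMap.sum_apply, LinearMap.smul_apply, LinearMap.smul_apply, hatScalar,
    smul_smul]
  have h1 : ε.val b a * (ε.val a b)⁻¹ * (ε.val a b * ((-1) ^ m a b * (m a b).factorial)) =
      ε.val b a * ((-1) ^ m a b * (m a b).factorial) := by
    have := ε.ne_zero a b
    field_simp
  rw [h1, ← h]
  refine Finset.sum_congr rfl fun z _ => ?_
  rw [map_nsmul, map_mul, labelAction_gen, labelAction_gen]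
  rfl

/-- The relations of the linked quiver that are not among those of `hatGen_diag`. -/
theorem lt_mergedMatrix_or {x y : Linked a b} {p : ℕ} (hm : m.IsSymm) (hab : a ≠ b)
    (hp : p < linkedMatrix m a b x y) :
    p < mergedMatrix m x y ∨ (x = .old a ∧ y = .old b ∧ p = m a b) ∨
      (x = .old b ∧ y = .old a ∧ p = m a b) := by
  cases x with
  | old i =>
    cases y with
    | old j =>
      rw [mergedMatrix_old]
      rw [linkedMatrix] at hp
      split_ifs at hp with h
      · rcases h with ⟨rfl, rfl⟩ | ⟨rfl, rfl⟩
        · rcases Nat.lt_succ_iff_lt_or_eq.1 hp with h | h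
          · exact Or.inl h
          · exact Or.inr (Or.inl ⟨rfl, rfl, h⟩)
        · rcases Nat.lt_succ_iff_lt_or_eq.1 hp with h | h
          · exact Or.inl h
          · exact Or.inr (Or.inr ⟨rfl, rfl, h.trans (hm.apply _ _)⟩)
      · exact Or.inl hp
    | diamond =>
      left
      simpa [linkedMatrix, mergedMatrix, letters, Finset.sum_pair hab] using hp
  | diamond =>
    left
    cases y with
    | old j =>
      simpa [linkedMatrix, mergedMatrix, letters, Finset.sum_pair hab, hm.apply a j,
        hm.apply b j] using hp
    | diamond =>
      have := hm.apply a b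
      simp only [linkedMatrix, mergedMatrix, letters, Finset.sum_pair hab] at hp ⊢
      omega

end Hat

/-! ### The homomorphism to the associated graded algebra -/

theorem AlgFiltration.cls_eq_zero_of_mem {R A : Type*} [CommRing R] [Ring A] [Algebra R A]
    (𝓕 : AlgFiltration R A) {p : ℕ} {x : 𝓕.F p} (hx : (x : A) ∈ 𝓕.pred p) : 𝓕.cls p x = 0 := by
  rw [AlgFiltration.cls, LinearMap.comp_apply, (𝓕.toPiece_eq_zero p x).2 hx, map_zero]

section LinkingMap

variable {V : Type*} [DecidableEq V] [Quiver V] (a b : V)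

/-- The elements of the original algebra that correspond to the generators of the linked one. -/
abbrev hat : Linked a b × ℕ → QuadAlg V := hatGen (incidence V) a b

omit [DecidableEq V] in
theorem hat_mem_linkingSet (x : Linked a b × ℕ) : hat a b x ∈ linkingSet a b := by
  obtain ⟨x | _, k⟩ := x
  · exact Or.inl ⟨_, rfl⟩
  · exact Or.inr ⟨_, rfl⟩

omit [DecidableEq V] in
theorem linkingSet_eq_range : linkingSet a b = Set.range (hat a b) := by
  apply Set.Subset.antisymm
  · rintro _ (⟨⟨i, k⟩, rfl⟩ | ⟨k, rfl⟩)
    · exact ⟨(.old i, k), rfl⟩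
    · exact ⟨(.diamond, k), rfl⟩
  · rintro _ ⟨x, rfl⟩
    exact hat_mem_linkingSet a b x

omit [DecidableEq V] in
theorem hat_mem (x : Linked a b × ℕ) : hat a b x ∈ (linkingFiltration a b).F 1 :=
  AlgFiltration.mem_generatedBy_one ℚ (hat_mem_linkingSet a b x)

omit [DecidableEq V] in
theorem linkingFiltration_F (p : ℕ) : (linkingFiltration a b).F p =
    Submodule.span ℚ {x | ∃ W : List (Linked a b × ℕ), W.length ≤ p ∧
      (W.map (hat a b)).prod = x} := by
  change Submodule.span ℚ _ = _
  congr 1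
  ext x
  constructor
  · rintro ⟨l, hl, hS, rfl⟩
    have : l ∈ Set.range (List.map (hat a b)) := by
      rw [Set.range_list_map]
      intro y hy
      rw [← linkingSet_eq_range]
      exact hS y hy
    obtain ⟨W, rfl⟩ := this
    exact ⟨W, by simpa using hl, rfl⟩
  · rintro ⟨W, hW, rfl⟩
    refine ⟨W.map (hat a b), by simpa using hW, ?_, rfl⟩
    intro y hy
    obtain ⟨x, -, rfl⟩ := List.mem_map.1 hy
    exact hat_mem_linkingSet a b x

omit [DecidableEq V] in
theorem hatWord_mem (W : List (Linked a b × ℕ)) :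
    (W.map (hat a b)).prod ∈ (linkingFiltration a b).F W.length := by
  rw [linkingFiltration_F]
  exact Submodule.subset_span ⟨W, le_rfl, rfl⟩

/-- The class of a generator in the associated graded algebra. -/
def hatCls (x : Linked a b × ℕ) : (linkingFiltration a b).Gr :=
  (linkingFiltration a b).cls 1 ⟨hat a b x, hat_mem a b x⟩

theorem isLinkingMap_iff (π : QuadAlg (Linked a b) →ₐ[ℚ] (linkingFiltration a b).Gr) :
    IsLinkingMap a b π ↔ ∀ x, π (gen (incidence (Linked a b)) x) = hatCls a b x := by
  constructor
  · rintro ⟨h1, h2⟩ ⟨i | _, k⟩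
    · exact h1 i k
    · exact h2 k
  · intro h
    exact ⟨fun i k => h (.old i, k), fun k => h (.diamond, k)⟩

omit [DecidableEq V] in
/-- The weight of the product is written `1 + 1`, the form in which `cls_mul_cls` produces it. -/
theorem hatCls_mul_hatCls (x y : Linked a b × ℕ) : hatCls a b x * hatCls a b y =
    (linkingFiltration a b).cls (1 + 1) ⟨hat a b x * hat a b y,
      (linkingFiltration a b).mul_mem (p := 1) (q := 1) (hat_mem a b x) (hat_mem a b y)⟩ :=
  (linkingFiltration a b).cls_mul_cls 1 1 ⟨hat a b x, hat_mem a b x⟩ ⟨hat a b y, hat_mem a b y⟩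

variable {a b}

theorem incidence_linked_apply (x y : Linked a b) :
    incidence (Linked a b) x y = linkedMatrix (incidence V) a b x y := by
  rw [incidence_linked]

variable (a b) in
/-- The homomorphism from the algebra of the linked quiver to the associated graded algebra. -/
def linkingMap (hm : (incidence V).IsSymm) (hab : a ≠ b) :
    QuadAlg (Linked a b) →ₐ[ℚ] (linkingFiltration a b).Gr :=
  matrixLift (m := incidence (Linked a b)) (hatCls a b)
    (by
      intro x y k l
      refine Eq.trans ?_ (neg_one_pow_mul_eq_smul
        (incidence (Linked a b) x x * incidence (Linked a b) y y) _).symm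
      rw [hatCls_mul_hatCls, hatCls_mul_hatCls, ← map_smul]
      congr 1
      ext
      change hatGen _ a b _ * hatGen _ a b _ = _ • (hatGen _ a b _ * hatGen _ a b _)
      have h := hatGen_supercomm hm hab x y k l
      rw [← incidence_linked_apply, ← incidence_linked_apply] at h
      exact h.trans (neg_one_pow_mul_eq_smul _ _))
    (by
      intro x y p n hp
      rw [incidence_linked_apply] at hp
      -- each of these sums lies in `F 1`, so its class of weight two vanishes
      simp only [hatCls_mul_hatCls, ← map_nsmul, ← map_sum]
      refine AlgFiltration.cls_eq_zero_of_mem _ ?_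
      change _ ∈ (linkingFiltration a b).F 1
      have h : ((∑ z ∈ antidiagonal n, (z.2 + p).descFactorial p •
          (⟨hat a b (x, z.1) * hat a b (y, z.2 + p), (linkingFiltration a b).mul_mem
            (p := 1) (q := 1) (hat_mem a b _) (hat_mem a b _)⟩ :
              (linkingFiltration a b).F (1 + 1)) :
          (linkingFiltration a b).F (1 + 1)) : QuadAlg V) =
          ∑ z ∈ antidiagonal n, (z.2 + p).descFactorial p •
            (hat a b (x, z.1) * hat a b (y, z.2 + p)) := by
        simp
      rw [h]
      rcases lt_mergedMatrix_or hm hab hp with h | ⟨rfl, rfl, rfl⟩ | ⟨rfl, rfl, rfl⟩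
      · rw [hatGen_diag hm hab h]
        exact zero_mem _
      · have := hat_mem a b (.diamond, n)
        rw [hat, hatGen_diamond] at this
        exact this
      · obtain ⟨c, hc⟩ := exists_hatGen_b_a hm hab n
        have := Submodule.smul_mem _ c (hat_mem a b (.diamond, n))
        rw [hat, ← hc] at this
        exact this)

variable (hm : (incidence V).IsSymm) (hab : a ≠ b)

theorem linkingMap_gen (x : Linked a b × ℕ) :
    linkingMap a b hm hab (gen _ x) = hatCls a b x :=
  matrixLift_gen _ _ _ _

theorem linkingMap_word (W : List (Linked a b × ℕ)) :
    linkingMap a b hm hab (W.map (gen _)).prod =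
      (linkingFiltration a b).cls W.length ⟨(W.map (hat a b)).prod, hatWord_mem a b W⟩ := by
  induction W with
  | nil =>
    rw [List.map_nil, List.prod_nil, map_one]
    rfl
  | cons x W ih =>
    rw [List.map_cons, List.prod_cons, map_mul, ih, linkingMap_gen, hatCls,
      AlgFiltration.cls_mul_cls]
    have h : ∀ (p q : ℕ) (h : p = q) (y : (linkingFiltration a b).F p)
        (z : (linkingFiltration a b).F q), (y : QuadAlg V) = z →
        (linkingFiltration a b).cls p y = (linkingFiltration a b).cls q z := by
      rintro p q rfl y z h
      rw [Subtype.ext h]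
    refine h _ _ (by simp [add_comm]) _ _ ?_
    simp

theorem linkingMap_unique {π : QuadAlg (Linked a b) →ₐ[ℚ] (linkingFiltration a b).Gr}
    (h : IsLinkingMap a b π) : π = linkingMap a b hm hab := by
  rw [isLinkingMap_iff] at h
  have key : π.toLinearMap = (linkingMap a b hm hab).toLinearMap := by
    refine linearMap_ext_words _ fun l => ?_
    simp only [AlgHom.toLinearMap_apply]
    induction l with
    | nil => simp
    | cons x l ih => rw [List.map_cons, List.prod_cons, map_mul, map_mul, ih, h, linkingMap_gen]
  exact AlgHom.toLinearMap_injective key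

/-- A class of weight `p` is represented by words of length exactly `p`, since shorter words have
class zero. -/
theorem cls_mem_of_mem_span {𝒲 : Set (List (Linked a b × ℕ))} {p : ℕ}
    {M : Submodule ℚ (linkingFiltration a b).Gr}
    (hM : ∀ W ∈ 𝒲, W.length = p → linkingMap a b hm hab (W.map (gen _)).prod ∈ M)
    {x : QuadAlg V} (hx : x ∈ (linkingFiltration a b).F p)
    (hx' : x ∈ Submodule.span ℚ {x | ∃ W ∈ 𝒲, W.length ≤ p ∧ (W.map (hat a b)).prod = x}) :
    (linkingFiltration a b).cls p ⟨x, hx⟩ ∈ M := by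
  induction hx' using Submodule.span_induction with
  | mem x h =>
    obtain ⟨W, hW, hl, rfl⟩ := h
    rcases hl.lt_or_eq with h | rfl
    · rw [AlgFiltration.cls_eq_zero_of_mem]
      · exact zero_mem _
      · obtain ⟨q, rfl⟩ : ∃ q, p = q + 1 := ⟨p - 1, by omega⟩
        exact (linkingFiltration a b).mono (Nat.lt_succ_iff.1 h) (hatWord_mem a b W)
    · rw [← linkingMap_word hm hab]
      exact hM W hW rfl
  | zero =>
    have : (⟨0, hx⟩ : (linkingFiltration a b).F p) = 0 := rfl
    rw [this, map_zero]
    exact zero_mem _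
  | add x y hx1 hy1 h1 h2 =>
    have hF : ∀ z ∈ Submodule.span ℚ {x | ∃ W ∈ 𝒲, W.length ≤ p ∧ (W.map (hat a b)).prod = x},
        z ∈ (linkingFiltration a b).F p := by
      intro z hz
      rw [linkingFiltration_F]
      refine Submodule.span_mono ?_ hz
      rintro _ ⟨W, -, h⟩
      exact ⟨W, h⟩
    have : (⟨x + y, hx⟩ : (linkingFiltration a b).F p) = ⟨x, hF x hx1⟩ + ⟨y, hF y hy1⟩ := rfl
    rw [this, map_add]
    exact add_mem (h1 _) (h2 _)
  | smul c x hx1 h1 =>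
    have hF : x ∈ (linkingFiltration a b).F p := by
      rw [linkingFiltration_F]
      refine Submodule.span_mono ?_ hx1
      rintro _ ⟨W, -, h⟩
      exact ⟨W, h⟩
    have : (⟨c • x, hx⟩ : (linkingFiltration a b).F p) = c • ⟨x, hF⟩ := rfl
    rw [this, map_smul]
    exact Submodule.smul_mem _ _ (h1 _)

theorem map_homogeneousPart_weight (p : ℕ) :
    (homogeneousPart (incidence (Linked a b)) (fun _ => 1) p).map
        (linkingMap a b hm hab).toLinearMap =
      LinearMap.range ((linkingFiltration a b).cls p) := by
  apply le_antisymm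
  · rw [homogeneousPart, Submodule.map_span, Submodule.span_le]
    rintro _ ⟨_, ⟨W, hW, rfl⟩, rfl⟩
    have hl : W.length = p := by simpa using hW
    subst hl
    exact ⟨_, (linkingMap_word hm hab W).symm⟩
  · rintro _ ⟨⟨x, hx⟩, rfl⟩
    refine cls_mem_of_mem_span hm hab (𝒲 := Set.univ) ?_ hx ?_
    · intro W _ hW
      exact Submodule.mem_map_of_mem (Submodule.subset_span ⟨W, by simpa using hW, rfl⟩)
    · rw [linkingFiltration_F] at hx
      simpa using hx

theorem linkingMap_surjective : Function.Surjective (linkingMap a b hm hab) := by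
  intro y
  change y ∈ LinearMap.range (linkingMap a b hm hab).toLinearMap
  induction y using DirectSum.induction_on with
  | zero => exact zero_mem _
  | of p x =>
    obtain ⟨x, rfl⟩ := (linkingFiltration a b).toPiece_surjective p x
    have h : (linkingFiltration a b).cls p x ∈
        LinearMap.range ((linkingFiltration a b).cls p) := ⟨x, rfl⟩
    rw [← map_homogeneousPart_weight hm hab] at h
    exact LinearMap.map_le_range h
  | add x y hx hy => exact add_mem hx hy

/-! ### Compatibility with the degrees -/

theorem gradingProj_of_mem_homogeneousPart {V : Type*} {m : Matrix V V ℕ} {G : Type*}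
    [AddCommMonoid G] (α : V → G) (β : G) {g : G} {y : MatrixAlg m}
    (hy : y ∈ homogeneousPart m (fun x => α x.1 + x.2 • β) g) :
    gradingProj m α β g y = y := by
  classical
  induction hy using Submodule.span_induction with
  | mem y h =>
    obtain ⟨l, hl, rfl⟩ := h
    rw [gradingProj_word, if_pos hl]
  | zero => exact map_zero _
  | add x y _ _ hx hy => rw [map_add, hx, hy]
  | smul c x _ hx => rw [map_smul, hx]

theorem gradingProj_of_mem_homogeneousPart_of_ne {V : Type*} {m : Matrix V V ℕ} {G : Type*}
    [AddCommMonoid G] (α : V → G) (β : G) {g g' : G} (hg : g' ≠ g) {y : MatrixAlg m}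
    (hy : y ∈ homogeneousPart m (fun x => α x.1 + x.2 • β) g') :
    gradingProj m α β g y = 0 := by
  classical
  induction hy using Submodule.span_induction with
  | mem y h =>
    obtain ⟨l, hl, rfl⟩ := h
    rw [gradingProj_word, if_neg (hl.trans_ne hg)]
  | zero => exact map_zero _
  | add x y _ _ hx hy => rw [map_add, hx, hy, add_zero]
  | smul c x _ hx => rw [map_smul, hx, smul_zero]

theorem mul_mem_homogeneousPart {V : Type*} {m : Matrix V V ℕ} {G : Type*} [AddCommMonoid G]
    {deg : V × ℕ → G} {g g' : G} {x y : MatrixAlg m} (hx : x ∈ homogeneousPart m deg g)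
    (hy : y ∈ homogeneousPart m deg g') : x * y ∈ homogeneousPart m deg (g + g') := by
  have h := Submodule.mul_mem_mul hx hy
  rw [homogeneousPart, homogeneousPart, Submodule.span_mul_span] at h
  refine Submodule.span_mono ?_ h
  rintro _ ⟨_, ⟨l, hl, rfl⟩, _, ⟨l', hl', rfl⟩, rfl⟩
  exact ⟨l ++ l', by simp [hl, hl'], by simp⟩

theorem hat_mem_homogeneousPart (x : Linked a b × ℕ) (hab : a ≠ b) :
    hat a b x ∈ homogeneousPart (incidence V) (genDegree (incidence V)) (reducedDegree a b x) := by
  obtain ⟨i | _, k⟩ := x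
  · refine Submodule.subset_span ⟨[(i, k)], ?_, by simp [hat, hatGen]⟩
    have h : linkedMatrix (incidence V) a b (.old i) (.old i) = incidence V i i := by
      rw [linkedMatrix, if_neg]
      rintro (⟨rfl, h⟩ | ⟨rfl, h⟩)
      exacts [hab h, hab h.symm]
    simp only [List.map_cons, List.map_nil, List.sum_cons, List.sum_nil, add_zero, genDegree,
      reducedDegree, incidence_linked_apply, h]
  · rw [hat, hatGen_diamond]
    refine sum_mem fun z hz => nsmul_mem (Submodule.subset_span ?_) _
    refine ⟨[(a, z.1), (b, z.2 + incidence V a b)], ?_, by simp⟩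
    have hz : z.1 + z.2 = k := Finset.HasAntidiagonal.mem_antidiagonal.1 hz
    simp only [List.map_cons, List.map_nil, List.sum_cons, List.sum_nil, add_zero, genDegree,
      reducedDegree, incidence_linked_apply, linkedMatrix, Prod.mk_add_mk]
    rw [← hz]
    congr 1
    push_cast
    ring

theorem hatWord_mem_homogeneousPart (W : List (Linked a b × ℕ)) (hab : a ≠ b) :
    (W.map (hat a b)).prod ∈ homogeneousPart (incidence V) (genDegree (incidence V))
      (W.map (reducedDegree a b)).sum := by
  induction W with
  | nil => exact Submodule.subset_span ⟨[], rfl, rfl⟩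
  | cons x W ih =>
    rw [List.map_cons, List.map_cons, List.prod_cons, List.sum_cons]
    exact mul_mem_homogeneousPart (hat_mem_homogeneousPart x hab) ih

omit [Quiver V] in
theorem genDegree_eq (m : Matrix V V ℕ) : genDegree m =
    fun x => (Pi.single x.1 1, - (m x.1 x.1 : ℤ)) + x.2 • ((0 : V → ℤ), (-2 : ℤ)) := by
  funext x
  ext1
  · simp [genDegree]
  · simp [genDegree]
    ring

/-- The projection of the algebra to its component of degree `g`. -/
def degreeProj (m : Matrix V V ℕ) (g : (V → ℤ) × ℤ) : MatrixAlg m →ₗ[ℚ] MatrixAlg m :=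
  gradingProj m (fun i => ((Pi.single i 1 : V → ℤ), - (m i i : ℤ))) ((0 : V → ℤ), (-2 : ℤ)) g

omit [Quiver V] in
theorem degreeProj_of_mem {m : Matrix V V ℕ} {g : (V → ℤ) × ℤ} {y : MatrixAlg m}
    (hy : y ∈ homogeneousPart m (genDegree m) g) : degreeProj m g y = y := by
  rw [genDegree_eq] at hy
  exact gradingProj_of_mem_homogeneousPart
    (fun i => ((Pi.single i 1 : V → ℤ), - (m i i : ℤ))) ((0 : V → ℤ), (-2 : ℤ)) hy

omit [Quiver V] in
theorem degreeProj_of_mem_of_ne {m : Matrix V V ℕ} {g g' : (V → ℤ) × ℤ} (hg : g' ≠ g)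
    {y : MatrixAlg m} (hy : y ∈ homogeneousPart m (genDegree m) g') : degreeProj m g y = 0 := by
  rw [genDegree_eq] at hy
  exact gradingProj_of_mem_homogeneousPart_of_ne
    (fun i => ((Pi.single i 1 : V → ℤ), - (m i i : ℤ))) ((0 : V → ℤ), (-2 : ℤ)) hg hy

theorem map_homogeneousPart_degree (g : (V → ℤ) × ℤ) :
    (homogeneousPart (incidence (Linked a b)) (reducedDegree a b) g).map
        (linkingMap a b hm hab).toLinearMap = grDegreePart a b g := by
  apply le_antisymm
  · rw [homogeneousPart, Submodule.map_span, Submodule.span_le]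
    rintro _ ⟨_, ⟨W, hW, rfl⟩, rfl⟩
    refine Submodule.mem_iSup_of_mem W.length ⟨⟨_, hatWord_mem a b W⟩, ?_,
      (linkingMap_word hm hab W).symm⟩
    rw [← hW]
    exact hatWord_mem_homogeneousPart W hab
  · refine iSup_le fun p => ?_
    rintro _ ⟨⟨x, hx⟩, hxg, rfl⟩
    refine cls_mem_of_mem_span hm hab (𝒲 := {W | (W.map (reducedDegree a b)).sum = g}) ?_ hx ?_
    · intro W hWg hW
      exact Submodule.mem_map_of_mem (Submodule.subset_span ⟨W, hWg, rfl⟩)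
    · -- the projection to the component of degree `g` fixes `x` and maps the words that represent
      -- `x` to themselves or to zero
      have hxg' : x ∈ homogeneousPart (incidence V) (genDegree (incidence V)) g := hxg
      have key := degreeProj_of_mem hxg'
      have hF := hx
      rw [linkingFiltration_F] at hF
      rw [← key]
      clear key hxg hxg' hx
      induction hF using Submodule.span_induction with
      | mem y h =>
        obtain ⟨W, hl, rfl⟩ := h
        have hW := hatWord_mem_homogeneousPart W hab
        by_cases h : (W.map (reducedDegree a b)).sum = g
        · rw [h] at hW
          rw [degreeProj_of_mem hW]
          exact Submodule.subset_span ⟨W, h, hl, rfl⟩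
        · rw [degreeProj_of_mem_of_ne h hW]
          exact zero_mem _
      | zero => rw [map_zero]; exact zero_mem _
      | add x y _ _ hx hy => rw [map_add]; exact add_mem hx hy
      | smul c x _ hx => rw [map_smul]; exact Submodule.smul_mem _ _ hx

end LinkingMap

/-! ### Products of differences of variables of the same colour -/

section Discriminant

theorem apply_symm_eq {C T : Type*} {c : T → C} {σ : Equiv.Perm T} (hσ : ∀ t, c (σ t) = c t)
    (t : T) : c (σ.symm t) = c t := by
  rw [← hσ (σ.symm t), σ.apply_symm_apply]

theorem apply_swap_eq {C T : Type*} [DecidableEq T] {c : T → C} {s t : T} (h : c s = c t) (z : T) :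
    c (Equiv.swap s t z) = c z := by
  rw [Equiv.swap_apply_def]
  split_ifs with h1 h2
  · rw [h1, h]
  · rw [h2, h]
  · rfl


/-- A polynomial divisible by `X s - X t` and invariant under the exchange of the variables is
divisible by the square. -/
theorem X_sub_X_mul_dvd_of_swap {T : Type*} [DecidableEq T] {s t : T} (hst : s ≠ t)
    {F : MvPolynomial T ℚ}
    (hF : (X s - X t) ∣ F) (hswap : rename (Equiv.swap s t) F = F) :
    (X s - X t) * (X t - X s) ∣ F := by
  obtain ⟨G, rfl⟩ := hF
  refine mul_dvd_mul_left _ ?_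
  rw [← neg_sub (X s), neg_dvd, ← identify_eq_zero_iff]
  have h0 : (X s - X t : MvPolynomial T ℚ) ≠ 0 := sub_ne_zero.2 fun h => hst (X_injective h)
  have h1 : rename (Equiv.swap s t) G = -G := by
    apply mul_left_cancel₀ h0
    rw [map_mul, map_sub, rename_X, rename_X, Equiv.swap_apply_left,
      Equiv.swap_apply_right] at hswap
    linear_combination - hswap
  have h2 : identify s t (rename (Equiv.swap s t) G) = identify s t G := by
    rw [identify, rename_rename]
    congr 2
    ext z
    simp only [Function.comp_apply, Equiv.swap_apply_def]
    split_ifs <;> simp_all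
  rw [h1, map_neg] at h2
  exact self_eq_neg.1 h2.symm

variable {C : Type*} {T : Type*} [Fintype T]

theorem map_filter_univ_equiv {p : T → Prop} [DecidablePred p] {σ : Equiv.Perm T}
    (h : ∀ z, p (σ z) ↔ p z) :
    (Finset.univ.filter p).map σ.toEmbedding = Finset.univ.filter p := by
  ext z
  simp only [Finset.mem_map_equiv, Finset.mem_filter, Finset.mem_univ, true_and]
  rw [← h, σ.apply_symm_apply]

open scoped Classical in
/-- The ordered pairs of distinct labels of the same colour. -/
def monoPairs (c : T → C) : Finset (T × T) :=
  Finset.univ.filter fun p => p.1 ≠ p.2 ∧ c p.1 = c p.2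

theorem mem_monoPairs {c : T → C} {p : T × T} :
    p ∈ monoPairs c ↔ p.1 ≠ p.2 ∧ c p.1 = c p.2 := by
  simp [monoPairs]

/-- The product of the differences `X s - X t` over all ordered pairs of distinct labels of the
same colour. Since each pair occurs in both orders, it is invariant under the permutations of the
labels preserving the colours, without a sign. -/
def monoDiscr (c : T → C) : MvPolynomial T ℚ := ∏ p ∈ monoPairs c, (X p.1 - X p.2)

theorem rename_monoDiscr_ne_zero {T' : Type*} {c : T → C} {ρ : T → T'}
    (h : ∀ s t, c s = c t → ρ s = ρ t → s = t) : rename ρ (monoDiscr c) ≠ 0 := by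
  rw [monoDiscr, map_prod]
  refine Finset.prod_ne_zero_iff.2 fun p hp => ?_
  rw [mem_monoPairs] at hp
  rw [map_sub, rename_X, rename_X, sub_ne_zero]
  exact fun h' => hp.1 (h _ _ hp.2 (X_injective h'))

theorem monoDiscr_ne_zero (c : T → C) : monoDiscr c ≠ 0 := by
  intro h
  refine rename_monoDiscr_ne_zero (c := c) (ρ := id) (fun _ _ _ h => h) ?_
  rw [h, map_zero]

theorem rename_monoDiscr {c : T → C} {σ : Equiv.Perm T} (hσ : ∀ t, c (σ t) = c t) :
    rename σ (monoDiscr c) = monoDiscr c := by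
  have hσ' := apply_symm_eq hσ
  rw [monoDiscr, map_prod]
  refine Finset.prod_bij' (fun p _ => (σ p.1, σ p.2)) (fun p _ => (σ.symm p.1, σ.symm p.2))
    ?_ ?_ ?_ ?_ ?_
  · intro p hp
    simpa [mem_monoPairs, hσ] using hp
  · intro p hp
    simpa [mem_monoPairs, hσ'] using hp
  · simp
  · simp
  · simp

variable [DecidableEq T]

/-- A polynomial vanishing whenever two variables of the same colour are equal, and invariant
under the permutations preserving the colours, is divisible by `monoDiscr`. -/
theorem monoDiscr_dvd {c : T → C} {F : MvPolynomial T ℚ}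
    (hF : ∀ s t, s ≠ t → c s = c t → (X s - X t) ∣ F)
    (hsymm : ∀ σ : Equiv.Perm T, (∀ t, c (σ t) = c t) → rename σ F = F) : monoDiscr c ∣ F := by
  -- group the two orders of each pair to obtain pairwise coprime factors
  let e := Fintype.equivFin T
  have key : monoDiscr c = ∏ p ∈ (monoPairs c).filter (fun p => e p.1 < e p.2),
      ((X p.1 - X p.2) * (X p.2 - X p.1)) := by
    rw [monoDiscr, ← Finset.prod_filter_mul_prod_filter_not _ (fun p => e p.1 < e p.2),
      Finset.prod_mul_distrib]
    refine congrArg _ ?_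
    refine Finset.prod_bij' (fun p _ => p.swap) (fun p _ => p.swap) ?_ ?_ (by simp) (by simp)
      (by simp)
    · intro p hp
      simp only [Finset.mem_filter, mem_monoPairs, Prod.fst_swap, Prod.snd_swap] at hp ⊢
      refine ⟨⟨hp.1.1.symm, hp.1.2.symm⟩, lt_of_le_of_ne (not_lt.1 hp.2) ?_⟩
      exact fun h => hp.1.1 (e.injective h).symm
    · intro p hp
      simp only [Finset.mem_filter, mem_monoPairs, Prod.fst_swap, Prod.snd_swap] at hp ⊢
      exact ⟨⟨hp.1.1.symm, hp.1.2.symm⟩, hp.2.le.not_gt⟩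
  rw [key]
  refine Finset.prod_dvd_of_isRelPrime ?_ ?_
  · intro p hp q hq hpq
    simp only [Finset.coe_filter, Set.mem_ofPred_eq, mem_monoPairs] at hp hq
    have h1 : ¬ (q.1 = p.1 ∧ q.2 = p.2) := fun h => hpq (Prod.ext h.1.symm h.2.symm)
    have h2 : ¬ (q.1 = p.2 ∧ q.2 = p.1) := by
      rintro ⟨h, h'⟩
      have := hq.2
      rw [h, h'] at this
      exact this.asymm hp.2
    refine IsRelPrime.mul_left (IsRelPrime.mul_right ?_ ?_) (IsRelPrime.mul_right ?_ ?_)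
    · exact isRelPrime_X_sub_X hp.1.1 hq.1.1 h1 h2
    · exact isRelPrime_X_sub_X hp.1.1 hq.1.1.symm (by tauto) (by tauto)
    · exact isRelPrime_X_sub_X hp.1.1.symm hq.1.1 h2 h1
    · exact isRelPrime_X_sub_X hp.1.1.symm hq.1.1.symm (by tauto) (by tauto)
  · intro p hp
    rw [Finset.mem_filter, mem_monoPairs] at hp
    exact X_sub_X_mul_dvd_of_swap hp.1.1 (hF _ _ hp.1.1 hp.1.2) (hsymm _ (apply_swap_eq hp.1.2))

end Discriminant

/-! ### Products of differences over two sets of labels -/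

section Differences

variable {T : Type*}

/-- The product of the differences `X s - X t` for `s ∈ A` and `t ∈ B`. -/
def diffs (A B : Finset T) : MvPolynomial T ℚ := ∏ s ∈ A, ∏ t ∈ B, (X s - X t)

theorem diffs_union_right [DecidableEq T] (A : Finset T) {B B' : Finset T} (h : Disjoint B B') :
    diffs A (B ∪ B') = diffs A B * diffs A B' := by
  rw [diffs, diffs, diffs, ← Finset.prod_mul_distrib]
  exact Finset.prod_congr rfl fun s _ => Finset.prod_union h

theorem rename_diffs {T' : Type*} [DecidableEq T'] {ρ : T → T'} {A B : Finset T}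
    (hA : Set.InjOn ρ A) (hB : Set.InjOn ρ B) :
    rename ρ (diffs A B) = diffs (A.image ρ) (B.image ρ) := by
  rw [diffs, diffs, Finset.prod_image hA, map_prod]
  refine Finset.prod_congr rfl fun s _ => ?_
  rw [Finset.prod_image hB]
  simp

theorem rename_perm_diffs (σ : Equiv.Perm T) (A B : Finset T) :
    rename σ (diffs A B) = diffs (A.map σ.toEmbedding) (B.map σ.toEmbedding) := by
  simp [diffs]

theorem rename_diffs_eq_zero {T' : Type*} {ρ : T → T'} {A B : Finset T} {s t : T} (hs : s ∈ A)
    (ht : t ∈ B) (h : ρ s = ρ t) : rename ρ (diffs A B) = 0 := by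
  rw [diffs, map_prod]
  refine Finset.prod_eq_zero hs ?_
  rw [map_prod]
  refine Finset.prod_eq_zero ht ?_
  rw [map_sub, rename_X, rename_X, h, sub_self]

end Differences

/-! ### Vanishing when several pairs of variables are identified -/

section Vanishing

variable {V : Type*} (a b : V) {T : Type*} [DecidableEq T] (c : T → V)

/-- The polynomial vanishes after the identification of the variables in any `r` disjoint pairs of
labels of colours `a` and `b` in `S`. -/
def VanishesOnPairs : ℕ → Finset T → MvPolynomial T ℚ → Prop
  | 0, _, F => F = 0
  | r + 1, S, F => ∀ t ∈ S, ∀ u ∈ S, c t = a → c u = b →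
      VanishesOnPairs r (S \ {t, u}) (identify t u F)

variable {a b c}

theorem VanishesOnPairs.mono {r : ℕ} {S S' : Finset T} {F : MvPolynomial T ℚ}
    (h : VanishesOnPairs a b c r S F) (hS : S' ⊆ S) : VanishesOnPairs a b c r S' F := by
  induction r generalizing S S' F with
  | zero => exact h
  | succ r ih =>
    intro t ht u hu hta hub
    exact ih (h t (hS ht) u (hS hu) hta hub) (Finset.sdiff_subset_sdiff hS le_rfl)

theorem VanishesOnPairs.zero (r : ℕ) (S : Finset T) : VanishesOnPairs a b c r S 0 := by
  induction r generalizing S with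
  | zero => rfl
  | succ r ih =>
    intro t _ u _ _ _
    rw [map_zero]
    exact ih _

theorem VanishesOnPairs.add {r : ℕ} {S : Finset T} {F G : MvPolynomial T ℚ}
    (hF : VanishesOnPairs a b c r S F) (hG : VanishesOnPairs a b c r S G) :
    VanishesOnPairs a b c r S (F + G) := by
  induction r generalizing S F G with
  | zero =>
    rw [VanishesOnPairs] at hF hG ⊢
    rw [hF, hG, add_zero]
  | succ r ih =>
    intro t ht u hu hta hub
    rw [map_add]
    exact ih (hF t ht u hu hta hub) (hG t ht u hu hta hub)

theorem VanishesOnPairs.sum {ι : Type*} {r : ℕ} {S : Finset T} {I : Finset ι}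
    {F : ι → MvPolynomial T ℚ} (hF : ∀ i ∈ I, VanishesOnPairs a b c r S (F i)) :
    VanishesOnPairs a b c r S (∑ i ∈ I, F i) :=
  Finset.sum_induction _ _ (fun _ _ h h' => h.add h') (VanishesOnPairs.zero r S) hF

theorem VanishesOnPairs.mul_left {r : ℕ} {S : Finset T} {F : MvPolynomial T ℚ}
    (hF : VanishesOnPairs a b c r S F) (p : MvPolynomial T ℚ) :
    VanishesOnPairs a b c r S (p * F) := by
  induction r generalizing S F p with
  | zero =>
    rw [VanishesOnPairs] at hF ⊢
    rw [hF, mul_zero]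
  | succ r ih =>
    intro t ht u hu hta hub
    rw [map_mul]
    exact ih (hF t ht u hu hta hub) _

theorem VanishesOnPairs.coeffAt {r : ℕ} {S : Finset T} {F : MvPolynomial T ℚ}
    (hF : VanishesOnPairs a b c r S F) {z : T} (hz : z ∉ S) (k : ℕ) :
    VanishesOnPairs a b c r S (coeffAt z k F) := by
  induction r generalizing S F with
  | zero =>
    rw [VanishesOnPairs] at hF ⊢
    rw [hF, map_zero]
  | succ r ih =>
    intro t ht u hu hta hub
    rw [identify_coeffAt (fun h : t = z => hz (h ▸ ht)) fun h : u = z => hz (h ▸ hu)]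
    exact ih (hF t ht u hu hta hub) fun h => hz (Finset.mem_sdiff.1 h).1

/-- Successive identifications amount to one substitution, which is injective on the labels of
each colour. -/
theorem vanishesOnPairs_rename (hab : a ≠ b) {d : ℕ} {F : MvPolynomial T ℚ}
    (hF : ∀ (ρ : T → T) (M : Finset T), (∀ s t, c s = c t → ρ s = ρ t → s = t) → M.card = d →
      (∀ t ∈ M, c t = a ∧ ∃ u, c u = b ∧ ρ t = ρ u) → rename ρ F = 0)
    {r : ℕ} {S : Finset T} {ρ : T → T} {M : Finset T}
    (hinj : ∀ s t, c s = c t → ρ s = ρ t → s = t) (hS : ∀ z ∈ S, ρ z = z)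
    (hS' : ∀ z, ρ z ∈ S → ρ z = z) (hM : ∀ t ∈ M, c t = a ∧ ∃ u, c u = b ∧ ρ t = ρ u)
    (hMS : Disjoint M S) (hcard : M.card + r = d) :
    VanishesOnPairs a b c r S (rename ρ F) := by
  induction r generalizing S ρ M with
  | zero => exact hF ρ M hinj (by omega) hM
  | succ r ih =>
    intro t ht u hu hta hub
    have htu : t ≠ u := by rintro rfl; exact hab (hta.symm.trans hub)
    rw [identify, rename_rename]
    have htM : t ∉ M := fun h => Finset.disjoint_left.1 hMS h ht
    refine ih (M := insert t M) ?_ ?_ ?_ ?_ ?_ ?_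
    · intro s s' hc h
      have h1 : ∀ z, ρ z = t → z = t := fun z hz => by
        rw [← hz]; exact (hS' z (hz ▸ ht)).symm
      have h2 : ∀ z, ρ z = u → z = u := fun z hz => by
        rw [← hz]; exact (hS' z (hz ▸ hu)).symm
      simp only [Function.comp_apply] at h
      split_ifs at h with h3 h4 h4
      · exact hinj _ _ hc (h3.trans h4.symm)
      · rw [h2 _ h3, h1 _ h.symm, hub, hta] at hc
        exact absurd hc.symm hab
      · rw [h2 _ h4, h1 _ h, hub, hta] at hc
        exact absurd hc hab
      · exact hinj _ _ hc h
    · intro z hz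
      simp only [Finset.mem_sdiff, Finset.mem_insert, Finset.mem_singleton, not_or] at hz
      rw [Function.comp_apply, hS z hz.1, if_neg hz.2.2]
    · intro z hz
      simp only [Function.comp_apply] at hz ⊢
      split_ifs at hz ⊢ with h
      · simp at hz
      · exact hS' z (Finset.mem_sdiff.1 hz).1
    · intro s hs
      rcases Finset.mem_insert.1 hs with rfl | hs
      · refine ⟨hta, u, hub, ?_⟩
        simp [hS s ht, hS u hu]
      · obtain ⟨h1, v, h2, h3⟩ := hM s hs
        exact ⟨h1, v, h2, by simp only [Function.comp_apply, h3]⟩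
    · rw [Finset.disjoint_insert_left]
      exact ⟨by simp, hMS.mono_right Finset.sdiff_subset⟩
    · rw [Finset.card_insert_of_notMem htM]
      omega

theorem vanishesOnPairs_of_rename [Fintype T] (hab : a ≠ b) {d : ℕ} {F : MvPolynomial T ℚ}
    (hF : ∀ (ρ : T → T) (M : Finset T), (∀ s t, c s = c t → ρ s = ρ t → s = t) → M.card = d →
      (∀ t ∈ M, c t = a ∧ ∃ u, c u = b ∧ ρ t = ρ u) → rename ρ F = 0) :
    VanishesOnPairs a b c d Finset.univ F := by
  have := vanishesOnPairs_rename (r := d) (S := Finset.univ) (ρ := id) (M := ∅) hab hF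
    (fun _ _ _ h => h) (fun _ _ => rfl) (fun _ _ => rfl) (by simp) (by simp) (by simp)
  rwa [rename_id_apply] at this

/-- Removing a block of the new vertex uses up one pair of labels of colours `a` and `b`. -/
theorem vanishesOnPairs_blockOp_diamond [Fintype T] {m : Matrix V V ℕ} (ε : SignSystem m)
    {r : ℕ} {G : Finset T → MvPolynomial T ℚ}
    (hG : ∀ S, VanishesOnPairs a b c (r + 1) S (G S)) (k : ℕ) (S : Finset T) :
    VanishesOnPairs a b c r S (blockOp ε c (.diamond : Linked a b) k G S) := by
  rw [blockOp_apply]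
  refine VanishesOnPairs.sum fun β hβ => ?_
  rw [mem_freeBlocks] at hβ
  obtain ⟨⟨hta, hub⟩, hdisj⟩ := hβ
  have h1 : β.1 ∉ S := Finset.disjoint_left.1 hdisj (by simp)
  rw [blockCoeff_apply]
  refine VanishesOnPairs.coeffAt ?_ h1 k
  have h2 := (hG (S ∪ blockSupp β)).mul_left (cross ε c S (blockSupp β)) β.1 (by simp) β.2
    (by simp) hta hub
  exact h2.mono fun z hz => Finset.mem_sdiff.2
    ⟨Finset.mem_union_left _ hz, Finset.disjoint_right.1 hdisj hz⟩

theorem vanishesOnPairs_blockOp_old [Fintype T] {m : Matrix V V ℕ} (ε : SignSystem m)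
    {r : ℕ} {G : Finset T → MvPolynomial T ℚ}
    (hG : ∀ S, VanishesOnPairs a b c r S (G S)) (i : V) (k : ℕ) (S : Finset T) :
    VanishesOnPairs a b c r S (blockOp ε c (.old i : Linked a b) k G S) := by
  rw [blockOp_apply]
  refine VanishesOnPairs.sum fun β hβ => ?_
  rw [mem_freeBlocks] at hβ
  obtain ⟨⟨hβ, -⟩, hdisj⟩ := hβ
  have h1 : β.1 ∉ S := Finset.disjoint_left.1 hdisj (by simp)
  rw [blockCoeff_apply, ← hβ, identify_self]
  refine VanishesOnPairs.coeffAt ?_ h1 k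
  exact ((hG (S ∪ blockSupp β)).mul_left _).mono Finset.subset_union_left

/-- A word of block operators with at least `r` letters for the new vertex kills the polynomials
vanishing on `r` pairs. -/
theorem opWord_eq_zero_of_vanishesOnPairs [Fintype T] [DecidableEq V] {m : Matrix V V ℕ}
    (ε : SignSystem m) {r : ℕ} {F : MvPolynomial T ℚ}
    (hF : VanishesOnPairs a b c r Finset.univ F) (W : List (Linked a b × ℕ))
    (hW : r ≤ (W.map Prod.fst).count .diamond) (S : Finset T) :
    opWord ε c W (Pi.single Finset.univ F) S = 0 := by
  have key : ∀ (W : List (Linked a b × ℕ)) (q : ℕ) (S : Finset T),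
      q + (W.map Prod.fst).count .diamond = r →
      VanishesOnPairs a b c q S (opWord ε c W (Pi.single Finset.univ F) S) := by
    intro W
    induction W with
    | nil =>
      intro q S h
      have h' : q = r := by simpa using h
      subst h'
      change VanishesOnPairs a b c q S ((Pi.single Finset.univ F : Finset T → _) S)
      by_cases hS : S = Finset.univ
      · subst hS
        rwa [Pi.single_eq_same]
      · rw [Pi.single_eq_of_ne hS]
        exact VanishesOnPairs.zero _ _
    | cons x W ih =>
      intro q S h
      rw [opWord_cons]
      obtain ⟨i | _, k⟩ := x
      · refine vanishesOnPairs_blockOp_old ε (fun S => ih q S ?_) i k S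
        simpa using h
      · refine vanishesOnPairs_blockOp_diamond ε (fun S => ih (q + 1) S ?_) k S
        rw [List.map_cons, List.count_cons_self] at h
        omega
  -- split off the shortest final segment with `r` letters for the new vertex
  induction W generalizing S with
  | nil =>
    have h := key [] 0 S (by simpa using hW.antisymm' (Nat.zero_le _))
    exact h
  | cons x W ih =>
    by_cases h : r ≤ (W.map Prod.fst).count .diamond
    · rw [opWord_cons, blockOp_apply]
      refine Finset.sum_eq_zero fun β _ => ?_
      rw [ih h, mul_zero, map_zero]
    · refine key (x :: W) 0 S ?_
      rw [List.map_cons, List.count_cons] at hW ⊢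
      split_ifs at hW ⊢ <;> omega

end Vanishing

/-! ### Lifting symmetric polynomials to the doubled labels -/

section Lift

variable {V : Type*} [DecidableEq V] {a b : V} {T : Type*} [Fintype T] [DecidableEq T]
  (τ : T → Linked a b)

/-- The labels of colour `i` coming from an old vertex. -/
def oldLabels (i : V) : Finset (Doubled τ) :=
  Finset.univ.filter fun z => doubledColour τ z = i ∧ τ (fold τ z) ≠ .diamond

/-- The labels of colour `i` coming from the new vertex. -/
def newLabels (i : V) : Finset (Doubled τ) :=
  Finset.univ.filter fun z => doubledColour τ z = i ∧ τ (fold τ z) = .diamond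

variable {τ}

omit [DecidableEq T] in
theorem mem_oldLabels {i : V} {z : Doubled τ} :
    z ∈ oldLabels τ i ↔ doubledColour τ z = i ∧ τ (fold τ z) ≠ .diamond := by
  simp [oldLabels]

omit [DecidableEq T] in
theorem mem_newLabels {i : V} {z : Doubled τ} :
    z ∈ newLabels τ i ↔ doubledColour τ z = i ∧ τ (fold τ z) = .diamond := by
  simp [newLabels]

omit [DecidableEq T] in
theorem disjoint_oldLabels_newLabels (i j : V) : Disjoint (oldLabels τ i) (newLabels τ j) :=
  Finset.disjoint_left.2 fun _ h h' => (mem_oldLabels.1 h).2 (mem_newLabels.1 h').2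

omit [DecidableEq T] in
theorem mem_oldLabels_or_mem_newLabels {i : V} {z : Doubled τ} (h : doubledColour τ z = i) :
    z ∈ oldLabels τ i ∨ z ∈ newLabels τ i := by
  by_cases h' : τ (fold τ z) = .diamond
  · exact Or.inr (mem_newLabels.2 ⟨h, h'⟩)
  · exact Or.inl (mem_oldLabels.2 ⟨h, h'⟩)

omit [DecidableEq V] [Fintype T] [DecidableEq T] in
/-- The two copies of a label have different colours. -/
theorem fold_injective (hab : a ≠ b) {s t : Doubled τ}
    (hc : doubledColour τ s = doubledColour τ t) (h : fold τ s = fold τ t) : s = t := by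
  rcases s with s | ⟨s, hs⟩ <;> rcases t with t | ⟨t, ht⟩ <;> simp only [fold, Sum.elim_inl,
    Sum.elim_inr, id_eq] at h <;> subst h
  · rfl
  · simp only [doubledColour, Sum.elim_inl, Sum.elim_inr, ht, baseLetter] at hc
    exact absurd hc hab
  · simp only [doubledColour, Sum.elim_inl, Sum.elim_inr, hs, baseLetter] at hc
    exact absurd hc.symm hab
  · rfl

omit [DecidableEq T] in
theorem exists_mem_newLabels_b {z : Doubled τ} (hz : z ∈ newLabels τ a) :
    ∃ w ∈ newLabels τ b, fold τ w = fold τ z :=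
  ⟨.inr ⟨fold τ z, (mem_newLabels.1 hz).2⟩,
    mem_newLabels.2 ⟨rfl, (mem_newLabels.1 hz).2⟩, rfl⟩

omit [DecidableEq T] in
theorem exists_mem_newLabels_a {z : Doubled τ} (hz : z ∈ newLabels τ b) :
    ∃ w ∈ newLabels τ a, fold τ w = fold τ z := by
  have h := (mem_newLabels.1 hz).2
  exact ⟨.inl (fold τ z), mem_newLabels.2 ⟨by simp [doubledColour, h, baseLetter], h⟩, rfl⟩

theorem image_fold_newLabels :
    (newLabels τ a).image (fold τ) = (newLabels τ b).image (fold τ) := by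
  ext x
  simp only [Finset.mem_image]
  constructor
  · rintro ⟨z, hz, rfl⟩
    exact exists_mem_newLabels_b hz
  · rintro ⟨z, hz, rfl⟩
    exact exists_mem_newLabels_a hz

theorem image_fold_oldLabels (i : V) :
    (oldLabels τ i).image (fold τ) = Finset.univ.filter fun x => τ x = .old i := by
  ext x
  simp only [Finset.mem_image, Finset.mem_filter, Finset.mem_univ, true_and, mem_oldLabels]
  constructor
  · rintro ⟨z | ⟨z, hz⟩, ⟨h1, h2⟩, rfl⟩
    · simp only [fold, Sum.elim_inl, id_eq] at h2 ⊢
      simp only [doubledColour, Sum.elim_inl] at h1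
      cases h : τ z with
      | old j =>
        rw [h, baseLetter] at h1
        rw [h1]
      | diamond => exact absurd h h2
    · exact absurd hz h2
  · intro h
    refine ⟨.inl x, ⟨?_, ?_⟩, rfl⟩
    · simp [doubledColour, h, baseLetter]
    · simp [fold, h]

theorem card_newLabels (hab : a ≠ b) :
    (newLabels τ a).card = (Finset.univ.filter fun x => τ x = .diamond).card := by
  have h : (newLabels τ a).image (fold τ) = Finset.univ.filter fun x => τ x = .diamond := by
    ext x
    simp only [Finset.mem_image, Finset.mem_filter, Finset.mem_univ, true_and, mem_newLabels]
    constructor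
    · rintro ⟨z, ⟨-, h⟩, rfl⟩
      exact h
    · intro h
      exact ⟨.inl x, ⟨by simp [doubledColour, h, baseLetter], h⟩, rfl⟩
  rw [← h, Finset.card_image_of_injOn]
  intro s hs t ht hst
  exact fold_injective hab
    ((mem_newLabels.1 hs).1.trans (mem_newLabels.1 ht).1.symm) hst

variable (τ) in
/-- The pairs of labels of colour `a` or of colour `b`, the first coming from an old vertex and the
second from the new vertex. -/
def mixedPairs : Finset (Doubled τ × Doubled τ) :=
  oldLabels τ a ×ˢ newLabels τ a ∪ oldLabels τ b ×ˢ newLabels τ b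

theorem prod_mixedPairs (hab : a ≠ b) :
    ∏ p ∈ mixedPairs τ, (X p.1 - X p.2 : MvPolynomial (Doubled τ) ℚ) =
      diffs (oldLabels τ a) (newLabels τ a) * diffs (oldLabels τ b) (newLabels τ b) := by
  rw [mixedPairs, Finset.prod_union, Finset.prod_product, Finset.prod_product, diffs, diffs]
  rw [Finset.disjoint_left]
  intro p hp hp'
  rw [Finset.mem_product, mem_oldLabels] at hp hp'
  exact hab (hp.1.1.symm.trans hp'.1.1)

theorem mem_mixedPairs_iff {p : Doubled τ × Doubled τ} : p ∈ mixedPairs τ ↔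
    (p.1 ∈ oldLabels τ a ∧ p.2 ∈ newLabels τ a) ∨ (p.1 ∈ oldLabels τ b ∧ p.2 ∈ newLabels τ b) := by
  simp [mixedPairs]

theorem mixedPairs_subset : mixedPairs τ ⊆ monoPairs (doubledColour τ) := by
  intro p hp
  rw [mem_monoPairs]
  rcases mem_mixedPairs_iff.1 hp with ⟨h1, h2⟩ | ⟨h1, h2⟩
  · refine ⟨fun h => ?_, (mem_oldLabels.1 h1).1.trans (mem_newLabels.1 h2).1.symm⟩
    exact Finset.disjoint_left.1 (disjoint_oldLabels_newLabels a a) h1 (h ▸ h2)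
  · refine ⟨fun h => ?_, (mem_oldLabels.1 h1).1.trans (mem_newLabels.1 h2).1.symm⟩
    exact Finset.disjoint_left.1 (disjoint_oldLabels_newLabels b b) h1 (h ▸ h2)

variable (τ) in
/-- The complementary factor of the differences belonging to `mixedPairs` in the product of all
differences of variables of the same colour. -/
def unmixedDiscr : MvPolynomial (Doubled τ) ℚ :=
  ∏ p ∈ monoPairs (doubledColour τ) \ mixedPairs τ, (X p.1 - X p.2)

theorem unmixedDiscr_mul (hab : a ≠ b) : unmixedDiscr τ *
    (diffs (oldLabels τ a) (newLabels τ a) * diffs (oldLabels τ b) (newLabels τ b)) =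
      monoDiscr (doubledColour τ) := by
  rw [← prod_mixedPairs hab, unmixedDiscr, monoDiscr, Finset.prod_sdiff mixedPairs_subset]

theorem X_sub_X_dvd_unmixedDiscr {s t : Doubled τ} (hst : s ≠ t)
    (hc : doubledColour τ s = doubledColour τ t) : (X s - X t) ∣ unmixedDiscr τ := by
  have key : ∀ p ∈ monoPairs (doubledColour τ) \ mixedPairs τ,
      (X p.1 - X p.2) ∣ unmixedDiscr τ := fun p hp =>
    Finset.dvd_prod_of_mem (fun p : Doubled τ × Doubled τ =>
      (X p.1 - X p.2 : MvPolynomial (Doubled τ) ℚ)) hp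
  by_cases h : (s, t) ∈ mixedPairs τ
  · have h' : (t, s) ∉ mixedPairs τ := by
      intro h'
      rcases mem_mixedPairs_iff.1 h with h1 | h1 <;> rcases mem_mixedPairs_iff.1 h' with h2 | h2
      all_goals exact (mem_oldLabels.1 h1.1).2 (mem_newLabels.1 h2.2).2
    have h1 := key (t, s) (Finset.mem_sdiff.2 ⟨mem_monoPairs.2 ⟨hst.symm, hc.symm⟩, h'⟩)
    exact (neg_sub (X t : MvPolynomial (Doubled τ) ℚ) (X s)) ▸ (neg_dvd.2 h1)
  · exact key (s, t) (Finset.mem_sdiff.2 ⟨mem_monoPairs.2 ⟨hst, hc⟩, h⟩)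

variable (τ) in
/-- The numerator of the rational function to be symmetrized; the denominator is `monoDiscr`. After
cancellation of `unmixedDiscr`, the denominator consists of the differences between the labels of
the old vertices `a` and `b` and the labels of the same colour coming from the new vertex. The
numerator contains the differences of all labels of the old vertex `a` with all labels of colour
`b`, which make it vanish on too many pairs. -/
def liftTerm (g : MvPolynomial T ℚ) : MvPolynomial (Doubled τ) ℚ :=
  rename Sum.inl g * diffs (oldLabels τ a) (oldLabels τ b ∪ newLabels τ b) *
    diffs (oldLabels τ b) (newLabels τ a) * unmixedDiscr τ

/-- A term in the symmetrization survives the identification of the two copies of the labels only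
if the permutation preserves the origin of the labels of colours `a` and `b`. -/
theorem map_oldLabels_of_rename_ne_zero {g : MvPolynomial T ℚ} {σ : Equiv.Perm (Doubled τ)}
    (hσ : ∀ t, doubledColour τ (σ t) = doubledColour τ t)
    (h : rename (fold τ) (rename σ (liftTerm τ g)) ≠ 0) (z : Doubled τ) :
    τ (fold τ (σ z)) = .diamond ↔ τ (fold τ z) = .diamond := by
  simp only [liftTerm, map_mul, rename_rename] at h
  have hσ' := apply_symm_eq hσ
  -- a finite set that is mapped to itself by a permutation contains the preimages of its elements
  have hmem : ∀ i, (∀ s ∈ oldLabels τ i, σ s ∈ oldLabels τ i) →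
      ∀ s, σ s ∈ oldLabels τ i → s ∈ oldLabels τ i := by
    intro i hi s hs
    have h1 : (oldLabels τ i).map σ.toEmbedding = oldLabels τ i := by
      refine Finset.eq_of_subset_of_card_le ?_ (by simp)
      intro z hz
      obtain ⟨w, hw, rfl⟩ := Finset.mem_map.1 hz
      exact hi w hw
    rw [← h1, Finset.mem_map] at hs
    obtain ⟨w, hw, hws⟩ := hs
    exact σ.injective hws ▸ hw
  have ha : ∀ s ∈ oldLabels τ a, σ s ∈ oldLabels τ a := by
    intro s hs
    refine (mem_oldLabels_or_mem_newLabels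
      ((hσ s).trans (mem_oldLabels.1 hs).1)).resolve_right fun hs' => h ?_
    obtain ⟨w, hw, hws⟩ := exists_mem_newLabels_b hs'
    rw [rename_diffs_eq_zero (t := σ.symm w) hs]
    · simp
    · rw [Finset.mem_union]
      exact mem_oldLabels_or_mem_newLabels ((hσ' w).trans (mem_newLabels.1 hw).1)
    · simp [hws]
  have hb : ∀ s ∈ oldLabels τ b, σ s ∈ oldLabels τ b := by
    intro s hs
    refine (mem_oldLabels_or_mem_newLabels
      ((hσ s).trans (mem_oldLabels.1 hs).1)).resolve_right fun hs' => h ?_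
    obtain ⟨w, hw, hws⟩ := exists_mem_newLabels_a hs'
    rw [rename_diffs_eq_zero (t := σ.symm w) (A := oldLabels τ b) hs]
    · simp
    · refine (mem_oldLabels_or_mem_newLabels
        ((hσ' w).trans (mem_newLabels.1 hw).1)).resolve_left fun hw' => ?_
      have := ha _ hw'
      rw [σ.apply_symm_apply] at this
      exact Finset.disjoint_left.1 (disjoint_oldLabels_newLabels a a) this hw
    · simp [hws]
  -- labels of the other colours come from old vertices
  have hother : ∀ z, τ (fold τ z) = .diamond → doubledColour τ z = a ∨ doubledColour τ z = b := by
    rintro (z | z) hz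
    · left
      simp only [fold, Sum.elim_inl, id_eq] at hz
      simp [doubledColour, hz, baseLetter]
    · exact Or.inr rfl
  rw [← not_iff_not]
  by_cases hza : doubledColour τ z = a
  · have h1 : σ z ∈ oldLabels τ a ↔ z ∈ oldLabels τ a := ⟨hmem a ha z, ha z⟩
    simpa [mem_oldLabels, hσ, hza] using h1
  · by_cases hzb : doubledColour τ z = b
    · have h1 : σ z ∈ oldLabels τ b ↔ z ∈ oldLabels τ b := ⟨hmem b hb z, hb z⟩
      simpa [mem_oldLabels, hσ, hzb] using h1
    · have h1 : τ (fold τ (σ z)) ≠ .diamond := fun h' => by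
        have := hother _ h'
        rw [hσ] at this
        exact this.elim hza hzb
      have h2 : τ (fold τ z) ≠ .diamond := fun h' => (hother _ h').elim hza hzb
      exact iff_of_true h1 h2

omit [DecidableEq V] [DecidableEq T] in
/-- A permutation of the doubled labels that preserves their origin induces one of the labels of the
linked quiver. -/
theorem rename_rename_inl {g : MvPolynomial T ℚ} (hab : a ≠ b)
    (hg : ∀ σ : Equiv.Perm T, (∀ t, τ (σ t) = τ t) → rename σ g = g)
    {σ : Equiv.Perm (Doubled τ)} (hσ : ∀ t, doubledColour τ (σ t) = doubledColour τ t)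
    (h : ∀ z, τ (fold τ (σ z)) = .diamond ↔ τ (fold τ z) = .diamond) :
    rename σ (rename Sum.inl g : MvPolynomial (Doubled τ) ℚ) = rename Sum.inl g := by
  have h1 : ∀ x : T, σ (.inl x) = .inl (fold τ (σ (.inl x))) := by
    intro x
    have hx := h (.inl x)
    have hc := hσ (.inl x)
    rcases hz : σ (.inl x) with y | ⟨y, hy⟩
    · rfl
    · rw [hz] at hx hc
      have h2 : τ x = .diamond := hx.1 hy
      simp only [doubledColour, Sum.elim_inl, Sum.elim_inr, h2, baseLetter] at hc
      exact absurd hc.symm hab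
  have hinj : Function.Injective fun x : T => fold τ (σ (.inl x)) := by
    intro x y hxy
    have : σ (.inl x) = σ (.inl y) := by
      rw [h1 x, h1 y]
      exact congrArg Sum.inl hxy
    exact Sum.inl_injective (σ.injective this)
  let π : Equiv.Perm T := Equiv.ofBijective _ (Finite.injective_iff_bijective.1 hinj)
  have hπ : ∀ x, τ (π x) = τ x := by
    intro x
    have hx := h (.inl x)
    have hc := hσ (.inl x)
    rw [h1 x] at hx hc
    change τ (π x) = .diamond ↔ τ x = .diamond at hx
    change baseLetter (τ (π x)) = baseLetter (τ x) at hc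
    cases h2 : τ x with
    | old i =>
      cases h3 : τ (π x) with
      | old j =>
        rw [h2, h3] at hc
        exact congrArg _ hc
      | diamond => exact absurd (h2.symm.trans (hx.1 h3)) (by simp)
    | diamond => exact hx.2 h2
  conv_rhs => rw [← hg π hπ]
  rw [rename_rename, rename_rename]
  congr 2
  funext x
  exact h1 x

theorem rename_liftTerm {g : MvPolynomial T ℚ} (hab : a ≠ b)
    (hg : ∀ σ : Equiv.Perm T, (∀ t, τ (σ t) = τ t) → rename σ g = g)
    {σ : Equiv.Perm (Doubled τ)} (hσ : ∀ t, doubledColour τ (σ t) = doubledColour τ t)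
    (h : ∀ z, τ (fold τ (σ z)) = .diamond ↔ τ (fold τ z) = .diamond) :
    rename σ (liftTerm τ g) = liftTerm τ g := by
  have hold : ∀ i, (oldLabels τ i).map σ.toEmbedding = oldLabels τ i := fun i =>
    map_filter_univ_equiv fun z => by rw [hσ, ne_eq, ne_eq, h]
  have hnew : ∀ i, (newLabels τ i).map σ.toEmbedding = newLabels τ i := fun i =>
    map_filter_univ_equiv fun z => by rw [hσ, h]
  have hdiscr : rename σ (unmixedDiscr τ) = unmixedDiscr τ := by
    have h1 := unmixedDiscr_mul (τ := τ) hab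
    have h2 := congrArg (rename σ) h1
    rw [rename_monoDiscr hσ, ← h1, map_mul, map_mul, rename_perm_diffs, rename_perm_diffs,
      hold, hold, hnew, hnew] at h2
    refine mul_right_cancel₀ (fun h0 => ?_) h2
    rw [h0, mul_zero] at h1
    exact monoDiscr_ne_zero _ h1.symm
  rw [liftTerm, map_mul, map_mul, map_mul, rename_rename_inl hab hg hσ h, rename_perm_diffs,
    rename_perm_diffs, Finset.map_union, hold, hold, hnew, hnew, hdiscr]

omit [DecidableEq V] [Fintype T] in
theorem rename_fold_diffs (hab : a ≠ b) {A B : Finset (Doubled τ)} {i j : V}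
    (hA : ∀ z ∈ A, doubledColour τ z = i) (hB : ∀ z ∈ B, doubledColour τ z = j) :
    rename (fold τ) (diffs A B) = diffs (A.image (fold τ)) (B.image (fold τ)) :=
  rename_diffs (fun s hs t ht => fold_injective hab ((hA s hs).trans (hA t ht).symm))
    (fun s hs t ht => fold_injective hab ((hB s hs).trans (hB t ht).symm))

/-- The differences with the two copies of a label of the new vertex become equal, so the
denominator of the rational function cancels. -/
theorem rename_fold_liftTerm (hab : a ≠ b) (g : MvPolynomial T ℚ) :
    rename (fold τ) (liftTerm τ g) = rename (fold τ) (monoDiscr (doubledColour τ)) *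
      (diffs (Finset.univ.filter fun x => τ x = .old a)
        (Finset.univ.filter fun x => τ x = .old b) * g) := by
  have hold : ∀ i, ∀ z ∈ oldLabels τ i, doubledColour τ z = i := fun i z hz =>
    (mem_oldLabels.1 hz).1
  have hnew : ∀ i, ∀ z ∈ newLabels τ i, doubledColour τ z = i := fun i z hz =>
    (mem_newLabels.1 hz).1
  rw [← unmixedDiscr_mul hab, liftTerm, diffs_union_right _ (disjoint_oldLabels_newLabels b b)]
  simp only [map_mul]
  rw [rename_fold_diffs hab (hold a) (hold b), rename_fold_diffs hab (hold a) (hnew b),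
    rename_fold_diffs hab (hold b) (hnew a), rename_fold_diffs hab (hold a) (hnew a),
    rename_fold_diffs hab (hold b) (hnew b), image_fold_newLabels, image_fold_oldLabels,
    image_fold_oldLabels, rename_rename]
  have : fold τ ∘ Sum.inl = id := rfl
  rw [this, rename_id_apply]
  ring

variable (τ) in
open scoped Classical in
/-- The permutations of the doubled labels preserving the colours. -/
def colourPerms : Finset (Equiv.Perm (Doubled τ)) :=
  Finset.univ.filter fun σ => ∀ t, doubledColour τ (σ t) = doubledColour τ t

theorem mem_colourPerms {σ : Equiv.Perm (Doubled τ)} :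
    σ ∈ colourPerms τ ↔ ∀ t, doubledColour τ (σ t) = doubledColour τ t := by
  simp [colourPerms]

/-- Every symmetric polynomial in the labels of the linked quiver, multiplied by the differences
of the variables of the linked vertices, is obtained by identifying the two copies of each label
from a symmetric polynomial in the doubled labels that vanishes when more pairs of labels of
colours `a` and `b` are identified than there are labels of the new vertex. -/
theorem exists_lift (hab : a ≠ b) {g : MvPolynomial T ℚ}
    (hg : ∀ σ : Equiv.Perm T, (∀ t, τ (σ t) = τ t) → rename σ g = g) :
    ∃ f : MvPolynomial (Doubled τ) ℚ,
      (∀ σ : Equiv.Perm (Doubled τ), (∀ t, doubledColour τ (σ t) = doubledColour τ t) →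
        rename σ f = f) ∧
      VanishesOnPairs a b (doubledColour τ)
        ((Finset.univ.filter fun x => τ x = .diamond).card + 1) Finset.univ f ∧
      ∃ N : ℚ, N ≠ 0 ∧ rename (fold τ) f =
        N • (diffs (Finset.univ.filter fun x => τ x = .old a)
          (Finset.univ.filter fun x => τ x = .old b) * g) := by
  classical
  set c := doubledColour τ with hc
  -- the numerator of the symmetrization over the common denominator `monoDiscr c`
  set A : MvPolynomial (Doubled τ) ℚ := ∑ σ ∈ colourPerms τ, rename σ (liftTerm τ g) with hA
  have hAsymm : ∀ σ : Equiv.Perm (Doubled τ), (∀ t, c (σ t) = c t) → rename σ A = A := by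
    intro π hπ
    have hπ' := apply_symm_eq hπ
    rw [hA, map_sum]
    refine Finset.sum_bij' (fun σ _ => σ.trans π) (fun σ _ => σ.trans π.symm) ?_ ?_ ?_ ?_ ?_
    · intro σ hσ
      rw [mem_colourPerms] at hσ ⊢
      exact fun t => (hπ _).trans (hσ t)
    · intro σ hσ
      rw [mem_colourPerms] at hσ ⊢
      exact fun t => (hπ' _).trans (hσ t)
    · intro σ _
      ext1 t
      simp
    · intro σ _
      ext1 t
      simp
    · intro σ _
      rw [rename_rename]
      rfl
  have hAdvd : monoDiscr c ∣ A := by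
    refine monoDiscr_dvd ?_ hAsymm
    intro s t hst hst'
    refine Finset.dvd_sum fun σ hσ => ?_
    rw [mem_colourPerms] at hσ
    have hσ' := apply_symm_eq hσ
    have h1 : (X (σ.symm s) - X (σ.symm t)) ∣ liftTerm τ g :=
      Dvd.dvd.mul_left (X_sub_X_dvd_unmixedDiscr (fun h => hst (σ.symm.injective h))
        ((hσ' s).trans (hst'.trans (hσ' t).symm))) _
    have h2 := map_dvd (rename σ) h1
    simpa using h2
  obtain ⟨f, hf⟩ := hAdvd
  refine ⟨f, ?_, ?_, ?_⟩
  · intro σ hσ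
    have h1 := hAsymm σ hσ
    rw [hf, map_mul, rename_monoDiscr hσ] at h1
    exact mul_left_cancel₀ (monoDiscr_ne_zero _) h1
  · refine vanishesOnPairs_of_rename hab ?_
    intro ρ M hρ hMcard hM
    have h0 : rename ρ (monoDiscr c) ≠ 0 := rename_monoDiscr_ne_zero hρ
    refine (mul_eq_zero.1 ?_).resolve_left h0
    rw [← map_mul, ← hf, hA, map_sum]
    refine Finset.sum_eq_zero fun σ hσ => ?_
    rw [mem_colourPerms] at hσ
    have hσ' := apply_symm_eq hσ
    -- some label of colour `a` in `M` is the image of a label coming from the vertex `a`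
    obtain ⟨t, htM, ht⟩ : ∃ t ∈ M, t ∉ (newLabels τ a).map σ.toEmbedding := by
      apply Finset.exists_mem_notMem_of_card_lt_card
      rw [Finset.card_map, card_newLabels hab, hMcard]
      exact Nat.lt_succ_self _
    obtain ⟨hta, u, hub, htu⟩ := hM t htM
    rw [Finset.mem_map_equiv] at ht
    have ht' := (mem_oldLabels_or_mem_newLabels ((hσ' t).trans hta)).resolve_right ht
    have hu' := Finset.mem_union.2 (mem_oldLabels_or_mem_newLabels ((hσ' u).trans hub))
    rw [rename_rename, liftTerm, map_mul, map_mul, map_mul,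
      rename_diffs_eq_zero ht' hu' (by simpa using htu)]
    simp
  · -- only the terms of the permutations in `P` survive, and all of them are equal
    have h0 : rename (fold τ) (monoDiscr c) ≠ 0 :=
      rename_monoDiscr_ne_zero fun s t h => fold_injective hab h
    set P := (colourPerms τ).filter fun σ =>
      ∀ z, τ (fold τ (σ z)) = .diamond ↔ τ (fold τ z) = .diamond with hP
    refine ⟨P.card, ?_, ?_⟩
    · rw [Nat.cast_ne_zero]
      refine Finset.card_ne_zero_of_mem (a := 1) ?_
      rw [hP, Finset.mem_filter, mem_colourPerms]
      exact ⟨fun _ => rfl, fun _ => Iff.rfl⟩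
    · apply mul_left_cancel₀ h0
      rw [← map_mul, ← hf, hA, map_sum, mul_smul_comm, ← rename_fold_liftTerm hab,
        Nat.cast_smul_eq_nsmul, ← Finset.sum_const, hP, Finset.sum_filter]
      refine Finset.sum_congr rfl fun σ hσ => ?_
      rw [mem_colourPerms] at hσ
      split_ifs with h
      · rw [rename_liftTerm hab hg hσ h]
      · by_contra h'
        exact h (map_oldLabels_of_rename_ne_zero hσ h')

end Lift

/-! ### Exchange factors of the linked quiver -/

section LinkedFactor

variable {V : Type*} [DecidableEq V] {m : Matrix V V ℕ} (ε : SignSystem m) {a b : V}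

/-- The linked quiver has one more arrow between `a` and `b` than the merged matrix counts. -/
theorem linkedMatrix_eq (hm : m.IsSymm) (hab : a ≠ b) (x y : Linked a b) :
    linkedMatrix m a b x y = mergedMatrix m x y +
      if (x = .old a ∧ y = .old b) ∨ (x = .old b ∧ y = .old a) then 1 else 0 := by
  cases x with
  | old i =>
    cases y with
    | old j =>
      simp only [linkedMatrix, mergedMatrix_old, Linked.old.injEq]
      split_ifs <;> rfl
    | diamond => simp [linkedMatrix, mergedMatrix, letters, Finset.sum_pair hab]
  | diamond =>
    cases y with
    | old j =>
      simp [linkedMatrix, mergedMatrix, letters, Finset.sum_pair hab, hm.apply a j, hm.apply b j]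
    | diamond =>
      have := hm.apply a b
      simp [linkedMatrix, mergedMatrix, letters, Finset.sum_pair hab]
      omega

theorem linkedMatrix_self (hm : m.IsSymm) (hab : a ≠ b) (x : Linked a b) :
    linkedMatrix m a b x x = mergedMatrix m x x := by
  rw [linkedMatrix_eq hm hab, if_neg, add_zero]
  rintro (⟨rfl, h⟩ | ⟨rfl, h⟩)
  · exact hab (Linked.old.inj h)
  · exact hab (Linked.old.inj h).symm

variable (a b) in
/-- The sign system of the matrix of the linked quiver. The sign is chosen such that its exchange
factors are those of the merged matrix multiplied by the difference of the variables belonging to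
`a` and to `b`, in this order. -/
def linkedSystem (hm : m.IsSymm) (hab : a ≠ b) : SignSystem (linkedMatrix m a b) where
  val x y := mergedSign ε x y * if x = .old b ∧ y = .old a then -1 else 1
  ne_zero x y := by
    refine mul_ne_zero ((mergedSystem ε a b hm hab).ne_zero x y) ?_
    split_ifs <;> norm_num
  swap x y := by
    have h := (mergedSystem ε a b hm hab).swap x y
    change mergedSign ε x y = _ * mergedSign ε y x at h
    rw [linkedMatrix_self hm hab, linkedMatrix_self hm hab, linkedMatrix_eq hm hab, h]
    have hne : (Linked.old a : Linked a b) ≠ .old b := fun h => hab (Linked.old.inj h)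
    by_cases h1 : x = .old a ∧ y = .old b
    · obtain ⟨rfl, rfl⟩ := h1
      simp [hab]
      ring
    · by_cases h2 : x = .old b ∧ y = .old a
      · obtain ⟨rfl, rfl⟩ := h2
        simp [hab]
        ring
      · have h3 : ¬ (y = .old b ∧ x = .old a) := fun h => h1 h.symm
        rw [if_neg h2, if_neg h3, if_neg (by tauto), add_zero]
        ring

variable {T : Type*} [DecidableEq T] {τ : T → Linked a b}

/-- The product of the differences of the variables belonging to `a` and to `b`. -/
def linkDiffs (τ : T → Linked a b) (S : Finset T) : MvPolynomial T ℚ :=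
  diffs (S.filter fun x => τ x = .old a) (S.filter fun x => τ x = .old b)

omit [DecidableEq T] in
theorem factor_linkedSystem (hm : m.IsSymm) (hab : a ≠ b) (s t : T) :
    factor (linkedSystem ε a b hm hab) τ s t = factor (mergedSystem ε a b hm hab) τ s t *
      ((if τ s = .old a ∧ τ t = .old b then X s - X t else 1) *
        if τ s = .old b ∧ τ t = .old a then X t - X s else 1) := by
  rw [factor, factor, linkedMatrix_eq hm hab]
  change C (mergedSign ε _ _ * _) * _ = C (mergedSign ε _ _) * _ * _
  by_cases h1 : τ s = .old a ∧ τ t = .old b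
  · have h2 : ¬ (τ s = .old b ∧ τ t = .old a) := fun h =>
      hab (Linked.old.inj (h1.1.symm.trans h.1))
    rw [if_neg h2, if_pos (Or.inl h1), if_pos h1, if_neg h2, pow_succ, mul_one, mul_one]
    exact (mul_assoc _ _ _).symm
  · by_cases h2 : τ s = .old b ∧ τ t = .old a
    · rw [if_pos h2, if_pos (Or.inr h2), if_neg h1, if_pos h2, pow_succ, one_mul, map_mul,
        map_neg, map_one]
      ring
    · rw [if_neg h2, if_neg (by tauto), if_neg h1, if_neg h2, add_zero, mul_one, mul_one, mul_one]

omit [DecidableEq V] in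
theorem linkDiffs_insert (hab : a ≠ b) {S : Finset T} {t : T} (ht : t ∉ S) :
    linkDiffs τ (insert t S) = linkDiffs τ S *
      ∏ s ∈ S, ((if τ s = .old a ∧ τ t = .old b then X s - X t else 1) *
        if τ s = .old b ∧ τ t = .old a then X t - X s else 1) := by
  rw [Finset.prod_mul_distrib, linkDiffs, linkDiffs, Finset.filter_insert, Finset.filter_insert]
  have hmem : ∀ x, t ∉ S.filter fun z => τ z = x := fun x h => ht (Finset.mem_filter.1 h).1
  by_cases h1 : τ t = .old a
  · have h2 : τ t ≠ .old b := fun h => hab (Linked.old.inj (h1.symm.trans h))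
    have h3 : ∏ s ∈ S, (if τ s = .old a ∧ τ t = .old b then X s - X t else
        (1 : MvPolynomial T ℚ)) = 1 := Finset.prod_eq_one fun s _ => if_neg fun h => h2 h.2
    have h4 : ∏ s ∈ S, (if τ s = .old b ∧ τ t = .old a then X t - X s else
        (1 : MvPolynomial T ℚ)) = ∏ s ∈ S with τ s = .old b, (X t - X s) := by
      rw [Finset.prod_filter]
      exact Finset.prod_congr rfl fun s _ => by simp only [h1, and_true]
    rw [if_pos h1, if_neg h2, h3, h4, one_mul, diffs, Finset.prod_insert (hmem _), mul_comm, diffs]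
  · have h4 : ∏ s ∈ S, (if τ s = .old b ∧ τ t = .old a then X t - X s else
        (1 : MvPolynomial T ℚ)) = 1 := Finset.prod_eq_one fun s _ => if_neg fun h => h1 h.2
    rw [if_neg h1, h4, mul_one]
    by_cases h2 : τ t = .old b
    · have h3 : ∏ s ∈ S, (if τ s = .old a ∧ τ t = .old b then X s - X t else
          (1 : MvPolynomial T ℚ)) = ∏ s ∈ S with τ s = .old a, (X s - X t) := by
        rw [Finset.prod_filter]
        exact Finset.prod_congr rfl fun s _ => by simp only [h2, and_true]
      rw [if_pos h2, h3, diffs, diffs, ← Finset.prod_mul_distrib]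
      refine Finset.prod_congr rfl fun s _ => ?_
      rw [Finset.prod_insert (hmem _), mul_comm]
    · have h3 : ∏ s ∈ S, (if τ s = .old a ∧ τ t = .old b then X s - X t else
          (1 : MvPolynomial T ℚ)) = 1 := Finset.prod_eq_one fun s _ => if_neg fun h => h2 h.2
      rw [if_neg h2, h3, mul_one]

/-- The additional arrow between `a` and `b` multiplies the exchange factors by the differences of
the variables belonging to `a` and to `b`, whatever the order of the labels in the list. -/
theorem listFactor_linkedSystem (hm : m.IsSymm) (hab : a ≠ b) {S : Finset T} {L : List T}
    (hL : L.Nodup) (hS : ∀ t ∈ L, t ∉ S) :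
    listFactor (linkedSystem ε a b hm hab) τ S L * linkDiffs τ S =
      listFactor (mergedSystem ε a b hm hab) τ S L * linkDiffs τ (S ∪ L.toFinset) := by
  induction L generalizing S with
  | nil => simp [listFactor]
  | cons t L ih =>
    have htS : t ∉ S := hS t (by simp)
    have h1 : ∀ u ∈ L, u ∉ insert t S := by
      intro u hu hu'
      rcases Finset.mem_insert.1 hu' with rfl | h
      · exact (List.nodup_cons.1 hL).1 hu
      · exact hS u (List.mem_cons_of_mem _ hu) h
    have h2 := ih (List.nodup_cons.1 hL).2 h1
    rw [linkDiffs_insert hab htS] at h2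
    rw [listFactor_cons, listFactor_cons, List.toFinset_cons, Finset.union_insert,
      ← Finset.insert_union, mul_assoc (cross (mergedSystem ε a b hm hab) τ S {t}), ← h2]
    have h3 : cross (linkedSystem ε a b hm hab) τ S {t} =
        cross (mergedSystem ε a b hm hab) τ S {t} *
      ∏ s ∈ S, ((if τ s = .old a ∧ τ t = .old b then X s - X t else 1) *
        if τ s = .old b ∧ τ t = .old a then X t - X s else 1) := by
      simp only [cross, Finset.prod_singleton]
      rw [← Finset.prod_mul_distrib]
      exact Finset.prod_congr rfl fun s _ => factor_linkedSystem ε hm hab s t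
    rw [h3]
    ring

end LinkedFactor

/-! ### Counting the letters of a word -/

section Counting

variable {V : Type*} [DecidableEq V] {a b : V}

/-- The multiset of the vertices merged in the vertices of a multiset. -/
def totalContent (M : Multiset (Linked a b)) : Multiset V := (M.map content).sum

theorem totalContent_cons (x : Linked a b) (M : Multiset (Linked a b)) :
    totalContent (x ::ₘ M) = content x + totalContent M := by
  simp [totalContent]

theorem totalContent_coe_map_fst (W : List (Linked a b × ℕ)) :
    totalContent ((W.map Prod.fst : List (Linked a b)) : Multiset (Linked a b)) =
      (W.map fun x => content x.1).sum := by
  rw [totalContent, Multiset.map_coe, Multiset.sum_coe, List.map_map]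
  rfl

theorem card_totalContent (hab : a ≠ b) (M : Multiset (Linked a b)) :
    (totalContent M).card = M.card + M.count .diamond := by
  induction M using Multiset.induction_on with
  | empty => simp [totalContent]
  | cons x M ih =>
    rw [totalContent_cons, Multiset.card_add, ih, Multiset.card_cons]
    cases x with
    | old i =>
      rw [Multiset.count_cons_of_ne (by simp)]
      simp [content, letters]
      ring
    | diamond =>
      rw [Multiset.count_cons_self]
      simp [content, letters, Finset.sum_pair hab]
      ring

theorem count_totalContent (hab : a ≠ b) (M : Multiset (Linked a b)) (i : V) :
    (totalContent M).count i =
      M.count (.old i) + if i = a ∨ i = b then M.count .diamond else 0 := by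
  induction M using Multiset.induction_on with
  | empty => simp [totalContent]
  | cons x M ih =>
    rw [totalContent_cons, Multiset.count_add, ih]
    cases x with
    | old j =>
      rw [Multiset.count_cons_of_ne (show (Linked.diamond : Linked a b) ≠ .old j by simp)]
      simp only [content, letters, Finset.sum_singleton, Multiset.count_cons,
        Multiset.count_singleton, Linked.old.injEq]
      ring
    | diamond =>
      rw [Multiset.count_cons_self, Multiset.count_cons_of_ne (by simp)]
      simp only [content, letters, Finset.sum_pair hab, Multiset.count_add,
        Multiset.count_singleton]
      by_cases h1 : i = a
      · subst h1
        simp [hab]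
        ring
      · by_cases h2 : i = b
        · subst h2
          simp [h1]
          ring
        · simp [h1, h2]

/-- The vertices of a word are determined by the merged vertices and the number of occurrences of
the new vertex. -/
theorem eq_of_totalContent_eq (hab : a ≠ b) {M M' : Multiset (Linked a b)}
    (h : totalContent M = totalContent M') (hd : M.count .diamond = M'.count .diamond) :
    M = M' := by
  ext x
  cases x with
  | old i =>
    have := congrArg (Multiset.count i) h
    rw [count_totalContent hab, count_totalContent hab, hd] at this
    exact Nat.add_right_cancel this
  | diamond => exact hd

theorem sum_doubledColour (hab : a ≠ b) {T : Type*} [Fintype T] [DecidableEq T]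
    (τ : T → Linked a b) :
    ∑ z, ({doubledColour τ z} : Multiset V) = totalContent (Finset.univ.val.map τ) := by
  have h1 : ∀ x : Linked a b, content x = {baseLetter x} + if x = .diamond then {b} else 0 := by
    intro x
    cases x with
    | old i => simp [content, letters, baseLetter]
    | diamond => simp [content, letters, baseLetter, Finset.sum_pair hab]
  have h2 : totalContent (Finset.univ.val.map τ) = ∑ x, content (τ x) := by
    rw [totalContent, Multiset.map_map]
    rfl
  have h3 : ∑ x with τ x = .diamond, ({b} : Multiset V) =
      ∑ _x : {x // τ x = .diamond}, ({b} : Multiset V) :=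
    Finset.sum_subtype (p := fun x => τ x = .diamond) _ (by simp) _
  rw [h2, Fintype.sum_sum_type]
  simp only [h1]
  rw [Finset.sum_add_distrib, ← Finset.sum_filter, h3]
  rfl

theorem count_univ_map {X T : Type*} [Fintype T] [DecidableEq X] (τ : T → X) (x : X) :
    (Finset.univ.val.map τ).count x = (Finset.univ.filter fun t => τ t = x).card := by
  rw [Multiset.count_map]
  simp only [eq_comm]
  rfl

end Counting

/-! ### Injectivity -/

section Injective

variable {V : Type*} [DecidableEq V] {m : Matrix V V ℕ} {a b : V}

theorem evalFunctional_hatWord (ε : SignSystem m) {T : Type*} [Fintype T] [DecidableEq T]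
    (τ : T → V) (hm : m.IsSymm) (hab : a ≠ b) (f : MvPolynomial T ℚ)
    (W : List (Linked a b × ℕ)) :
    evalFunctional ε τ hm hab f (W.map (hatGen m a b)).prod =
      (W.map fun x => hatScalar ε x.1).prod *
        constantCoeff (opWord ε τ W (Pi.single Finset.univ f) ∅) := by
  rw [evalFunctional_apply, labelAction_hatWord, LinearMap.smul_apply, Pi.smul_apply,
    constantCoeff_smul, smul_eq_mul]

/-- Every nonzero element of the algebra of the linked quiver is detected by a functional on the
original algebra that kills the words shorter than the words on which it is considered. -/
theorem exists_detecting_functional (hm : m.IsSymm) (hab : a ≠ b)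
    {m' : Matrix (Linked a b) (Linked a b) ℕ} (hm' : m' = linkedMatrix m a b)
    {y : MatrixAlg m'} (hy : y ≠ 0) :
    ∃ (p : ℕ) (ψ : MatrixAlg m →ₗ[ℚ] ℚ),
      (∀ W : List (Linked a b × ℕ), W.length < p → ψ (W.map (hatGen m a b)).prod = 0) ∧
      ∀ θ : MatrixAlg m' →ₗ[ℚ] ℚ, (∀ W : List (Linked a b × ℕ), θ (W.map (gen m')).prod =
        if W.length = p then ψ (W.map (hatGen m a b)).prod else 0) → θ y ≠ 0 := by
  subst hm'
  obtain ⟨ε⟩ := exists_signSystem hm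
  have hmL := linkedMatrix_isSymm hm a b
  obtain ⟨n, τ, φ, g, hφy, hφ, hg, hgφ⟩ :=
    exists_symmetric_dual (linkedSystem ε a b hm hab) hmL hy
  have hL := List.nodup_finRange n
  have hL' : ∀ t, t ∈ List.finRange n := List.mem_finRange
  obtain ⟨f, hf, hvan, N, hN, hfold⟩ := exists_lift hab hg
  obtain ⟨N', hN', hNκ⟩ := exists_constantCoeff_opWord_eq ε hm hab hf hL hL'
  -- a word with at most `n` letters on which the functional does not vanish contains each vertex
  -- as often as it occurs as a colour of the labels
  have hψ : ∀ W : List (Linked a b × ℕ), W.length ≤ n →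
      ((W.map Prod.fst : List (Linked a b)) : Multiset (Linked a b)) ≠ Finset.univ.val.map τ →
      evalFunctional ε (doubledColour τ) hm hab f (W.map (hatGen m a b)).prod = 0 := by
    intro W hW hne
    rw [evalFunctional_hatWord]
    by_cases h1 : totalContent ((W.map Prod.fst : List (Linked a b)) : Multiset (Linked a b)) =
        totalContent (Finset.univ.val.map τ)
    · have h2 := congrArg Multiset.card h1
      rw [card_totalContent hab, card_totalContent hab] at h2
      have h3 : (Finset.univ.val.map τ).card = n := by simp
      have h4 : ((W.map Prod.fst : List (Linked a b)) : Multiset (Linked a b)).card =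
        W.length := by simp
      have h5 : (Finset.univ.val.map τ).count .diamond ≠
          ((W.map Prod.fst : List (Linked a b)) : Multiset (Linked a b)).count .diamond :=
        fun h => hne (eq_of_totalContent_eq hab h1 h.symm)
      rw [opWord_eq_zero_of_vanishesOnPairs ε hvan, map_zero, mul_zero]
      rw [← count_univ_map τ, ← Multiset.coe_count]
      omega
    · rw [opWord_single_eq_zero ε _ hab, map_zero, mul_zero]
      rw [Finset.sum_empty, zero_add, sum_doubledColour hab, ← totalContent_coe_map_fst]
      exact h1
  refine ⟨n, evalFunctional ε (doubledColour τ) hm hab f, ?_, ?_⟩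
  · intro W hW
    refine hψ W hW.le fun h => ?_
    have := congrArg Multiset.card h
    simp at this
    omega
  · intro θ hθ
    have key : θ = ((((List.finRange n).map fun t => hatScalar ε (τ t)).prod * N') * N) • φ := by
      refine functional_ext_of_labelWord hmL (τ := τ) hL hL' ?_ ?_ ?_
      · intro κ
        have h1 := listFactor_linkedSystem ε (τ := τ) hm hab (S := ∅) hL (by simp)
        have h2 : (∅ ∪ (List.finRange n).toFinset : Finset (Fin n)) = Finset.univ := by
          ext t
          simp
        have h3 : linkDiffs τ (∅ : Finset (Fin n)) = 1 := by simp [linkDiffs, diffs]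
        rw [h2, h3, mul_one] at h1
        rw [LinearMap.smul_apply, ← hgφ, h1, labelWord_eq_prod, hθ, if_pos (by simp),
          evalFunctional_hatWord, hNκ, hfold, mul_smul_comm, coeff_smul, List.map_map,
          ← mul_assoc, smul_eq_mul, smul_eq_mul, ← mul_assoc, mul_assoc (listFactor _ _ _ _)]
        rfl
      · intro W hW
        rw [hθ]
        split_ifs with h
        · exact hψ W h.le hW
        · rfl
      · intro W hW
        rw [LinearMap.smul_apply, hφ W hW, smul_zero]
    rw [key, LinearMap.smul_apply]
    refine smul_ne_zero (mul_ne_zero (mul_ne_zero ?_ hN') hN) hφy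
    refine List.prod_ne_zero ?_
    simp only [List.mem_map, not_exists, not_and]
    exact fun t _ => hatScalar_ne_zero ε (τ t)

end Injective

/-- A detecting functional kills the preceding component of the filtration, so it factors through
the graded piece. -/
theorem linkingMap_injective {V : Type*} [DecidableEq V] [Quiver V] {a b : V}
    (hm : (incidence V).IsSymm) (hab : a ≠ b) :
    Function.Injective (linkingMap a b hm hab) := by
  rw [injective_iff_map_eq_zero]
  intro y hy
  by_contra hy0
  obtain ⟨p, ψ, hψ, h⟩ := exists_detecting_functional hm hab (incidence_linked a b) hy0
  have hpred : (linkingFiltration a b).pred p ≤ LinearMap.ker ψ := by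
    cases p with
    | zero => exact bot_le
    | succ p =>
      change (linkingFiltration a b).F p ≤ _
      rw [linkingFiltration_F, Submodule.span_le]
      rintro _ ⟨W, hW, rfl⟩
      exact hψ W (Nat.lt_succ_of_le hW)
  let ψ' : (linkingFiltration a b).Piece p →ₗ[ℚ] ℚ :=
    Submodule.liftQ _ (ψ ∘ₗ ((linkingFiltration a b).F p).subtype) fun x hx => hpred hx
  refine h (ψ' ∘ₗ DirectSum.component ℚ ℕ (linkingFiltration a b).Piece p ∘ₗ
    (linkingMap a b hm hab).toLinearMap) ?_ ?_
  · intro W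
    rw [LinearMap.comp_apply, LinearMap.comp_apply, AlgHom.toLinearMap_apply,
      linkingMap_word hm hab, AlgFiltration.cls, LinearMap.comp_apply]
    split_ifs with hW
    · subst hW
      rw [DirectSum.component.lof_self]
      rfl
    · rw [DirectSum.component.of, dif_neg hW, map_zero]
  · rw [LinearMap.comp_apply, LinearMap.comp_apply, AlgHom.toLinearMap_apply, hy, map_zero,
      map_zero]

end QuiverLinking

end

theorem mainTheorem1 {V : Type*} [Quiver V] [Finite V] [DecidableEq V]
    [∀ i j : V, Finite (i ⟶ j)]
    (hsymm : ∀ i j : V, Nat.card (i ⟶ j) = Nat.card (j ⟶ i))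
    (a b : V) (hab : a ≠ b) :
    ∃ π : QuiverLinking.QuadAlg (QuiverLinking.Linked a b) →ₐ[ℚ]
        (QuiverLinking.linkingFiltration a b).Gr,
      QuiverLinking.IsLinkingMap a b π ∧
      (∀ π', QuiverLinking.IsLinkingMap a b π' → π' = π) ∧
      Function.Bijective π ∧
      -- the number of generators in a word corresponds to the weight of the associated graded
      (∀ p : ℕ,
        (QuiverLinking.homogeneousPart (QuiverLinking.incidence (QuiverLinking.Linked a b))
            (fun _ => 1) p).map π.toLinearMap =
          LinearMap.range ((QuiverLinking.linkingFiltration a b).cls p)) ∧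
      -- the degrees in `ℤ ^ V × ℤ` correspond to each other
      (∀ g : (V → ℤ) × ℤ,
        (QuiverLinking.homogeneousPart (QuiverLinking.incidence (QuiverLinking.Linked a b))
            (QuiverLinking.reducedDegree a b) g).map π.toLinearMap =
          QuiverLinking.grDegreePart a b g) := by
  have hm : (QuiverLinking.incidence V).IsSymm := by
    ext i j
    exact hsymm j i
  exact ⟨QuiverLinking.linkingMap a b hm hab,
    (QuiverLinking.isLinkingMap_iff a b _).2 (QuiverLinking.linkingMap_gen hm hab),
    fun π' h => QuiverLinking.linkingMap_unique hm hab h,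
    ⟨QuiverLinking.linkingMap_injective hm hab, QuiverLinking.linkingMap_surjective hm hab⟩,
    QuiverLinking.map_homogeneousPart_weight hm hab,
    QuiverLinking.map_homogeneousPart_degree hm hab⟩
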